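/- Let $X$ be a regular projective geometrically irreducible curve of genus $g$ over $\mathbb F_q$, with Artin zeta function $\zeta_X(s)=\sum_{D\ge 0}q^{-s\deg D}$ (sum over effective divisors, continued to $\mathbb C$ as a rational function of $q^{-s}$) and complete zeta function $\widehat\zeta_X(s)=q^{(g-1)s}\zeta_X(s)$. Let $\Phi$ be the (reduced, crystallographic) root system, with complexified span $V$, of a split connected reductive group $G$ over the function field of $X$; let $\Delta=\{\alpha_1,\dots,\alpha_n\}$ be the simple roots for a fixed Borel subgroup, $\Phi^\pm$ the positive and negative roots, $W$ the Weyl group, $\rho=\frac12\sum_{\alpha\in\Phi^+}\alpha$, $\mathrm{ht}\,\alpha^\vee=\langle\rho,\alpha^\vee\rangle$, $\Phi_w=\Phi^+\cap w^{-1}\Phi^-$ for $w\in W$, and let $\lambda_1,\dots,\lambda_n\in V$ be the fundamental weights, $\langle\lambda_i,\alpha_j^\vee\rangle=\delta_{ij}$. Let $P$ be the maximal standard parabolic subgroup attached to $\Delta_p=\Delta\setminus\{\alpha_p\}$, let $\Phi_p$ be the roots in the span of $\Delta_p$, $\rho_p=\frac12\sum_{\alpha\in\Phi_p\cap\Phi^+}\alpha$,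 and $c_p=2\langle\lambda_p-\rho_p,\alpha_p^\vee\rangle$. Put $$\omega_X^G(\lambda)=\sum_{w\in W}\prod_{\alpha\in\Delta}\frac1{1-q^{-\langle w\lambda-\rho,\alpha^\vee\rangle}}\prod_{\alpha\in\Phi_w}\frac{\widehat\zeta_X(\langle\lambda,\alpha^\vee\rangle)}{\widehat\zeta_X(\langle\lambda,\alpha^\vee\rangle+1)},\qquad \lambda=\sum_{j}(1+s_j)\lambda_j,$$ and let $\omega_X^{(G,P)}(s)$, $s=s_p$, be the iterated residue of $\omega_X^G(\lambda)$ at $s_j=0$ for all $j\ne p$, taken one variable at a time in any fixed order. Let $\mathfrak W_p=\{w\in W: w\Delta_p\subset\Delta\cup\Phi^-\}$ and, for integers $k,h$, $$N_{p,w}(k,h)=\#\{\alpha\in w^{-1}\Phi^-:\langle\lambda_p,\alpha^\vee\rangle=k,\ \mathrm{ht}\,\alpha^\vee=h\},\qquad N_p(k,h)=\#\{\alpha\in\Phi:\langle\lambda_p,\alpha^\vee\rangle=k,\ \mathrm{ht}\,\alpha^\vee=h\},$$ $$M_p(k,h)=\max_{w\in\mathfrak W_p}\bigl(N_{p,w}(k,h-1)-N_{p,w}(k,h)\bigr),\qquad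 \widetilde M_p(k,h)=\max_{w\in\mathfrak W_p}\max\bigl(0,\,N_{p,w}(k,h-1)-N_{p,w}(k,h)\bigr).$$ The zeta function of $X$ associated to $(G,P)$ is $\widehat\zeta_X^{(G,P)}(s)=\omega_X^{(G,P)}(s)\prod_{k\ge0}\prod_{h\ge2}\widehat\zeta_X(ks+h)^{\widetilde M_p(k,h)}$. Set $$\Omega_X^{(G,P)}(s)=\omega_X^{(G,P)}(s)\prod_{\alpha\in\Phi^+}\widehat\zeta_X\bigl(\langle\lambda_p,\alpha^\vee\rangle s+\mathrm{ht}\,\alpha^\vee+1\bigr),\qquad D_X^{(G,P)}(s)=\prod_{k\ge0}\prod_{h\ge2}\widehat\zeta_X(ks+h)^{N_p(k,h-1)-M_p(k,h)}.$$ Then $\Omega_X^{(G,P)}$ and $D_X^{(G,P)}$ are meromorphic on $\mathbb C$ and, as identities of meromorphic functions, $$\widehat\zeta_X^{(G,P)}(s)=\frac{\Omega_X^{(G,P)}(s)}{D_X^{(G,P)}(s)},\qquad D_X^{(G,P)}(-c_p-s)=D_X^{(G,P)}(s),\qquad \Omega_X^{(G,P)}(-c_p-s)=\Omega_X^{(G,P)}(s).$$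 -/

import Mathlib

open Filter Topology
open scoped WithZero PowerSeries

noncomputable section

namespace GroupZeta

/-! ## The curve

A regular projective geometrically irreducible curve `X` over a finite field `k` is handled through
its function field `F`: its closed points are the discrete valuations of `F / k`. -/

section Curve

variable (k F : Type*) [Field k] [Field F] [Algebra k F]

/-- `F` is the function field of a regular projective curve over `k`, with field of constants `k`
(for a finite field `k`, the latter says that the curve is geometrically irreducible). -/
structure IsCurveFunctionField : Prop where
  exists_transcendental : ∃ x : F, Transcendental k x ∧
    FiniteDimensional (IntermediateField.adjoin k {x}) F
  constants : ∀ y : F, IsAlgebraic k y → y ∈ Set.range (algebraMap k F)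

/-- A closed point of the curve: a normalized discrete valuation of `F`, trivial on `k`. -/
structure Place where
  val : Valuation F ℤᵐ⁰
  surjective : Function.Surjective val
  trivial : ∀ a : k, a ≠ 0 → val (algebraMap k F a) = 1

variable {k F}

lemma Place.val_algebraMap_le_one (v : Place k F) (a : k) : v.val (algebraMap k F a) ≤ 1 := by
  by_cases h : a = 0
  · simp [h]
  · exact (v.trivial a h).le

/-- The local ring at a closed point. -/
def Place.localRing (v : Place k F) : ValuationSubring F := v.val.valuationSubring

instance (v : Place k F) : Algebra k v.localRing :=
  ((algebraMap k F).codRestrict v.localRing.toSubring v.val_algebraMap_le_one).toAlgebra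

/-- The degree of a closed point: the degree over `k` of its residue field. -/
def Place.degree (v : Place k F) : ℕ :=
  Module.finrank k (IsLocalRing.ResidueField v.localRing)

/-- The degree of a divisor. -/
def divisorDegree (D : Place k F →₀ ℤ) : ℤ := D.sum fun v n => n * v.degree

/-- The degree of an effective divisor. -/
def effectiveDegree (D : Place k F →₀ ℕ) : ℕ := D.sum fun v n => n * v.degree

/-- The space `H⁰(X, O(D))`, consisting of `f` with `ord_v f ≥ -D v` for all `v`. -/
def riemannRochSpace (D : Place k F →₀ ℤ) : Submodule k F where
  carrier := {f | ∀ v : Place k F, v.val f ≤ WithZero.exp (D v)}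
  add_mem' := fun {f g} hf hg v => (v.val.map_add f g).trans (max_le (hf v) (hg v))
  zero_mem' := fun v => by simp
  smul_mem' := fun a f hf v => by
    rw [Algebra.smul_def, map_mul]
    exact (mul_le_of_le_one_left' (v.val_algebraMap_le_one a)).trans (hf v)

variable (k F)

/-- The genus of the curve: the maximum of `deg D + 1 - h⁰(D)` over all divisors `D`. -/
def genus : ℤ :=
  sSup (Set.range fun D : Place k F →₀ ℤ =>
    divisorDegree D + 1 - Module.finrank k (riemannRochSpace D))

/-- The power series `Z_X(T) = ∑_{D ≥ 0} T ^ (deg D)`, the sum over all effective divisors. -/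
def zetaSeries : ℂ⟦X⟧ :=
  PowerSeries.mk fun n => (Nat.card {D : Place k F →₀ ℕ // effectiveDegree D = n} : ℂ)

open Classical in
/-- The (unique) rational function with power series expansion `Z_X(T)`. -/
def zetaRatFunc : RatFunc ℂ :=
  if h : ∃ R : RatFunc ℂ, (R.denom : ℂ⟦X⟧) * zetaSeries k F = (R.num : ℂ⟦X⟧)
  then h.choose else 0

/-- The Artin zeta function `ζ_X(s) = Z_X(q ^ (-s))`, on the whole complex plane. -/
def artinZeta (s : ℂ) : ℂ :=
  (zetaRatFunc k F).eval (RingHom.id ℂ) ((Nat.card k : ℂ) ^ (-s))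

/-- The complete Artin zeta function `q ^ ((g - 1) s) ζ_X(s)`. -/
def completedZeta (s : ℂ) : ℂ :=
  (Nat.card k : ℂ) ^ (((genus k F : ℂ) - 1) * s) * artinZeta k F s

end Curve

/-! ## Residues -/

/-- The residue at `z₀` of a function of one variable that is meromorphic there. -/
def residue (f : ℂ → ℂ) (z₀ : ℂ) : ℂ :=
  limUnder (𝓝[>] (0 : ℝ)) fun r : ℝ => (2 * Real.pi * Complex.I)⁻¹ * ∮ z in C(z₀, r), f z

open Classical in
/-- Iterated residue at `s_j = 0` for the indices `j` in a list, the head of the list first. -/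
def iteratedResidue {J : Type*} : List J → ((J → ℂ) → ℂ) → (J → ℂ) → ℂ
  | [], Ψ => Ψ
  | j :: l, Ψ => iteratedResidue l fun s => residue (fun z => Ψ (Function.update s j z)) 0

/-! ## The root system

`P` is the root system of the split reductive group `G`, on the complex vector space `V` spanned by
the roots; `b` is the set `Δ` of simple roots (the Borel subgroup) and `p` is the simple root that
corresponds to the maximal parabolic subgroup. `P.coroot' i x` is `⟨x, αᵢ^∨⟩`. -/

section RootSystem

variable {ι V V' : Type*} [Fintype ι] [AddCommGroup V] [Module ℂ V] [AddCommGroup V'] [Module ℂ V']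
  {P : RootPairing ι ℂ V V'} (b : P.Base)

open Classical in
/-- The Weyl vector. -/
def rho : V := (1 / 2 : ℂ) • ∑ i with b.IsPos i, P.root i

/-- The height `⟨ρ, αᵢ^∨⟩`. -/
def ht (i : ι) : ℂ := P.coroot' i (rho b)

variable [P.IsRootSystem]

/-- The fundamental weights: `⟨λ_j, αᵢ^∨⟩ = δᵢⱼ` for simple roots. -/
def fundamentalWeight (j : b.support) : V := P.toPerfPair.symm (b.toCoweightBasis.coord j)

/-- The point `λ = ∑ (1 + s_j) λ_j`. -/
def weightOfCoords (s : b.support → ℂ) : V := ∑ j, (1 + s j) • fundamentalWeight b j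

variable (p : b.support)

/-- Membership in `Φ_p`, the root subsystem spanned by `Δ_p = Δ \ {α_p}`. -/
def IsLeviRoot (i : ι) : Prop :=
  P.root i ∈ Submodule.span ℂ (P.root '' {j | j ∈ b.support ∧ j ≠ p})

open Classical in
/-- Half the sum of the positive roots of `Φ_p`. -/
def rhoLevi : V := (1 / 2 : ℂ) • ∑ i with b.IsPos i ∧ IsLeviRoot b p i, P.root i

/-- `c_p = 2 ⟨λ_p - ρ_p, α_p^∨⟩`. -/
def cp : ℂ := 2 * P.coroot' p (fundamentalWeight b p - rhoLevi b p)

/-- The set of Weyl group elements `w` with `w Δ_p ⊆ Δ ∪ Φ⁻`. -/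
def specialWeyl : Set P.weylGroup :=
  {w | ∀ i ∈ b.support, i ≠ p → w • i ∈ b.support ∨ ¬ b.IsPos (w • i)}

open Classical in
/-- The number of `α ∈ w⁻¹ Φ⁻` with `⟨λ_p, α^∨⟩ = m` and `ht α^∨ = h`. -/
def countW (w : P.weylGroup) (m h : ℤ) : ℕ :=
  Finset.card {i : ι | ¬ b.IsPos (w • i) ∧ P.coroot' i (fundamentalWeight b p) = m ∧ ht b i = h}

open Classical in
/-- The number of `α ∈ Φ` with `⟨λ_p, α^∨⟩ = m` and `ht α^∨ = h`. -/
def count (m h : ℤ) : ℕ :=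
  Finset.card {i : ι | P.coroot' i (fundamentalWeight b p) = m ∧ ht b i = h}

/-- `M_p(m, h)`. -/
def maxDrop (m h : ℤ) : ℤ :=
  ⨆ w : specialWeyl b p, ((countW b p w m (h - 1) : ℤ) - countW b p w m h)

/-- `M_p(m, h)` with the negative differences replaced by `0`. -/
def maxPosDrop (m h : ℤ) : ℤ :=
  ⨆ w : specialWeyl b p, max 0 ((countW b p w m (h - 1) : ℤ) - countW b p w m h)

/-! ## Periods and zeta functions of the group -/

variable (k F : Type*) [Field k] [Field F] [Algebra k F]

open Classical in
/-- The period `ω_X^G(λ)`. -/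
def period (x : V) : ℂ :=
  ∑ᶠ w : P.weylGroup,
    (∏ i ∈ b.support, (1 - (Nat.card k : ℂ) ^ (-P.coroot' i (w • x - rho b))))⁻¹ *
      ∏ i with b.IsPos i ∧ ¬ b.IsPos (w • i),
        completedZeta k F (P.coroot' i x) / completedZeta k F (P.coroot' i x + 1)

open Classical in
/-- The period `ω_X^{(G,P)}(s)`: the iterated residue of `ω_X^G` at `s_j = 0`, `j ≠ p`, with
`s = s_p`. The list `l` is the order in which the residues are taken. -/
def parabolicPeriod (l : List b.support) (s : ℂ) : ℂ :=
  iteratedResidue l (fun σ => period b k F (weightOfCoords b σ)) (Pi.single p s)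

/-- The zeta function of `X` associated to `(G, P)`: the period of `(G, P)`, multiplied by the
minimal product of zeta factors that clears the zeta functions in the denominators. -/
def groupZeta (l : List b.support) (s : ℂ) : ℂ :=
  (∏ᶠ (m : ℕ) (h : ℕ) (_ : 2 ≤ h), completedZeta k F (m * s + h) ^ maxPosDrop b p m h) *
    parabolicPeriod b p k F l s

open Classical in
/-- The full factor: the product of `ζ̂_X(⟨λ_p, α^∨⟩ s + ht α^∨ + 1)` over the positive roots. -/
def fullFactor (s : ℂ) : ℂ :=
  ∏ i with b.IsPos i,
    completedZeta k F (P.coroot' i (fundamentalWeight b p) * s + ht b i + 1)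

/-- `Ω_X^{(G,P)}(s)`. -/
def Omega (l : List b.support) (s : ℂ) : ℂ :=
  fullFactor b p k F s * parabolicPeriod b p k F l s

/-- `D_X^{(G,P)}(s)`. -/
def Dfactor (s : ℂ) : ℂ :=
  ∏ᶠ (m : ℕ) (h : ℕ) (_ : 2 ≤ h),
    completedZeta k F (m * s + h) ^ ((count b p m (h - 1) : ℤ) - maxDrop b p m h)

end RootSystem

end GroupZeta

end

/-! Write ζ̂ for the completed zeta function. The functional equation of the period becomes visible
once its zeta denominators are cleared. The full factor turns the zeta part of the term of w into
the product of ζ̂(⟨λ,α^∨⟩) over positive α with wα < 0, times the product of ζ̂(⟨λ,α^∨⟩ + 1) over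
positive α with wα > 0. Since ζ̂(1 - s) = ζ̂(s), the second kind of factor is ζ̂(⟨λ,(-α)^∨⟩). So the
zeta part is the product of ζ̂(⟨λ,α^∨⟩) over all roots α with wα < 0, and the remaining part is the
product of (1 - q^{1-⟨λ,α^∨⟩})⁻¹ over the roots α with wα simple.

The residues only concern α in Δ_p, where ⟨λ,α^∨⟩ = 1 + s_j. Such a root contributes a constant a if
wα is simple, a constant R if wα < 0, and 0 otherwise, because then there is no pole. Hence Ω is a
sum over w of products over all roots, whose factors depend only on the level ⟨λ_p,α^∨⟩, on ht α^∨,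
on ht (wα)^∨ and on the number level · s + height (`omegaSum`, `exists_Omega_eventuallyEq`).

Let w₀ be the longest element of W and w_p that of the Weyl group of Φ_p. Then w_p fixes λ_p, and
w_p⁻¹ρ = ρ - 2ρ_p = c_p λ_p - ρ. The permutation σ : α ↦ -w_p α therefore negates levels and
replaces ht by ht - c_p · level, and τ : w ↦ w₀ w w_p satisfies ht (τ(w)α)^∨ = ht (wσα)^∨
(`exists_symmetry_perm`). Replacing s by -c_p - s just relabels the sum by τ and the products by σ
(`omegaSum_symm`). The same permutations give N_{p,τw}(k,h) = N_p(k, c_p k - h) - N_{p,w}(k, c_p k -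
h). So the exponents of D are invariant under h ↦ c_p k - h + 1 (`exponent_symm`), which is the
reflection that ζ̂(1 - s) = ζ̂(s) requires (`Dfactor_symm`). The quotient formula counts exponents:
w = 1 shows M_p ≥ 0 for h ≥ 2, so truncating at 0 changes nothing.

What is needed of ζ̂ is collected in `IsCompletedZeta`: meromorphy, the functional equation, an at
most simple pole at 1, and no zeros at integers ≥ 2. It is derived from the Riemann-Roch theorem,
proved here with Weil differentials; as k is finite, dimensions are often handled as indices of
additive subgroups. No divisor of degree 1 is required: the zeta function is written with
denominator (1 - T^e)(1 - (qT)^e), where e is the degree of some closed point.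

Identities of meromorphic functions are asserted on codiscrete sets, since values assigned at
singular points carry no meaning. -/

namespace GroupZeta

/-! ### Function fields in one variable: finiteness over k(x) -/

section FunctionField

open IntermediateField algebraAdjoinAdjoin

variable {k F : Type*} [Field k] [Field F] [Algebra k F]

/-- The transcendence degree is at most 1, so any single transcendental element is already a
transcendence basis. -/
lemma IsCurveFunctionField.isAlgebraic_adjoin (hF : IsCurveFunctionField k F) {y : F}
    (hy : Transcendental k y) : Algebra.IsAlgebraic k⟮y⟯ F := by
  obtain ⟨x, hx, hfin⟩ := hF.exists_transcendental
  have halg : Algebra.IsAlgebraic (Algebra.adjoin k {x}) F := by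
    have : Algebra.IsAlgebraic k⟮x⟯ F := inferInstance
    refine ⟨fun a => ?_⟩
    exact (IsFractionRing.isAlgebraic_iff (Algebra.adjoin k {x}) k⟮x⟯ F).mpr (this.isAlgebraic a)
  have htr : Algebra.trdeg k F ≤ 1 := by
    simpa using Algebra.IsAlgebraic.trdeg_le_cardinalMk k ({x} : Set F)
  have hind : AlgebraicIndependent k (fun _ : Unit => y) :=
    algebraicIndependent_unique_type_iff.mpr hy
  have hb : IsTranscendenceBasis k (fun _ : Unit => y) :=
    hind.isTranscendenceBasis_of_lift_trdeg_le
      (lt_of_le_of_lt htr Cardinal.one_lt_aleph0) (by simpa using htr)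
  have := hb.isAlgebraic_field
  rwa [Set.range_const] at this

/-- A function field in one variable is finite over `k(y)` for every nonconstant `y`. -/
lemma IsCurveFunctionField.finiteDimensional_adjoin (hF : IsCurveFunctionField k F) {y : F}
    (hy : Transcendental k y) : FiniteDimensional k⟮y⟯ F := by
  have halg := hF.isAlgebraic_adjoin hy
  obtain ⟨x, hx, hfin⟩ := hF.exists_transcendental
  obtain ⟨s, hs⟩ := hfin.1
  -- Adjoining x and a finite spanning set of F over k(x) gives everything, and these finitely many
  -- elements are algebraic over k(y).
  have key : IntermediateField.adjoin k⟮y⟯ (insert x (s : Set F)) = ⊤ := by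
    rw [eq_top_iff]
    intro f _
    have hf : f ∈ Submodule.span k⟮x⟯ (s : Set F) := by rw [hs]; trivial
    have hx' : ∀ a : k⟮x⟯, (a : F) ∈ IntermediateField.adjoin k⟮y⟯ (insert x (s : Set F)) := by
      intro a
      have h1 : k⟮x⟯ ≤ (IntermediateField.adjoin k⟮y⟯ (insert x (s : Set F))).restrictScalars k := by
        rw [adjoin_simple_le_iff]
        exact subset_adjoin k⟮y⟯ _ (Set.mem_insert _ _)
      exact h1 a.2
    induction hf using Submodule.span_induction with
    | mem a ha => exact subset_adjoin k⟮y⟯ _ (Set.mem_insert_of_mem _ ha)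
    | zero => exact zero_mem _
    | add a b _ _ ha hb => exact add_mem (ha trivial) (hb trivial)
    | smul c a _ ha =>
      rw [IntermediateField.smul_def, smul_eq_mul]
      exact mul_mem (hx' c) (ha trivial)
  have hfd : FiniteDimensional k⟮y⟯ (IntermediateField.adjoin k⟮y⟯ (insert x (s : Set F))) := by
    have : Finite (insert x (s : Set F) : Set F) := (s.finite_toSet.insert x).to_subtype
    exact IntermediateField.finiteDimensional_adjoin fun a _ => (halg.isAlgebraic a).isIntegral
  rw [key] at hfd
  exact Module.Finite.equiv (IntermediateField.topEquiv (F := k⟮y⟯) (E := F)).toLinearEquiv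

/-- Elements of a `k[x]`-submodule `R` of `F` that are linearly independent modulo `x R` are
linearly independent over `k(x)`. -/
lemma linearIndependent_of_mod {x : F} (hx : Transcendental k x) (R : Submodule k F)
    (hR : ∀ f ∈ R, x * f ∈ R) {m : Type*} (y : m → F) (hy : ∀ i, y i ∈ R)
    (hind : ∀ (s : Finset m) (c : m → k), (∃ r ∈ R, ∑ i ∈ s, c i • y i = x * r) →
      ∀ i ∈ s, c i = 0) :
    LinearIndependent k⟮x⟯ y := by
  rw [← LinearIndependent.iff_fractionRing (Algebra.adjoin k {x}) k⟮x⟯, linearIndependent_iff']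
  intro s g hg
  have hg' : ∀ i, ∃ P : Polynomial k, Polynomial.aeval x P = (g i : F) := fun i => by
    have := (Algebra.adjoin_singleton_eq_range_aeval k x).le (g i).2
    exact this
  choose P hP using hg'
  have hx0 : x ≠ 0 := fun h => hx (h ▸ isAlgebraic_zero)
  have hpow : ∀ (Q : Polynomial k), ∀ f ∈ R, Polynomial.aeval x Q * f ∈ R := by
    intro Q f hf
    have hxn : ∀ n : ℕ, x ^ n * f ∈ R := fun n => by
      induction n with
      | zero => simpa
      | succ n ih => rw [pow_succ', mul_assoc]; exact hR _ ih
    rw [Polynomial.aeval_eq_sum_range, Finset.sum_mul]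
    refine Submodule.sum_mem _ fun i _ => ?_
    rw [smul_mul_assoc]
    exact R.smul_mem _ (hxn i)
  -- Infinite descent: in a relation with coefficients in k[x], independence modulo x R kills the
  -- constant terms. The relation can then be divided by x, so every coefficient is divisible by all
  -- powers of X.
  have hdvd : ∀ N : ℕ, ∀ i ∈ s, (Polynomial.X : Polynomial k) ^ N ∣ P i := by
    intro N
    induction N with
    | zero => intro i _; simp
    | succ N ih =>
      have : ∀ i, ∃ Q : Polynomial k, i ∈ s → P i = Polynomial.X ^ N * Q := fun i => by
        by_cases hi : i ∈ s
        · obtain ⟨Q, hQ⟩ := ih i hi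
          exact ⟨Q, fun _ => hQ⟩
        · exact ⟨0, fun h => (hi h).elim⟩
      choose Q hQ using this
      have hsum : ∑ i ∈ s, Polynomial.aeval x (Q i) * y i = 0 := by
        have h0 : x ^ N * ∑ i ∈ s, Polynomial.aeval x (Q i) * y i = 0 := by
          rw [← hg, Finset.mul_sum]
          refine Finset.sum_congr rfl fun i hi => ?_
          rw [Subalgebra.smul_def, smul_eq_mul, ← hP i, hQ i hi]
          simp [mul_assoc]
        exact (mul_eq_zero.mp h0).resolve_left (pow_ne_zero _ hx0)
      have hz := hind s (fun i => (Q i).coeff 0)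
        ⟨-∑ i ∈ s, Polynomial.aeval x (Q i).divX * y i,
          R.neg_mem (Submodule.sum_mem _ fun i _ => hpow _ _ (hy i)), by
          rw [mul_neg, eq_neg_iff_add_eq_zero, Finset.mul_sum, ← Finset.sum_add_distrib, ← hsum]
          refine Finset.sum_congr rfl fun i _ => ?_
          conv_rhs => rw [← Polynomial.divX_mul_X_add (Q i)]
          simp only [map_add, map_mul, Polynomial.aeval_X, Polynomial.aeval_C, Algebra.smul_def]
          ring⟩
      intro i hi
      rw [pow_succ, hQ i hi]
      exact mul_dvd_mul_left _ (Polynomial.X_dvd_iff.mpr (hz i hi))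
  intro i hi
  have hPi : P i = 0 := by
    by_contra hne
    have := Polynomial.natDegree_le_of_dvd (hdvd ((P i).natDegree + 1) i hi) hne
    simp at this
  ext
  rw [← hP i, hPi]
  simp

/-- The index of `x R` in a `k[x]`-submodule `R` of `F` is finite, at most `q ^ [F : k(x)]`. -/
lemma relIndex_mul_le [Finite k] (hF : IsCurveFunctionField k F) {x : F} (hx : Transcendental k x)
    (R S : Submodule k F) (hR : ∀ f ∈ R, x * f ∈ R) (hS : ∀ f, f ∈ S ↔ ∃ r ∈ R, f = x * r) :
    S.toAddSubgroup.relIndex R.toAddSubgroup ≠ 0 ∧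
      S.toAddSubgroup.relIndex R.toAddSubgroup ≤ Nat.card k ^ Module.finrank k⟮x⟯ F := by
  have hfd := hF.finiteDimensional_adjoin hx
  set T := S.comap R.subtype with hT
  have hcard : S.toAddSubgroup.relIndex R.toAddSubgroup = Nat.card (R ⧸ T) := rfl
  have hrank : Module.rank k (R ⧸ T) ≤ (Module.finrank k⟮x⟯ F : ℕ) := by
    refine rank_le fun s hs => ?_
    have hsurj : ∀ i : R ⧸ T, ∃ r : R, T.mkQ r = i := T.mkQ_surjective
    choose l hl using hsurj
    -- Lifts of k-independent elements of R / x R are independent over k(x), which bounds their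
    -- number by [F : k(x)].
    have hli : LinearIndependent k⟮x⟯ (fun i : s => ((l i : R) : F)) := by
      refine linearIndependent_of_mod hx R hR _ (fun i => (l i).2) fun t c hc => ?_
      obtain ⟨r, hr, hcr⟩ := hc
      have hz : ∑ i ∈ t, c i • (i : R ⧸ T) = 0 := by
        have : T.mkQ (∑ i ∈ t, c i • l i) = 0 := by
          rw [Submodule.mkQ_apply, Submodule.Quotient.mk_eq_zero]
          refine (hS _).mpr ?_
          exact ⟨r, hr, by simpa using hcr⟩
        rw [← this, map_sum]
        exact Finset.sum_congr rfl fun i _ => by rw [map_smul, hl]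
      exact linearIndependent_iff'.mp hs t c hz
    simpa using hli.fintype_card_le_finrank
  have hfin : Module.Finite k (R ⧸ T) :=
    Module.finite_of_rank_eq_nat (n := (Module.rank k (R ⧸ T)).toNat)
      (Cardinal.cast_toNat_of_lt_aleph0 (lt_of_le_of_lt hrank (Cardinal.natCast_lt_aleph0))).symm
  have hle : Module.finrank k (R ⧸ T) ≤ Module.finrank k⟮x⟯ F := by
    rw [← Module.finrank_eq_rank] at hrank
    exact_mod_cast hrank
  rw [hcard, Module.natCard_eq_pow_finrank (K := k)]
  exact ⟨pow_ne_zero _ Nat.card_pos.ne', Nat.pow_le_pow_right Nat.card_pos hle⟩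

end FunctionField

end GroupZeta

namespace GroupZeta

/-! ### Existence of closed points -/

section Places

variable {k F : Type*} [Field k] [Field F] [Algebra k F]

lemma IsCurveFunctionField.transcendental_of_notMem_range (hF : IsCurveFunctionField k F) {y : F}
    (hy : y ∉ Set.range (algebraMap k F)) : Transcendental k y :=
  fun h => hy (hF.constants y h)

lemma Place.val_algebraMap_mul (v : Place k F) {a : k} (ha : a ≠ 0) (f : F) :
    v.val (algebraMap k F a * f) = v.val f := by
  rw [map_mul, v.trivial a ha, one_mul]

/-- Every nonconstant function has a zero. -/
lemma IsCurveFunctionField.exists_place [Finite k] (hF : IsCurveFunctionField k F) {x : F}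
    (hx : Transcendental k x) : ∃ v : Place k F, v.val x < 1 := by
  have hx0 : x ≠ 0 := fun h => hx (h ▸ isAlgebraic_zero)
  set A : Subring F := (Algebra.adjoin k {x}).toSubring with hA
  have hxA : x ∈ A := Algebra.subset_adjoin (Set.mem_singleton x)
  -- As x is transcendental it is not a unit of k[x], so some valuation ring B of F contains k[x]
  -- and has x as a nonunit. It remains to see that B is discrete.
  have hI : Ideal.span {(⟨x, hxA⟩ : A)} ≠ ⊤ := by
    intro h
    rw [Ideal.eq_top_iff_one, Ideal.mem_span_singleton'] at h
    obtain ⟨⟨a, ha⟩, h1⟩ := h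
    obtain ⟨P, hP⟩ := (Algebra.adjoin_singleton_eq_range_aeval k x).le ha
    have h1' : a * x = 1 := congrArg Subtype.val h1
    refine hx ⟨P * Polynomial.X - 1, fun h0 => ?_, ?_⟩
    · have := congrArg (Polynomial.eval 0) h0
      simp at this
    · change Polynomial.aeval x P = a at hP
      simp [hP, h1']
  obtain ⟨B, hAB, hIB⟩ := Ideal.image_subset_nonunits_valuationSubring _ hI
  have hxB : x ∈ B.nonunits := hIB ⟨⟨x, hxA⟩, Ideal.mem_span_singleton_self _, rfl⟩
  have hkB : ∀ a : k, algebraMap k F a ∈ B := fun a => hAB (Subalgebra.algebraMap_mem _ a)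
  let R : Submodule k F :=
    { carrier := B
      add_mem' := fun ha hb => B.add_mem _ _ ha hb
      zero_mem' := B.zero_mem
      smul_mem' := fun a f hf => by
        rw [Algebra.smul_def]; exact B.mul_mem _ _ (hkB a) hf }
  -- A nonzero nonunit of B is not in k, hence is transcendental, and the index bound makes B / yB
  -- finite. This forces ideals to be finitely generated.
  have hfin : ∀ y : B, y ≠ 0 → ¬ IsUnit y → Finite (B ⧸ Ideal.span {y}) := by
    intro y hy0 hyu
    have hyt : Transcendental k (y : F) := by
      refine hF.transcendental_of_notMem_range ?_
      rintro ⟨a, ha⟩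
      refine hyu (IsUnit.of_mul_eq_one ⟨algebraMap k F a⁻¹, hkB _⟩ (Subtype.ext ?_))
      have ha0 : a ≠ 0 := by
        rintro rfl
        exact hy0 (Subtype.ext (by simpa using ha.symm))
      change (y : F) * algebraMap k F a⁻¹ = 1
      rw [← ha, ← map_mul, mul_inv_cancel₀ ha0, map_one]
    let S : Submodule k F := R.map (LinearMap.mulLeft k (y : F))
    have h := (relIndex_mul_le hF hyt R S (fun f hf => B.mul_mem _ _ y.2 hf)
      (fun f => by simp [S, Submodule.mem_map, eq_comm])).1
    have hsub : S.toAddSubgroup.addSubgroupOf R.toAddSubgroup =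
        (Ideal.span {y}).toAddSubgroup := by
      ext ⟨f, hf⟩
      rw [AddSubgroup.mem_addSubgroupOf]
      change f ∈ S ↔ (⟨f, hf⟩ : B) ∈ Ideal.span {y}
      rw [Ideal.mem_span_singleton']
      simp only [S, Submodule.mem_map, LinearMap.mulLeft_apply]
      constructor
      · rintro ⟨r, hr, h⟩
        exact ⟨⟨r, hr⟩, Subtype.ext ((mul_comm _ _).trans h)⟩
      · rintro ⟨⟨r, hr⟩, h⟩
        exact ⟨r, hr, by rw [mul_comm]; exact congrArg Subtype.val h⟩
    rw [AddSubgroup.relIndex, hsub] at h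
    exact Nat.finite_of_card_ne_zero h
  have hnoeth : IsNoetherianRing B := by
    rw [isNoetherianRing_iff_ideal_fg]
    intro I
    by_cases hI : I = ⊥
    · rw [hI]; exact Submodule.fg_bot
    obtain ⟨y, hyI, hy0⟩ := Submodule.exists_mem_ne_zero_of_ne_bot hI
    by_cases hyu : IsUnit y
    · rw [Ideal.eq_top_of_isUnit_mem I hyI hyu]
      exact ⟨{1}, by simp⟩
    have := hfin y hy0 hyu
    refine Submodule.fg_of_fg_map_of_fg_inf_ker (Ideal.span {y}).mkQ ?_ ?_
    · exact Submodule.FG.of_finite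
    · rw [Submodule.ker_mkQ, inf_eq_right.mpr ((Ideal.span_singleton_le_iff_mem I).mpr hyI)]
      exact ⟨{y}, by simp⟩
  have hpid : IsPrincipalIdealRing B :=
    ((tfae_of_isNoetherianRing_of_isLocalRing_of_isDomain B).out 0 1).mpr (inferInstance : ValuationRing B)
  have hxB' : x ∈ B := hAB hxA
  have hxm : (⟨x, hxB'⟩ : B) ∈ IsLocalRing.maximalIdeal B := by
    rw [IsLocalRing.mem_maximalIdeal]
    exact B.coe_mem_nonunits_iff.mp hxB
  have hdvr : IsDiscreteValuationRing B :=
    { not_a_field' := fun h => hx0 (by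
        rw [h] at hxm
        exact congrArg Subtype.val ((Submodule.mem_bot B).mp hxm)) }
  let w := IsDiscreteValuationRing.maximalIdeal B
  refine ⟨⟨w.valuation F, w.valuation_surjective F, fun a ha => ?_⟩, ?_⟩
  · have hle : ∀ c : k, w.valuation F (algebraMap k F c) ≤ 1 := fun c =>
      w.valuation_le_one (K := F) (⟨algebraMap k F c, hkB c⟩ : B)
    refine le_antisymm (hle a) ?_
    have h2 := hle a⁻¹
    rw [map_inv₀, map_inv₀] at h2
    exact (inv_le_one₀ (zero_lt_iff.mpr ((Valuation.ne_zero_iff _).mpr (by simpa using ha)))).mp h2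
  · exact (w.valuation_lt_one_iff_mem (K := F) (⟨x, hxB'⟩ : B)).mpr hxm

end Places

end GroupZeta

namespace GroupZeta

/-! ### Local indices and residue fields -/

section LocalIndex

variable {k F : Type*} [Field k] [Field F] [Algebra k F]

lemma exp_le_one_iff {n : ℤ} : WithZero.exp n ≤ 1 ↔ n ≤ 0 := by
  rw [← WithZero.exp_zero, WithZero.exp_le_exp]

lemma lt_one_iff_le_exp_neg_one {x : ℤᵐ⁰} : x < 1 ↔ x ≤ WithZero.exp (-1 : ℤ) := by
  have h := WithZero.lt_mul_exp_iff_le (x := x) (y := WithZero.exp (-1 : ℤ)) (by simp)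
  rw [← WithZero.exp_add] at h
  simpa using h

lemma Place.exists_val_eq (v : Place k F) (n : ℤ) : ∃ f : F, f ≠ 0 ∧ v.val f = WithZero.exp n := by
  obtain ⟨f, hf⟩ := v.surjective (WithZero.exp n)
  refine ⟨f, ?_, hf⟩
  rintro rfl
  rw [map_zero] at hf
  exact WithZero.exp_ne_zero hf.symm

lemma Place.ext' {v w : Place k F} (h : v.val = w.val) : v = w := by
  cases v; cases w; cases h; rfl

/-- The functions with a pole of order at most `n` at `v`. -/
def Place.ball (v : Place k F) (n : ℤ) : Submodule k F where
  carrier := {f | v.val f ≤ WithZero.exp n}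
  add_mem' := fun {f g} hf hg => (v.val.map_add f g).trans (max_le hf hg)
  zero_mem' := by simp
  smul_mem' := fun a f hf => by
    change v.val (a • f) ≤ _
    rw [Algebra.smul_def, map_mul]
    exact (mul_le_of_le_one_left' (v.val_algebraMap_le_one a)).trans hf

lemma Place.mem_ball {v : Place k F} {n : ℤ} {f : F} :
    f ∈ v.ball n ↔ v.val f ≤ WithZero.exp n := Iff.rfl

lemma Place.ball_mono (v : Place k F) {m n : ℤ} (h : m ≤ n) : v.ball m ≤ v.ball n :=
  fun _ hf => le_trans hf (WithZero.exp_le_exp.mpr h)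

lemma Place.relIndex_ball_zero (v : Place k F) :
    (v.ball (-1)).toAddSubgroup.relIndex (v.ball 0).toAddSubgroup =
      Nat.card (IsLocalRing.ResidueField v.localRing) := by
  have hsub : (v.ball (-1)).toAddSubgroup.addSubgroupOf (v.ball 0).toAddSubgroup =
      (IsLocalRing.maximalIdeal v.localRing).toAddSubgroup := by
    ext ⟨f, hf⟩
    rw [AddSubgroup.mem_addSubgroupOf]
    change f ∈ v.ball (-1) ↔ (⟨f, hf⟩ : v.localRing) ∈ IsLocalRing.maximalIdeal v.localRing
    rw [IsLocalRing.mem_maximalIdeal, mem_nonunits_iff, Place.mem_ball, ← lt_one_iff_le_exp_neg_one]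
    exact (Valuation.Integer.not_isUnit_iff_valuation_lt_one (v := v.val) (x := ⟨f, hf⟩)).symm
  rw [AddSubgroup.relIndex, hsub]
  rfl

lemma Place.map_mulLeft_ball (v : Place k F) {u : F} (hu : u ≠ 0) {m : ℤ}
    (hm : v.val u = WithZero.exp m) (n : ℤ) :
    (v.ball n).toAddSubgroup.map (AddMonoidHom.mulLeft u) = (v.ball (n + m)).toAddSubgroup := by
  ext f
  simp only [AddSubgroup.mem_map, Submodule.mem_toAddSubgroup, Place.mem_ball,
    AddMonoidHom.coe_mulLeft]
  constructor
  · rintro ⟨g, hg, rfl⟩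
    rw [map_mul, hm, mul_comm, WithZero.exp_add]
    gcongr
  · intro hf
    refine ⟨u⁻¹ * f, ?_, by rw [mul_inv_cancel_left₀ hu]⟩
    rw [map_mul, map_inv₀, hm, ← WithZero.exp_neg]
    calc WithZero.exp (-m) * v.val f ≤ WithZero.exp (-m) * WithZero.exp (n + m) := by gcongr
      _ = WithZero.exp n := by rw [← WithZero.exp_add]; congr 1; ring

lemma Place.relIndex_ball_succ (v : Place k F) (n : ℤ) :
    (v.ball n).toAddSubgroup.relIndex (v.ball (n + 1)).toAddSubgroup =
      Nat.card (IsLocalRing.ResidueField v.localRing) := by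
  obtain ⟨u, hu, hun⟩ := v.exists_val_eq (n + 1)
  have h1 := v.map_mulLeft_ball hu hun (-1)
  have h2 := v.map_mulLeft_ball hu hun 0
  rw [show -1 + (n + 1) = n by ring] at h1
  rw [zero_add] at h2
  rw [← h1, ← h2, AddSubgroup.relIndex_map_map_of_injective _ _ (mul_right_injective₀ hu),
    v.relIndex_ball_zero]

variable [Finite k] (hF : IsCurveFunctionField k F)
include hF

/-- Residue fields are finite. -/
lemma IsCurveFunctionField.finite_residueField (v : Place k F) :
    Finite (IsLocalRing.ResidueField v.localRing) := by
  obtain ⟨u, hu, hu1⟩ := v.exists_val_eq (-1)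
  have hut : Transcendental k u := by
    refine hF.transcendental_of_notMem_range ?_
    rintro ⟨a, rfl⟩
    have ha : a ≠ 0 := by rintro rfl; simp at hu
    rw [v.trivial a ha, ← WithZero.exp_zero, WithZero.exp_inj] at hu1
    omega
  refine Nat.finite_of_card_ne_zero ?_
  rw [← v.relIndex_ball_zero]
  refine (relIndex_mul_le hF hut (v.ball 0) (v.ball (-1)) (fun f hf => ?_) (fun f => ?_)).1
  · rw [Place.mem_ball, map_mul, hu1]
    exact mul_le_of_le_one_of_le (by rw [exp_le_one_iff]; omega) hf
  · have h1 := v.map_mulLeft_ball hu hu1 0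
    rw [zero_add] at h1
    have : f ∈ (v.ball (-1)).toAddSubgroup ↔ ∃ r ∈ v.ball 0, f = u * r := by
      rw [← h1]
      simp [AddSubgroup.mem_map, eq_comm]
    exact this

lemma IsCurveFunctionField.card_residueField (v : Place k F) :
    Nat.card (IsLocalRing.ResidueField v.localRing) = Nat.card k ^ v.degree := by
  have := hF.finite_residueField v
  have : Module.Finite k (IsLocalRing.ResidueField v.localRing) := Module.Finite.of_finite
  exact Module.natCard_eq_pow_finrank

lemma IsCurveFunctionField.degree_pos (v : Place k F) : 0 < v.degree := by
  have := hF.finite_residueField v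
  have : Module.Finite k (IsLocalRing.ResidueField v.localRing) := Module.Finite.of_finite
  exact Module.finrank_pos

lemma IsCurveFunctionField.relIndex_ball (v : Place k F) (m : ℤ) (n : ℕ) :
    (v.ball m).toAddSubgroup.relIndex (v.ball (m + n)).toAddSubgroup =
      Nat.card k ^ (n * v.degree) := by
  induction n with
  | zero => simp
  | succ n ih =>
    have h1 : (v.ball m).toAddSubgroup ≤ (v.ball (m + n)).toAddSubgroup :=
      v.ball_mono (by omega)
    have h2 : (v.ball (m + n)).toAddSubgroup ≤ (v.ball (m + n + 1)).toAddSubgroup :=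
      v.ball_mono (by omega)
    rw [Nat.cast_succ, ← add_assoc, ← AddSubgroup.relIndex_mul_relIndex _ _ _ h1 h2, ih,
      v.relIndex_ball_succ, hF.card_residueField, ← pow_add]
    congr 1
    ring

end LocalIndex

/-! ### Weak approximation -/

section WeakApproximation

variable {k F : Type*} [Field k] [Field F] [Algebra k F]

lemma log_val_mul (v : Place k F) {f g : F} (hf : f ≠ 0) (hg : g ≠ 0) :
    WithZero.log (v.val (f * g)) = WithZero.log (v.val f) + WithZero.log (v.val g) := by
  rw [map_mul, WithZero.log_mul (by simpa) (by simpa)]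

lemma Place.val_eq_exp (v : Place k F) {f : F} (hf : f ≠ 0) :
    v.val f = WithZero.exp (WithZero.log (v.val f)) :=
  (WithZero.exp_log (by simpa)).symm

/-- If v(f) < 1 always implied w(f) < 1, then log w would be a positive integer multiple of log v;
both valuations being normalized, the factor is 1 and v = w. -/
lemma Place.exists_lt_one_one_le {v w : Place k F} (h : v ≠ w) :
    ∃ a : F, v.val a < 1 ∧ 1 ≤ w.val a := by
  by_contra! hcon
  have lv : ∀ f : F, f ≠ 0 → (WithZero.log (v.val f) < 0 → WithZero.log (w.val f) < 0) := by
    intro f hf hlt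
    have h1 : v.val f < 1 := by
      rw [v.val_eq_exp hf, ← WithZero.exp_zero, WithZero.exp_lt_exp]; exact hlt
    have h2 := hcon f h1
    rwa [w.val_eq_exp hf, ← WithZero.exp_zero, WithZero.exp_lt_exp] at h2
  obtain ⟨u, hu, hu1⟩ := v.exists_val_eq (-1)
  have hvu : WithZero.log (v.val u) = -1 := by rw [hu1, WithZero.log_exp]
  -- If v(f) = 1 but w(f) > 1, a high power of f times a uniformizer u of v violates the assumed
  -- implication.
  have lz : ∀ f : F, f ≠ 0 → WithZero.log (v.val f) = 0 → WithZero.log (w.val f) = 0 := by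
    have half : ∀ f : F, f ≠ 0 → WithZero.log (v.val f) = 0 → WithZero.log (w.val f) ≤ 0 := by
      intro f hf h0
      by_contra! hpos
      set c := WithZero.log (w.val u)
      have h3 := lv (f ^ c.natAbs * u) (mul_ne_zero (pow_ne_zero _ hf) hu) (by
        rw [log_val_mul _ (pow_ne_zero _ hf) hu, map_pow, WithZero.log_pow, h0, hvu]; simp)
      rw [log_val_mul _ (pow_ne_zero _ hf) hu, map_pow, WithZero.log_pow, nsmul_eq_mul] at h3
      have : (c.natAbs : ℤ) * 1 ≤ c.natAbs * WithZero.log (w.val f) := by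
        apply mul_le_mul_of_nonneg_left _ (by positivity); omega
      have h4 : c = WithZero.log (w.val u) := rfl
      omega
    intro f hf h0
    refine le_antisymm (half f hf h0) ?_
    have := half f⁻¹ (inv_ne_zero hf) (by rw [map_inv₀, WithZero.log_inv, h0, neg_zero])
    rw [map_inv₀, WithZero.log_inv] at this
    omega
  set c := -WithZero.log (w.val u) with hc
  have hlin : ∀ f : F, f ≠ 0 → WithZero.log (w.val f) = c * WithZero.log (v.val f) := by
    intro f hf
    have hun : u ^ WithZero.log (v.val f) ≠ 0 := zpow_ne_zero _ hu
    have := lz (f * u ^ WithZero.log (v.val f)) (mul_ne_zero hf hun) (by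
      rw [log_val_mul _ hf hun, map_zpow₀, WithZero.log_zpow, hvu]; simp)
    rw [log_val_mul _ hf hun, map_zpow₀, WithZero.log_zpow, smul_eq_mul] at this
    rw [hc]; linarith
  have hcpos : 0 < c := by have := lv u hu (by omega); omega
  -- Surjectivity of w makes c a divisor of 1.
  obtain ⟨t, ht, ht1⟩ := w.exists_val_eq 1
  have hc1 : c = 1 := by
    have := hlin t ht
    rw [ht1, WithZero.log_exp] at this
    exact Int.eq_one_of_dvd_one hcpos.le ⟨_, this⟩
  refine h (Place.ext' (Valuation.ext fun f => ?_))
  by_cases hf : f = 0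
  · simp [hf]
  · rw [v.val_eq_exp hf, w.val_eq_exp hf, hlin f hf, hc1, one_mul]

lemma Place.exists_lt_one_one_lt {v w : Place k F} (h : v ≠ w) :
    ∃ a : F, v.val a < 1 ∧ 1 < w.val a := by
  obtain ⟨a, ha1, ha2⟩ := Place.exists_lt_one_one_le h
  obtain ⟨b, hb1, hb2⟩ := Place.exists_lt_one_one_le h.symm
  have hb0 : b ≠ 0 := by rintro rfl; simp at hb2
  refine ⟨a / b, ?_, ?_⟩
  · rw [map_div₀]
    exact (div_lt_one₀ (lt_of_lt_of_le zero_lt_one hb2)).mpr (ha1.trans_le hb2)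
  · rw [map_div₀]
    exact (one_lt_div₀ (by simpa [zero_lt_iff] using hb0)).mpr (hb1.trans_le ha2)

lemma exists_pow_gt {x y : ℤᵐ⁰} (hx : 1 < x) (hy : y ≠ 0) : ∀ᶠ n : ℕ in atTop, y < x ^ n := by
  have hx0 : x ≠ 0 := (zero_lt_one.trans hx).ne'
  have h1 : 0 < WithZero.log x := by rwa [WithZero.lt_log_iff_exp_lt hx0, WithZero.exp_zero]
  filter_upwards [eventually_gt_atTop (WithZero.log y).natAbs] with n hn
  rw [← WithZero.log_lt_log hy (pow_ne_zero _ hx0), WithZero.log_pow, nsmul_eq_mul]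
  have : (n : ℤ) * 1 ≤ n * WithZero.log x := mul_le_mul_of_nonneg_left (by omega) (by positivity)
  omega

/-- Induction on S: y works for S and u for the new place. If y fails at the new place, y + uⁿ works
for large n. -/
lemma Place.exists_lt_one_forall_one_lt (v : Place k F) (S : Finset (Place k F)) (hv : v ∉ S) :
    ∃ y : F, v.val y < 1 ∧ ∀ w ∈ S, 1 < w.val y := by
  classical
  induction S using Finset.induction_on with
  | empty => exact ⟨0, by simp, by simp⟩
  | insert w S hw ih =>
    obtain ⟨y, hy1, hy2⟩ := ih (fun h => hv (Finset.mem_insert_of_mem h))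
    obtain ⟨u, hu1, hu2⟩ := Place.exists_lt_one_one_lt (v := v) (w := w)
      (fun h => hv (h ▸ Finset.mem_insert_self _ _))
    by_cases hyw : 1 < w.val y
    · exact ⟨y, hy1, fun w' hw' => by
        rcases Finset.mem_insert.mp hw' with rfl | h
        exacts [hyw, hy2 _ h]⟩
    -- For large n one of the two summands strictly dominates: uⁿ if w'(u) > 1, and y otherwise.
    have hev : ∀ w' ∈ S, ∀ᶠ n : ℕ in atTop, 1 < w'.val (y + u ^ n) := by
      intro w' hw'
      have hy := hy2 w' hw'
      by_cases hu : 1 < w'.val u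
      · filter_upwards [exists_pow_gt hu (zero_lt_one.trans hy).ne'] with n hn
        rw [Valuation.map_add_eq_of_lt_right _ (by rwa [map_pow])]
        rw [map_pow]; exact hy.trans hn
      · filter_upwards with n
        rw [Valuation.map_add_eq_of_lt_left _ ?_]
        · exact hy
        · rw [map_pow]; exact (pow_le_one₀ zero_le (not_lt.mp hu)).trans_lt hy
    obtain ⟨n, hn, hn0⟩ := (((S.eventually_all).mpr hev).and (eventually_gt_atTop 0)).exists
    refine ⟨y + u ^ n, ?_, fun w' hw' => ?_⟩
    · refine (v.val.map_add _ _).trans_lt (max_lt hy1 ?_)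
      rw [map_pow]; exact pow_lt_one₀ zero_le hu1 hn0.ne'
    · rcases Finset.mem_insert.mp hw' with rfl | h
      · have : 1 < w'.val (u ^ n) := by rw [map_pow]; exact one_lt_pow₀ hu2 hn0.ne'
        rw [Valuation.map_add_eq_of_lt_right _ ((not_lt.mp hyw).trans_lt this)]
        exact this
      · exact hn w' h

lemma Place.exists_near_one (v : Place k F) (S : Finset (Place k F)) (hv : v ∉ S) {c : ℤᵐ⁰}
    (hc : c ≠ 0) : ∃ e : F, v.val (e - 1) ≤ c ∧ ∀ w ∈ S, w.val e ≤ c := by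
  obtain ⟨y, hy1, hy2⟩ := v.exists_lt_one_forall_one_lt S hv
  have hev : ∀ᶠ n : ℕ in atTop, v.val y ^ n ≤ c := by
    by_cases hy0 : v.val y = 0
    · filter_upwards [eventually_gt_atTop 0] with n hn
      rw [hy0, zero_pow hn.ne']; exact zero_le
    · filter_upwards [exists_pow_gt ((one_lt_inv₀ (zero_lt_iff.mpr hy0)).mpr hy1)
        (inv_ne_zero hc)] with n hn
      rw [inv_pow] at hn
      exact ((inv_lt_inv₀ (zero_lt_iff.mpr hc) (zero_lt_iff.mpr (pow_ne_zero _ hy0))).mp hn).le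
  have hev2 : ∀ w ∈ S, ∀ᶠ n : ℕ in atTop, c⁻¹ < w.val y ^ n := fun w hw =>
    exists_pow_gt (hy2 w hw) (inv_ne_zero hc)
  obtain ⟨n, ⟨hn, hn2⟩, hn0⟩ :=
    ((hev.and ((S.eventually_all).mpr hev2)).and (eventually_gt_atTop 0)).exists
  have h1 : v.val (1 + y ^ n) = 1 := by
    rw [Valuation.map_add_eq_of_lt_left _ (by
      rw [map_pow, map_one]; exact pow_lt_one₀ zero_le hy1 hn0.ne'), map_one]
  have hne : 1 + y ^ n ≠ 0 := by intro h; simp [h] at h1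
  -- Where y is small, (1 + yⁿ)⁻¹ tends to 1; where y is large, it tends to 0.
  refine ⟨(1 + y ^ n)⁻¹, ?_, fun w hw => ?_⟩
  · rw [show (1 + y ^ n)⁻¹ - 1 = -(y ^ n) * (1 + y ^ n)⁻¹ by field_simp; ring, map_mul, map_inv₀, h1,
      Valuation.map_neg, map_pow, inv_one, mul_one]
    exact hn
  · have h2 : w.val (1 + y ^ n) = w.val y ^ n := by
      rw [Valuation.map_add_eq_of_lt_right _ (by
        rw [map_one, map_pow]; exact one_lt_pow₀ (hy2 w hw) hn0.ne'), map_pow]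
    rw [map_inv₀, h2]
    exact (inv_lt_of_inv_lt₀ (zero_lt_iff.mpr hc) (hn2 w hw)).le

/-- Weak approximation. -/
lemma Place.exists_approx (S : Finset (Place k F)) (α : Place k F → F) (n : ℤ) :
    ∃ f : F, ∀ v ∈ S, v.val (f - α v) ≤ WithZero.exp n := by
  classical
  set m : ℤ := ∑ v ∈ S, ∑ w ∈ S, |WithZero.log (w.val (α v))| with hm
  have hbound : ∀ v ∈ S, ∀ w ∈ S, w.val (α v) ≤ WithZero.exp m := by
    intro v hv w hw
    by_cases h0 : α v = 0
    · simp [h0]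
    rw [w.val_eq_exp h0, WithZero.exp_le_exp]
    calc _ ≤ |WithZero.log (w.val (α v))| := le_abs_self _
      _ ≤ ∑ w ∈ S, |WithZero.log (w.val (α v))| :=
        Finset.single_le_sum (f := fun w => |WithZero.log (w.val (α v))|)
          (fun _ _ => abs_nonneg _) hw
      _ ≤ m := Finset.single_le_sum (f := fun v => ∑ w ∈ S, |WithZero.log (w.val (α v))|)
          (fun _ _ => Finset.sum_nonneg fun _ _ => abs_nonneg _) hv
  have hex : ∀ v : Place k F, ∃ e : F, v.val (e - 1) ≤ WithZero.exp (n - m) ∧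
      ∀ w ∈ S.erase v, w.val e ≤ WithZero.exp (n - m) := fun v =>
    v.exists_near_one (S.erase v) (Finset.notMem_erase v S) (by simp)
  choose e he1 he2 using hex
  refine ⟨∑ v ∈ S, α v * e v, fun w hw => ?_⟩
  have hsplit : ∑ v ∈ S, α v * e v - α w =
      ∑ v ∈ S, α v * (e v - if v = w then 1 else 0) := by
    simp only [mul_sub, Finset.sum_sub_distrib, mul_ite, mul_one, mul_zero]
    rw [Finset.sum_ite_eq' S w, if_pos hw]
  rw [hsplit]
  refine Valuation.map_sum_le _ fun v hv => ?_
  have hval : w.val (e v - if v = w then 1 else 0) ≤ WithZero.exp (n - m) := by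
    split_ifs with h
    · rw [← h]; exact he1 v
    · rw [sub_zero]; exact he2 v w (Finset.mem_erase.mpr ⟨fun h' => h h'.symm, hw⟩)
  rw [map_mul]
  calc _ ≤ WithZero.exp m * WithZero.exp (n - m) := mul_le_mul' (hbound v hv w hw) hval
    _ = WithZero.exp n := by rw [← WithZero.exp_add]; congr 1; ring

end WeakApproximation

end GroupZeta

namespace GroupZeta

/-! ### Degrees, boxes of repartitions, and zeros of functions -/

section Divisors

variable {k F : Type*} [Field k] [Field F] [Algebra k F]

lemma divisorDegree_add (D E : Place k F →₀ ℤ) :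
    divisorDegree (D + E) = divisorDegree D + divisorDegree E :=
  Finsupp.sum_add_index' (fun _ => by simp) (fun _ _ _ => by ring)

@[simp] lemma divisorDegree_zero : divisorDegree (0 : Place k F →₀ ℤ) = 0 :=
  Finsupp.sum_zero_index

@[simp] lemma divisorDegree_neg (D : Place k F →₀ ℤ) : divisorDegree (-D) = -divisorDegree D := by
  have := divisorDegree_add D (-D)
  rw [add_neg_cancel, divisorDegree_zero] at this
  omega

lemma divisorDegree_sub (D E : Place k F →₀ ℤ) :
    divisorDegree (D - E) = divisorDegree D - divisorDegree E := by
  rw [sub_eq_add_neg, divisorDegree_add, divisorDegree_neg]; ring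

@[simp] lemma divisorDegree_single (v : Place k F) (n : ℤ) :
    divisorDegree (Finsupp.single v n) = n * v.degree :=
  Finsupp.sum_single_index (by simp)

lemma divisorDegree_nsmul (n : ℕ) (D : Place k F →₀ ℤ) :
    divisorDegree (n • D) = n * divisorDegree D := by
  induction n with
  | zero => simp
  | succ n ih => rw [succ_nsmul, divisorDegree_add, ih]; push_cast; ring

lemma divisorDegree_nonneg {D : Place k F →₀ ℤ} (h : 0 ≤ D) : 0 ≤ divisorDegree D :=
  Finset.sum_nonneg fun v _ => mul_nonneg (h v) (by positivity)

lemma divisorDegree_mono {D E : Place k F →₀ ℤ} (h : D ≤ E) :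
    divisorDegree D ≤ divisorDegree E := by
  have := divisorDegree_nonneg (D := E - D) (fun v => by simpa using h v)
  rw [divisorDegree_sub] at this
  omega

/-- The repartitions (families of functions indexed by the closed points) bounded by `D`. -/
def box (D : Place k F →₀ ℤ) : Submodule k (Place k F → F) where
  carrier := {α | ∀ v, v.val (α v) ≤ WithZero.exp (D v)}
  add_mem' := fun {_ _} ha hb v => (v.ball (D v)).add_mem (ha v) (hb v)
  zero_mem' := fun v => (v.ball (D v)).zero_mem
  smul_mem' := fun a _ ha v => (v.ball (D v)).smul_mem a (ha v)

lemma mem_box {D : Place k F →₀ ℤ} {α : Place k F → F} :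
    α ∈ box D ↔ ∀ v, v.val (α v) ≤ WithZero.exp (D v) := Iff.rfl

lemma box_mono {D E : Place k F →₀ ℤ} (h : D ≤ E) : box D ≤ box E :=
  fun _ hα v => (hα v).trans (WithZero.exp_le_exp.mpr (h v))

/-- The diagonal embedding of the function field into the repartitions. -/
def diag : F →ₗ[k] (Place k F → F) := LinearMap.pi fun _ => LinearMap.id

variable [Finite k] (hF : IsCurveFunctionField k F)
include hF

/-- The two boxes differ only in the coordinate v, so evaluation at v reduces the index to a local
one. -/
lemma IsCurveFunctionField.relIndex_box_single (D : Place k F →₀ ℤ) (v : Place k F) (n : ℕ) :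
    (box D).toAddSubgroup.relIndex (box (D + Finsupp.single v (n : ℤ))).toAddSubgroup =
      Nat.card k ^ (n * v.degree) := by
  classical
  set E := D + Finsupp.single v (n : ℤ)
  have hEv : E v = D v + n := by simp [E]
  have hle : D ≤ E := le_add_of_nonneg_right (Finsupp.single_nonneg.mpr (by positivity))
  let ev : (Place k F → F) →+ F := Pi.evalAddMonoidHom _ v
  have h1 : (box D).toAddSubgroup =
      (v.ball (D v)).toAddSubgroup.comap ev ⊓ (box E).toAddSubgroup := by
    ext α
    simp only [AddSubgroup.mem_inf, AddSubgroup.mem_comap, Submodule.mem_toAddSubgroup]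
    refine ⟨fun h => ⟨h v, box_mono hle h⟩, fun h w => ?_⟩
    by_cases hw : w = v
    · subst hw; exact h.1
    · have := h.2 w
      rwa [show E w = D w by simp [E, Ne.symm hw]] at this
  have h2 : (box E).toAddSubgroup.map ev = (v.ball (D v + n)).toAddSubgroup := by
    ext f
    simp only [AddSubgroup.mem_map, Submodule.mem_toAddSubgroup]
    constructor
    · rintro ⟨α, hα, rfl⟩
      have := hα v
      rwa [hEv] at this
    · intro hf
      refine ⟨Pi.single v f, fun w => ?_, by simp [ev]⟩
      by_cases hw : w = v
      · subst hw; rw [Pi.single_eq_same, hEv]; exact hf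
      · rw [Pi.single_eq_of_ne hw, map_zero]; exact zero_le
  rw [h1, AddSubgroup.inf_relIndex_right, AddSubgroup.relIndex_comap, h2, hF.relIndex_ball]

lemma IsCurveFunctionField.relIndex_box {D E : Place k F →₀ ℤ} (h : D ≤ E) :
    (box D).toAddSubgroup.relIndex (box E).toAddSubgroup =
      Nat.card k ^ (divisorDegree E - divisorDegree D).toNat := by
  classical
  have key : ∀ n : Place k F →₀ ℤ, 0 ≤ n → (box D).toAddSubgroup.relIndex (box (D + n)).toAddSubgroup =
      Nat.card k ^ (divisorDegree n).toNat := by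
    intro n
    induction n using Finsupp.induction with
    | zero => intro; simp
    | single_add v m n hv hm ih =>
      intro hpos
      have hm0 : 0 ≤ m := by
        have := hpos v
        simpa [Finsupp.notMem_support_iff.mp hv] using this
      have hn0 : 0 ≤ n := by
        intro w
        by_cases hw : w = v
        · subst hw; rw [Finsupp.notMem_support_iff.mp hv]; rfl
        · have := hpos w
          simpa [Finsupp.single_apply, Ne.symm hw] using this
      obtain ⟨m, rfl⟩ := Int.eq_ofNat_of_zero_le hm0
      have h1 : (box D).toAddSubgroup ≤ (box (D + n)).toAddSubgroup :=
        box_mono (le_add_of_nonneg_right hn0)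
      have h2 : (box (D + n)).toAddSubgroup ≤
          (box (D + n + Finsupp.single v (m : ℤ))).toAddSubgroup :=
        box_mono (le_add_of_nonneg_right (Finsupp.single_nonneg.mpr hm0))
      rw [add_comm (Finsupp.single v _) n, ← add_assoc,
        ← AddSubgroup.relIndex_mul_relIndex _ _ _ h1 h2, ih hn0, hF.relIndex_box_single, ← pow_add,
        divisorDegree_add, divisorDegree_single,
        Int.toNat_add (divisorDegree_nonneg hn0) (by positivity)]
      rfl
  have := key (E - D) (sub_nonneg.mpr h)
  rwa [add_sub_cancel, divisorDegree_sub] at this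

/-- For the ring R of functions integral at S, weak approximation identifies R / x R with the
product of the local quotients, whose size is governed by the orders of the zeros. The index of x R
in R is at most q^[F : k(x)]. -/
lemma IsCurveFunctionField.sum_zeros_le {x : F} (hx : Transcendental k x) (S : Finset (Place k F))
    (hS : ∀ v ∈ S, v.val x < 1) :
    ∑ v ∈ S, -WithZero.log (v.val x) * v.degree ≤
      Module.finrank (IntermediateField.adjoin k {x}) F := by
  classical
  have hx0 : x ≠ 0 := fun h => hx (h ▸ isAlgebraic_zero)
  set D : Place k F →₀ ℤ := Finsupp.indicator S fun v _ => WithZero.log (v.val x) with hD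
  have hDS : ∀ v ∈ S, WithZero.exp (D v) = v.val x := fun v hv => by
    rw [hD, Finsupp.indicator_of_mem hv, ← v.val_eq_exp hx0]
  have hD0 : ∀ v, v ∉ S → D v = 0 := fun v hv => Finsupp.indicator_of_notMem hv _
  have hDle : D ≤ 0 := fun v => by
    by_cases hv : v ∈ S
    · have := (hS v hv).le
      rw [← hDS v hv, exp_le_one_iff] at this
      exact this
    · rw [hD0 v hv]; rfl
  have hdeg : divisorDegree D = ∑ v ∈ S, WithZero.log (v.val x) * v.degree := by
    rw [divisorDegree, Finsupp.sum_of_support_subset _ (Finsupp.support_indicator_subset _ _) _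
      (by simp)]
    exact Finset.sum_congr rfl fun v hv => by rw [Finsupp.indicator_of_mem hv]
  -- The diagonal embedding restricted to S: the preimage of `box 0` is R, and that of `box D` is x
  -- R, since D records log v(x) on S.
  let φ : F →ₗ[k] (Place k F → F) :=
    LinearMap.pi fun v => if v ∈ S then LinearMap.id else 0
  have hφ1 : ∀ v ∈ S, ∀ f, φ f v = f := fun v hv f => by simp [φ, hv]
  have hφ0 : ∀ v, v ∉ S → ∀ f, φ f v = 0 := fun v hv f => by simp [φ, hv]
  have hmem : ∀ E : Place k F →₀ ℤ, ∀ f,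
      f ∈ (box E).comap φ ↔ ∀ v ∈ S, v.val f ≤ WithZero.exp (E v) := by
    intro E f
    rw [Submodule.mem_comap, mem_box]
    refine ⟨fun h v hv => by simpa [hφ1 v hv] using h v, fun h v => ?_⟩
    by_cases hv : v ∈ S
    · rw [hφ1 v hv]; exact h v hv
    · rw [hφ0 v hv, map_zero]; exact zero_le
  have hidx := (relIndex_mul_le hF hx ((box 0).comap φ) ((box D).comap φ) (fun f hf => by
    rw [hmem] at hf ⊢
    intro v hv
    rw [map_mul]
    exact mul_le_of_le_one_of_le (hS v hv).le (hf v hv)) (fun f => by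
      rw [hmem]
      constructor
      · intro h
        refine ⟨x⁻¹ * f, (hmem _ _).mpr fun v hv => ?_, (mul_inv_cancel_left₀ hx0 f).symm⟩
        have hvx : 0 < v.val x := by simpa [zero_lt_iff] using hx0
        rw [map_mul, map_inv₀]
        have := h v hv
        rw [hDS v hv] at this
        exact (inv_mul_le_one₀ hvx).mpr this
      · rintro ⟨r, hr, rfl⟩ v hv
        rw [map_mul, hDS v hv]
        exact mul_le_of_le_one_right' ((hmem _ _).mp hr v hv))).2
  -- By weak approximation, every integral repartition is congruent to a function modulo `box D`, so
  -- passing to R loses no index.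
  have hsup : (box (0 : Place k F →₀ ℤ)).toAddSubgroup =
      ((box 0).comap φ).toAddSubgroup.map φ.toAddMonoidHom ⊔ (box D).toAddSubgroup := by
    refine le_antisymm (fun α hα => ?_) (sup_le ?_ (box_mono hDle))
    · obtain ⟨f, hf⟩ := Place.exists_approx S α (-∑ v ∈ S, |WithZero.log (v.val x)|)
      have hfD : ∀ v ∈ S, v.val (f - α v) ≤ WithZero.exp (D v) := fun v hv => by
        refine (hf v hv).trans (WithZero.exp_le_exp.mpr ?_)
        rw [hD, Finsupp.indicator_of_mem hv]
        have h1 := Finset.single_le_sum (f := fun v => |WithZero.log (v.val x)|)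
          (fun _ _ => abs_nonneg _) hv
        have h2 := neg_abs_le (WithZero.log (v.val x))
        omega
      have hsub : α - φ f ∈ box D := fun v => by
        by_cases hv : v ∈ S
        · rw [Pi.sub_apply, hφ1 v hv, Valuation.map_sub_swap]; exact hfD v hv
        · rw [Pi.sub_apply, hφ0 v hv, sub_zero, hD0 v hv]; exact hα v
      have hφf : φ f ∈ box (0 : Place k F →₀ ℤ) := by
        have := (box (0 : Place k F →₀ ℤ)).sub_mem hα (box_mono hDle hsub)
        rwa [sub_sub_cancel] at this
      rw [AddSubgroup.mem_sup]
      exact ⟨φ f, ⟨f, hφf, rfl⟩, α - φ f, hsub, add_sub_cancel _ _⟩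
    · rintro _ ⟨f, hf, rfl⟩
      exact hf
  have h1 := hF.relIndex_box hDle
  rw [hsup, AddSubgroup.relIndex_sup_right, ← AddSubgroup.relIndex_comap] at h1
  change ((box D).comap φ).toAddSubgroup.relIndex ((box 0).comap φ).toAddSubgroup = _ at h1
  rw [h1, divisorDegree_zero, zero_sub, hdeg] at hidx
  have h2 := (Nat.pow_le_pow_iff_right (Finite.one_lt_card (α := k))).mp hidx
  have h3 : -∑ v ∈ S, WithZero.log (v.val x) * v.degree =
      ∑ v ∈ S, -WithZero.log (v.val x) * v.degree := by
    rw [← Finset.sum_neg_distrib]; exact Finset.sum_congr rfl fun _ _ => by ring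
  rw [← h3]
  omega

lemma IsCurveFunctionField.finite_zeros {x : F} (hx : Transcendental k x) :
    {v : Place k F | v.val x < 1}.Finite := by
  have hx0 : x ≠ 0 := fun h => hx (h ▸ isAlgebraic_zero)
  by_contra hinf
  obtain ⟨S, hS, hcard⟩ := (Set.not_finite.mp hinf).exists_subset_card_eq
    (Module.finrank (IntermediateField.adjoin k {x}) F + 1)
  have h := hF.sum_zeros_le hx S fun v hv => hS hv
  have h2 : ∑ v ∈ S, (1 : ℤ) ≤ ∑ v ∈ S, -WithZero.log (v.val x) * v.degree := by
    refine Finset.sum_le_sum fun v hv => ?_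
    have h3 : v.val x < 1 := hS hv
    rw [v.val_eq_exp hx0, ← WithZero.exp_zero, WithZero.exp_lt_exp] at h3
    have h4 := hF.degree_pos v
    nlinarith
  rw [Finset.sum_const, hcard, nsmul_eq_mul, mul_one] at h2
  push_cast at h2
  omega

/-- The places with nonzero log are the zeros of f and of f⁻¹. -/
lemma IsCurveFunctionField.finite_support {f : F} (hf : f ≠ 0) :
    {v : Place k F | WithZero.log (v.val f) ≠ 0}.Finite := by
  by_cases hr : f ∈ Set.range (algebraMap k F)
  · obtain ⟨a, rfl⟩ := hr
    have ha : a ≠ 0 := by rintro rfl; simp at hf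
    simp [Place.trivial, ha]
  · have h1 := hF.transcendental_of_notMem_range hr
    have h2 : Transcendental k f⁻¹ := hF.transcendental_of_notMem_range (by
      rintro ⟨a, ha⟩
      exact hr ⟨a⁻¹, by rw [map_inv₀, ha, inv_inv]⟩)
    refine ((hF.finite_zeros h1).union (hF.finite_zeros h2)).subset fun v hv => ?_
    have hv' : WithZero.log (v.val f) ≠ 0 := hv
    have e1 := v.val_eq_exp hf
    rcases lt_or_gt_of_ne hv' with h | h
    · left
      change v.val f < 1
      rwa [e1, ← WithZero.exp_zero, WithZero.exp_lt_exp]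
    · right
      change v.val f⁻¹ < 1
      rw [map_inv₀, e1, ← WithZero.exp_neg, ← WithZero.exp_zero, WithZero.exp_lt_exp]
      omega

end Divisors

end GroupZeta

namespace GroupZeta

/-! ### Principal divisors, Riemann's theorem and the genus -/

section PrincipalDivisors

variable {k F : Type*} [Field k] [Field F] [Algebra k F]

open Classical in
/-- The divisor of a function (`0` for the zero function). -/
noncomputable def divisorOf (f : F) : Place k F →₀ ℤ :=
  if h : (Function.support fun v : Place k F => -WithZero.log (v.val f)).Finite
  then Finsupp.ofSupportFinite _ h else 0

/-- The dimension of the Riemann-Roch space. -/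
noncomputable abbrev hZero (D : Place k F →₀ ℤ) : ℕ := Module.finrank k (riemannRochSpace D)

lemma riemannRochSpace_mono {D E : Place k F →₀ ℤ} (h : D ≤ E) :
    riemannRochSpace D ≤ riemannRochSpace E := fun _ hf => box_mono h hf

/-- The powers of x are independent over k because x is transcendental; products of independent
families multiply along the tower k ⊆ k(x) ⊆ F. -/
lemma linearIndependent_pow_mul {x : F} (hx : Transcendental k x) {m : Type*} {u : m → F}
    (hu : LinearIndependent (IntermediateField.adjoin k {x}) u) :
    LinearIndependent k fun i : ℕ × m => x ^ i.1 * u i.2 := by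
  set g := IntermediateField.AdjoinSimple.gen k x
  have hg : LinearIndependent k fun j : ℕ => g ^ j := by
    have h := (Polynomial.basisMonomials k).linearIndependent.map'
      (Polynomial.aeval g).toLinearMap (LinearMap.ker_eq_bot.mpr ?_)
    · have hfun : (fun j : ℕ => g ^ j) =
          (Polynomial.aeval g).toLinearMap ∘ Polynomial.basisMonomials k := by
        funext j; simp
      rw [hfun]; exact h
    · intro P Q hPQ
      apply transcendental_iff_injective.mp hx
      have := congrArg (algebraMap (IntermediateField.adjoin k {x}) F) hPQ
      simpa [g, ← Polynomial.aeval_algebraMap_apply] using this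
  have := linearIndependent_smul hg hu
  exact this

variable [Finite k] (hF : IsCurveFunctionField k F)
include hF

lemma IsCurveFunctionField.divisorOf_apply (f : F) (v : Place k F) :
    divisorOf f v = -WithZero.log (v.val f) := by
  have h : (Function.support fun v : Place k F => -WithZero.log (v.val f)).Finite := by
    by_cases hf : f = 0
    · simp [hf, Function.support]
    · refine (hF.finite_support hf).subset fun v hv => ?_
      simpa using hv
  rw [divisorOf, dif_pos h]
  rfl

lemma IsCurveFunctionField.divisorOf_mul {f g : F} (hf : f ≠ 0) (hg : g ≠ 0) :
    (divisorOf (f * g) : Place k F →₀ ℤ) = divisorOf f + divisorOf g := by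
  ext v
  rw [Finsupp.add_apply]
  simp only [hF.divisorOf_apply, log_val_mul v hf hg]
  ring

lemma IsCurveFunctionField.divisorOf_inv (f : F) :
    (divisorOf f⁻¹ : Place k F →₀ ℤ) = -divisorOf f := by
  ext v
  rw [Finsupp.neg_apply]
  simp only [hF.divisorOf_apply, map_inv₀, WithZero.log_inv]

lemma IsCurveFunctionField.divisorOf_one : (divisorOf (1 : F) : Place k F →₀ ℤ) = 0 := by
  ext v
  simp [hF.divisorOf_apply]

lemma IsCurveFunctionField.val_eq_exp_neg_divisorOf {f : F} (hf : f ≠ 0) (v : Place k F) :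
    v.val f = WithZero.exp (-divisorOf f v) := by
  rw [hF.divisorOf_apply, neg_neg, ← v.val_eq_exp hf]

lemma IsCurveFunctionField.mem_riemannRochSpace {f : F} (hf : f ≠ 0) {D : Place k F →₀ ℤ} :
    f ∈ riemannRochSpace D ↔ 0 ≤ divisorOf f + D := by
  refine forall_congr' fun v => ?_
  rw [hF.val_eq_exp_neg_divisorOf hf, WithZero.exp_le_exp, Finsupp.add_apply, Finsupp.zero_apply]
  omega

lemma IsCurveFunctionField.mul_mem_riemannRochSpace {f g : F} (hf : f ≠ 0) {D : Place k F →₀ ℤ} :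
    f * g ∈ riemannRochSpace D ↔ g ∈ riemannRochSpace (D + divisorOf f) := by
  by_cases hg : g = 0
  · simp [hg]
  · rw [hF.mem_riemannRochSpace hg, hF.mem_riemannRochSpace (mul_ne_zero hf hg),
      hF.divisorOf_mul hf hg, add_comm (divisorOf f), add_assoc, add_comm (divisorOf f)]

lemma IsCurveFunctionField.hZero_add_divisorOf {f : F} (hf : f ≠ 0) (D : Place k F →₀ ℤ) :
    hZero (D + divisorOf f) = hZero D := by
  let e : F ≃ₗ[k] F := LinearEquiv.ofBijective (LinearMap.mulLeft k f)
    ⟨mul_right_injective₀ hf, fun g => ⟨f⁻¹ * g, mul_inv_cancel_left₀ hf g⟩⟩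
  refine LinearEquiv.finrank_eq (e.submoduleMap (riemannRochSpace (D + divisorOf f)) ≪≫ₗ
    LinearEquiv.ofEq _ _ ?_)
  ext g
  rw [Submodule.mem_map]
  constructor
  · rintro ⟨h, hh, rfl⟩
    exact (hF.mul_mem_riemannRochSpace hf).mpr hh
  · intro hg
    refine ⟨f⁻¹ * g, ?_, mul_inv_cancel_left₀ hf g⟩
    rw [← hF.mul_mem_riemannRochSpace hf, mul_inv_cancel_left₀ hf]
    exact hg

/-- A function without poles is constant. -/
lemma IsCurveFunctionField.mem_riemannRochSpace_zero {f : F} :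
    f ∈ riemannRochSpace (0 : Place k F →₀ ℤ) ↔ f ∈ Set.range (algebraMap k F) := by
  constructor
  · intro h
    by_contra hr
    have h2 : Transcendental k f⁻¹ := hF.transcendental_of_notMem_range (by
      rintro ⟨a, ha⟩
      exact hr ⟨a⁻¹, by rw [map_inv₀, ha, inv_inv]⟩)
    obtain ⟨v, hv⟩ := hF.exists_place h2
    have hf : f ≠ 0 := by rintro rfl; exact hr ⟨0, by simp⟩
    rw [map_inv₀, inv_lt_one₀ (by simpa [zero_lt_iff] using hf)] at hv
    exact absurd (h v) (not_le.mpr hv)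
  · rintro ⟨a, rfl⟩ v
    exact v.val_algebraMap_le_one a

lemma IsCurveFunctionField.riemannRochSpace_zero :
    riemannRochSpace (0 : Place k F →₀ ℤ) = LinearMap.range (Algebra.linearMap k F) := by
  ext f
  rw [hF.mem_riemannRochSpace_zero]
  rfl

lemma IsCurveFunctionField.hZero_zero : hZero (0 : Place k F →₀ ℤ) = 1 := by
  rw [hZero, hF.riemannRochSpace_zero, LinearMap.finrank_range_of_inj (algebraMap k F).injective,
    Module.finrank_self]

/-- The diagonal embeds L(E)/L(D) into the quotient of the boxes. -/
lemma IsCurveFunctionField.relIndex_riemannRochSpace_le {D E : Place k F →₀ ℤ} (h : D ≤ E) :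
    (riemannRochSpace D).toAddSubgroup.relIndex (riemannRochSpace E).toAddSubgroup ≤
      Nat.card k ^ (divisorDegree E - divisorDegree D).toNat ∧
    (riemannRochSpace D).toAddSubgroup.relIndex (riemannRochSpace E).toAddSubgroup ≠ 0 := by
  have hbox := hF.relIndex_box h
  have h0 : (box D).toAddSubgroup.relIndex (box E).toAddSubgroup ≠ 0 := by
    rw [hbox]; exact pow_ne_zero _ Nat.card_pos.ne'
  have hmap : (riemannRochSpace E).toAddSubgroup.map (diag (k := k) (F := F)).toAddMonoidHom ≤
      (box E).toAddSubgroup := by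
    rintro _ ⟨f, hf, rfl⟩
    exact hf
  have hcomap : (riemannRochSpace D).toAddSubgroup =
      (box D).toAddSubgroup.comap (diag (k := k) (F := F)).toAddMonoidHom := rfl
  rw [hcomap, AddSubgroup.relIndex_comap, ← hbox]
  exact ⟨AddSubgroup.relIndex_le_of_le_right hmap h0,
    fun hz => h0 (AddSubgroup.relIndex_eq_zero_of_le_right hmap hz)⟩

lemma IsCurveFunctionField.finite_riemannRochSpace (D : Place k F →₀ ℤ) :
    Finite (riemannRochSpace D) := by
  have hfin0 : Finite (riemannRochSpace (0 : Place k F →₀ ℤ)) := by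
    rw [hF.riemannRochSpace_zero]
    exact Finite.of_surjective _ (LinearMap.surjective_rangeRestrict (Algebra.linearMap k F))
  have h := (hF.relIndex_riemannRochSpace_le (le_sup_right : (0 : Place k F →₀ ℤ) ≤ D ⊔ 0)).2
  have hcard := AddSubgroup.relIndex_mul_relIndex ⊥ (riemannRochSpace 0).toAddSubgroup
    (riemannRochSpace (D ⊔ 0)).toAddSubgroup bot_le
    (riemannRochSpace_mono (le_sup_right : (0 : Place k F →₀ ℤ) ≤ D ⊔ 0))
  rw [AddSubgroup.relIndex_bot_left, AddSubgroup.relIndex_bot_left] at hcard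
  have hfin : Finite (riemannRochSpace (D ⊔ 0)).toAddSubgroup := by
    refine Nat.finite_of_card_ne_zero ?_
    rw [← hcard]
    refine mul_ne_zero ?_ h
    exact (Nat.card_pos (α := riemannRochSpace (0 : Place k F →₀ ℤ))).ne'
  exact Finite.of_injective (β := (riemannRochSpace (D ⊔ 0)).toAddSubgroup)
    (fun f => ⟨f, riemannRochSpace_mono le_sup_left f.2⟩)
    fun a b hab => Subtype.ext (Subtype.mk.inj hab)

lemma IsCurveFunctionField.card_riemannRochSpace (D : Place k F →₀ ℤ) :
    Nat.card (riemannRochSpace D) = Nat.card k ^ hZero D := by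
  have := hF.finite_riemannRochSpace D
  have : Module.Finite k (riemannRochSpace D) := Module.Finite.of_finite
  exact Module.natCard_eq_pow_finrank

/-- In other words, deg - h⁰ is nondecreasing in the divisor. Together with its invariance under
linear equivalence, this drives Riemann's theorem. -/
lemma IsCurveFunctionField.hZero_le {D E : Place k F →₀ ℤ} (h : D ≤ E) :
    (hZero E : ℤ) ≤ hZero D + (divisorDegree E - divisorDegree D) := by
  have h1 := (hF.relIndex_riemannRochSpace_le h).1
  have hcard := AddSubgroup.relIndex_mul_relIndex ⊥ (riemannRochSpace D).toAddSubgroup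
    (riemannRochSpace E).toAddSubgroup bot_le (riemannRochSpace_mono h)
  rw [AddSubgroup.relIndex_bot_left, AddSubgroup.relIndex_bot_left] at hcard
  change Nat.card (riemannRochSpace D) * _ = Nat.card (riemannRochSpace E) at hcard
  rw [hF.card_riemannRochSpace, hF.card_riemannRochSpace] at hcard
  have h2 : Nat.card k ^ hZero E ≤
      Nat.card k ^ (hZero D + (divisorDegree E - divisorDegree D).toNat) := by
    rw [← hcard, pow_add]
    exact Nat.mul_le_mul_left _ h1
  have h3 := (Nat.pow_le_pow_iff_right (Finite.one_lt_card (α := k))).mp h2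
  have h4 := divisorDegree_mono h
  omega

lemma IsCurveFunctionField.exists_forall_mem_riemannRochSpace {m : Type*} [Finite m] (u : m → F) :
    ∃ C : Place k F →₀ ℤ, 0 ≤ C ∧ ∀ i, u i ∈ riemannRochSpace C := by
  have := Fintype.ofFinite m
  have hpos : ∀ i, 0 ≤ -divisorOf (u i) ⊔ (0 : Place k F →₀ ℤ) := fun i => le_sup_right
  refine ⟨∑ i, (-divisorOf (u i) ⊔ 0), Finset.sum_nonneg fun i _ => hpos i, fun i => ?_⟩
  by_cases hi : u i = 0
  · rw [hi]; exact Submodule.zero_mem _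
  rw [hF.mem_riemannRochSpace hi]
  have h1 : -divisorOf (u i) ≤ -divisorOf (u i) ⊔ (0 : Place k F →₀ ℤ) := le_sup_left
  have h2 := Finset.single_le_sum (f := fun i => -divisorOf (u i) ⊔ (0 : Place k F →₀ ℤ))
    (fun i _ => hpos i) (Finset.mem_univ i)
  have h3 := h1.trans h2
  rwa [neg_le_iff_add_nonneg'] at h3

/-- The key estimate: `h⁰(C + l (x)_∞) ≥ (l + 1) [F : k(x)]` for a suitable effective `C`. -/
lemma IsCurveFunctionField.exists_le_hZero_add {x : F} (hx : Transcendental k x) :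
    ∃ C : Place k F →₀ ℤ, 0 ≤ C ∧ ∀ l : ℕ,
      (l + 1) * Module.finrank (IntermediateField.adjoin k {x}) F ≤
        hZero (C + l • (-divisorOf x ⊔ 0)) := by
  have hx0 : x ≠ 0 := fun h => hx (h ▸ isAlgebraic_zero)
  have hfd := hF.finiteDimensional_adjoin hx
  let u := Module.finBasis (IntermediateField.adjoin k {x}) F
  obtain ⟨C, hC, huC⟩ := hF.exists_forall_mem_riemannRochSpace u
  refine ⟨C, hC, fun l => ?_⟩
  set B : Place k F →₀ ℤ := -divisorOf x ⊔ 0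
  have hli := linearIndependent_pow_mul hx u.linearIndependent
  have hli2 := hli.comp
    (fun i : Fin (l + 1) × Fin (Module.finrank (IntermediateField.adjoin k {x}) F) =>
      ((i.1 : ℕ), i.2)) (fun i j h => by
        simp only [Prod.mk.injEq] at h
        exact Prod.ext (Fin.ext h.1) h.2)
  have hmem : ∀ i : Fin (l + 1) × Fin (Module.finrank (IntermediateField.adjoin k {x}) F),
      x ^ (i.1 : ℕ) * u i.2 ∈ riemannRochSpace (C + l • B) := by
    rintro ⟨i, j⟩
    have hpow : ∀ n : ℕ, (divisorOf (x ^ n) : Place k F →₀ ℤ) = n • divisorOf x := fun n => by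
      induction n with
      | zero => simp [hF.divisorOf_one]
      | succ n ih => rw [pow_succ, hF.divisorOf_mul (pow_ne_zero _ hx0) hx0, ih, succ_nsmul]
    rw [hF.mul_mem_riemannRochSpace (pow_ne_zero _ hx0), hpow]
    refine riemannRochSpace_mono ?_ (huC j)
    have h1 : (i : ℕ) • B ≤ l • B := nsmul_le_nsmul_left le_sup_right (by omega)
    have h2 : (i : ℕ) • (-divisorOf x) ≤ (i : ℕ) • B := nsmul_le_nsmul_right le_sup_left _
    rw [add_assoc]
    refine le_add_of_nonneg_right ?_
    have h3 := h2.trans h1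
    rw [smul_neg, neg_le_iff_add_nonneg] at h3
    exact h3
  have := hF.finite_riemannRochSpace (C + l • B)
  have : Module.Finite k (riemannRochSpace (C + l • B)) := Module.Finite.of_finite
  have hli3 : LinearIndependent k (fun i => (⟨_, hmem i⟩ : riemannRochSpace (C + l • B))) :=
    LinearIndependent.of_comp (riemannRochSpace (C + l • B)).subtype hli2
  simpa using hli3.fintype_card_le_finrank

/-- Compare growth in l: h⁰(C + l (x)_∞) is at least (l + 1)[F : k(x)], but at most 1 + deg C + l
deg (x)_∞. -/
lemma IsCurveFunctionField.finrank_le_degree_poles {x : F} (hx : Transcendental k x) :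
    (Module.finrank (IntermediateField.adjoin k {x}) F : ℤ) ≤
      divisorDegree (-divisorOf x ⊔ 0 : Place k F →₀ ℤ) := by
  obtain ⟨C, hC, h⟩ := hF.exists_le_hZero_add hx
  set n := Module.finrank (IntermediateField.adjoin k {x}) F
  set B : Place k F →₀ ℤ := -divisorOf x ⊔ 0
  by_contra! hlt
  -- If deg (x)_∞ ≤ n - 1, the two bounds give n + l ≤ 1 + deg C, which this l violates.
  set l := (divisorDegree C).toNat + 2
  have h1 := h l
  have h2 := hF.hZero_le (D := 0) (E := C + l • B)
    (add_nonneg hC (nsmul_nonneg le_sup_right _))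
  rw [hF.hZero_zero, divisorDegree_zero, divisorDegree_add, divisorDegree_nsmul] at h2
  have h3 := divisorDegree_nonneg hC
  have h4 : (l : ℤ) * divisorDegree B ≤ l * (n - 1) :=
    mul_le_mul_of_nonneg_left (by omega) (by positivity)
  have h5 : ((l : ℤ) + 1) * n ≤ hZero (C + l • B) := by exact_mod_cast h1
  have h6 : (l : ℤ) = divisorDegree C + 2 := by omega
  have h7 : (0 : ℤ) ≤ n := by positivity
  push_cast at h2
  linarith

lemma IsCurveFunctionField.degree_zeros_le {x : F} (hx : Transcendental k x) :
    divisorDegree (divisorOf x ⊔ 0 : Place k F →₀ ℤ) ≤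
      Module.finrank (IntermediateField.adjoin k {x}) F := by
  have hx0 : x ≠ 0 := fun h => hx (h ▸ isAlgebraic_zero)
  set Z : Place k F →₀ ℤ := divisorOf x ⊔ 0
  have hZ : ∀ v, Z v = max (-WithZero.log (v.val x)) 0 := fun v => by
    rw [Finsupp.sup_apply, hF.divisorOf_apply]; rfl
  have hpos : ∀ v ∈ Z.support, 0 < -WithZero.log (v.val x) := fun v hv => by
    have := Finsupp.mem_support_iff.mp hv
    rw [hZ] at this
    by_contra hcon
    exact this (max_eq_right (by omega))
  refine le_trans (le_of_eq ?_) (hF.sum_zeros_le hx Z.support fun v hv => ?_)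
  · refine Finset.sum_congr rfl fun v hv => ?_
    rw [hZ, max_eq_left (hpos v hv).le]
  · have := hpos v hv
    rw [v.val_eq_exp hx0, ← WithZero.exp_zero, WithZero.exp_lt_exp]
    omega

/-- The degree of a principal divisor is zero. -/
lemma IsCurveFunctionField.divisorDegree_divisorOf {f : F} (hf : f ≠ 0) :
    divisorDegree (divisorOf f : Place k F →₀ ℤ) = 0 := by
  by_cases hr : f ∈ Set.range (algebraMap k F)
  · obtain ⟨a, rfl⟩ := hr
    have ha : a ≠ 0 := by rintro rfl; simp at hf
    have : (divisorOf (algebraMap k F a) : Place k F →₀ ℤ) = 0 := by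
      ext v
      rw [hF.divisorOf_apply, v.trivial a ha]; simp
    rw [this, divisorDegree_zero]
  · have h1 := hF.transcendental_of_notMem_range hr
    have h2 : Transcendental k f⁻¹ := hF.transcendental_of_notMem_range (by
      rintro ⟨a, ha⟩
      exact hr ⟨a⁻¹, by rw [map_inv₀, ha, inv_inv]⟩)
    -- The degree of the zeros is at most the degree of the poles, via [F : k(f)]; applying this to
    -- f⁻¹ gives the reverse inequality.
    have a1 := hF.finrank_le_degree_poles h1
    have a2 := hF.degree_zeros_le h1
    have b1 := hF.finrank_le_degree_poles h2
    have b2 := hF.degree_zeros_le h2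
    rw [hF.divisorOf_inv] at b1 b2
    rw [neg_neg] at b1
    have : (divisorOf f : Place k F →₀ ℤ) = (divisorOf f ⊔ 0) - (-divisorOf f ⊔ 0) := by
      ext v
      simp only [Finsupp.sub_apply, Finsupp.sup_apply, Finsupp.neg_apply, Finsupp.zero_apply]
      omega
    rw [this, divisorDegree_sub]
    omega

lemma IsCurveFunctionField.divisorDegree_nonneg_of_hZero_pos {D : Place k F →₀ ℤ}
    (h : 0 < hZero D) : 0 ≤ divisorDegree D := by
  have : Nontrivial (riemannRochSpace D) := Module.nontrivial_of_finrank_pos h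
  obtain ⟨⟨f, hf⟩, hne⟩ := exists_ne (0 : riemannRochSpace D)
  have hf0 : f ≠ 0 := fun h => hne (Subtype.ext h)
  have h1 := divisorDegree_nonneg ((hF.mem_riemannRochSpace hf0).mp hf)
  rwa [divisorDegree_add, hF.divisorDegree_divisorOf hf0, zero_add] at h1

/-- Riemann's theorem: `deg D - h⁰(D)` is bounded above. -/
lemma IsCurveFunctionField.exists_degree_sub_hZero_le :
    ∃ γ : ℤ, ∀ D : Place k F →₀ ℤ, divisorDegree D - hZero D ≤ γ := by
  obtain ⟨x, hx, -⟩ := hF.exists_transcendental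
  have hfd := hF.finiteDimensional_adjoin hx
  obtain ⟨C, hC, h⟩ := hF.exists_le_hZero_add hx
  have hn := Module.finrank_pos (R := IntermediateField.adjoin k {x}) (M := F)
  have hn1 := hF.finrank_le_degree_poles hx
  have hn2 : divisorDegree (-divisorOf x ⊔ 0 : Place k F →₀ ℤ) ≤
      Module.finrank (IntermediateField.adjoin k {x}) F := by
    have h0 := hF.divisorDegree_divisorOf (k := k) (f := x) (fun h => hx (h ▸ isAlgebraic_zero))
    have h1 := hF.degree_zeros_le hx
    have h2 : (divisorOf x : Place k F →₀ ℤ) = (divisorOf x ⊔ 0) - (-divisorOf x ⊔ 0) := by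
      ext v
      simp only [Finsupp.sub_apply, Finsupp.sup_apply, Finsupp.neg_apply, Finsupp.zero_apply]
      omega
    rw [h2, divisorDegree_sub] at h0
    omega
  set n := Module.finrank (IntermediateField.adjoin k {x}) F
  set B : Place k F →₀ ℤ := -divisorOf x ⊔ 0 with hB
  have hBl : ∀ l : ℕ, divisorDegree (l • B) - hZero (l • B) ≤ divisorDegree C := fun l => by
    have h1 := hF.hZero_le (D := l • B) (E := C + l • B) (le_add_of_nonneg_left hC)
    have h2 : ((l : ℤ) + 1) * n ≤ hZero (C + l • B) := by exact_mod_cast h l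
    rw [divisorDegree_add] at h1
    rw [divisorDegree_nsmul] at h1 ⊢
    have h3 : (l : ℤ) * divisorDegree B = l * n := by rw [le_antisymm hn2 hn1]
    nlinarith
  refine ⟨divisorDegree C, fun D => ?_⟩
  -- Large enough for l B - D⁺ to have a nonzero section z. Then D ≤ l B + (z), and monotonicity of
  -- deg - h⁰ transfers the bound for l B to D.
  set l := (divisorDegree C + divisorDegree (D ⊔ 0) + 1).toNat
  have h1 := hF.hZero_le (D := l • B - (D ⊔ 0)) (E := l • B) (sub_le_self _ le_sup_right)
  rw [divisorDegree_sub] at h1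
  have h2 := hBl l
  have h3 : (l : ℤ) ≤ divisorDegree (l • B) := by
    rw [divisorDegree_nsmul]
    have : (1 : ℤ) ≤ divisorDegree B := by omega
    nlinarith
  have h4 : 0 < hZero (l • B - (D ⊔ 0)) := by omega
  have : Nontrivial (riemannRochSpace (l • B - (D ⊔ 0))) := Module.nontrivial_of_finrank_pos h4
  obtain ⟨⟨z, hz⟩, hne⟩ := exists_ne (0 : riemannRochSpace (l • B - (D ⊔ 0)))
  have hz0 : z ≠ 0 := fun h => hne (Subtype.ext h)
  have h5 : D ≤ l • B + divisorOf z := by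
    have := (hF.mem_riemannRochSpace hz0).mp hz
    rw [← add_sub_assoc, sub_nonneg, add_comm] at this
    exact le_sup_left.trans this
  have h6 := hF.hZero_le h5
  rw [hF.hZero_add_divisorOf hz0, divisorDegree_add, hF.divisorDegree_divisorOf hz0] at h6
  omega

lemma IsCurveFunctionField.bddAbove_genus : BddAbove (Set.range fun D : Place k F →₀ ℤ =>
    divisorDegree D + 1 - Module.finrank k (riemannRochSpace D)) := by
  obtain ⟨γ, hγ⟩ := hF.exists_degree_sub_hZero_le
  refine ⟨γ + 1, ?_⟩
  rintro _ ⟨D, rfl⟩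
  have := hγ D
  simp only [hZero] at this ⊢
  omega

/-- Riemann's inequality. -/
lemma IsCurveFunctionField.degree_add_one_sub_hZero_le (D : Place k F →₀ ℤ) :
    divisorDegree D + 1 - hZero D ≤ genus k F :=
  le_csSup hF.bddAbove_genus ⟨D, rfl⟩

lemma IsCurveFunctionField.exists_eq_genus :
    ∃ D : Place k F →₀ ℤ, divisorDegree D + 1 - hZero D = genus k F :=
  Int.csSup_mem (Set.range_nonempty _) hF.bddAbove_genus

lemma IsCurveFunctionField.genus_nonneg : 0 ≤ genus k F := by
  have := hF.degree_add_one_sub_hZero_le (0 : Place k F →₀ ℤ)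
  rw [hF.hZero_zero, divisorDegree_zero] at this
  omega

/-- Divisors of large degree are nonspecial. -/
lemma IsCurveFunctionField.exists_forall_degree_le :
    ∃ c : ℤ, ∀ D : Place k F →₀ ℤ, c ≤ divisorDegree D →
      (hZero D : ℤ) = divisorDegree D + 1 - genus k F := by
  obtain ⟨D₀, hD₀⟩ := hF.exists_eq_genus
  refine ⟨divisorDegree D₀ + genus k F, fun D hD => ?_⟩
  -- Riemann's inequality provides a nonzero section z of D - D₀, so D₀ ≤ D + (z). As deg - h⁰ is
  -- already maximal at D₀, it is maximal at D.
  have h1 := hF.degree_add_one_sub_hZero_le (D - D₀)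
  rw [divisorDegree_sub] at h1
  have h4 : 0 < hZero (D - D₀) := by omega
  have : Nontrivial (riemannRochSpace (D - D₀)) := Module.nontrivial_of_finrank_pos h4
  obtain ⟨⟨z, hz⟩, hne⟩ := exists_ne (0 : riemannRochSpace (D - D₀))
  have hz0 : z ≠ 0 := fun h => hne (Subtype.ext h)
  have h5 : D₀ ≤ D + divisorOf z := by
    have := (hF.mem_riemannRochSpace hz0).mp hz
    rwa [← add_sub_assoc, sub_nonneg, add_comm] at this
  have h6 := hF.hZero_le h5
  rw [hF.hZero_add_divisorOf hz0, divisorDegree_add, hF.divisorDegree_divisorOf hz0] at h6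
  have h7 := hF.degree_add_one_sub_hZero_le D
  omega

end PrincipalDivisors

end GroupZeta

namespace GroupZeta

/-! ### Weil differentials and the Riemann-Roch theorem -/

section RiemannRoch

variable {k F : Type*} [Field k] [Field F] [Algebra k F]

variable (k F) in
/-- The adeles: the families of functions that are bounded by some divisor. -/
def adeles : Submodule k (Place k F → F) where
  carrier := {α | ∃ D, α ∈ box D}
  add_mem' := by
    rintro α β ⟨D, hD⟩ ⟨E, hE⟩
    exact ⟨D ⊔ E, (box _).add_mem (box_mono le_sup_left hD) (box_mono le_sup_right hE)⟩
  zero_mem' := ⟨0, Submodule.zero_mem _⟩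
  smul_mem' := by
    rintro a α ⟨D, hD⟩
    exact ⟨D, (box D).smul_mem a hD⟩

lemma box_le_adeles (D : Place k F →₀ ℤ) : box D ≤ adeles k F := fun _ h => ⟨D, h⟩

variable (k F) in
/-- The image of the function field in the adeles. -/
abbrev principalAdeles : Submodule k (Place k F → F) := LinearMap.range diag

/-- The Weil differentials that vanish on the adeles bounded by `D`. -/
def weilDifferentials (D : Place k F →₀ ℤ) : Submodule k (Module.Dual k (adeles k F)) :=
  ((box D ⊔ principalAdeles k F).comap (adeles k F).subtype).dualAnnihilator

lemma mem_weilDifferentials {D : Place k F →₀ ℤ} {ω : Module.Dual k (adeles k F)} :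
    ω ∈ weilDifferentials D ↔ (∀ α : adeles k F, (α : Place k F → F) ∈ box D → ω α = 0) ∧
      ∀ α : adeles k F, (α : Place k F → F) ∈ principalAdeles k F → ω α = 0 := by
  rw [weilDifferentials, Submodule.mem_dualAnnihilator]
  constructor
  · intro h
    exact ⟨fun α hα => h α (Submodule.mem_sup_left hα), fun α hα => h α (Submodule.mem_sup_right hα)⟩
  · rintro ⟨h1, h2⟩ ⟨α, hα⟩ hmem
    obtain ⟨β, hβ, γ, hγ, hsum⟩ := Submodule.mem_sup.mp hmem
    have hβA := box_le_adeles D hβ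
    have hγA : γ ∈ adeles k F := by
      have : γ = α - β := by rw [eq_sub_iff_add_eq', hsum]; rfl
      rw [this]; exact Submodule.sub_mem _ hα hβA
    have : (⟨α, hα⟩ : adeles k F) = ⟨β, hβA⟩ + ⟨γ, hγA⟩ := Subtype.ext hsum.symm
    rw [this, map_add, h1 ⟨β, hβA⟩ hβ, h2 ⟨γ, hγA⟩ hγ, add_zero]

lemma weilDifferentials_anti {D E : Place k F →₀ ℤ} (h : D ≤ E) :
    weilDifferentials E ≤ weilDifferentials D := fun ω hω => by
  rw [mem_weilDifferentials] at hω ⊢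
  exact ⟨fun α hα => hω.1 α (box_mono h hα), hω.2⟩

/-- An adele bounded by D ⊔ E splits place by place into one bounded by D and one bounded by E. This
is what gives a differential a greatest divisor. -/
lemma weilDifferentials_sup {D E : Place k F →₀ ℤ} {ω : Module.Dual k (adeles k F)}
    (hD : ω ∈ weilDifferentials D) (hE : ω ∈ weilDifferentials E) :
    ω ∈ weilDifferentials (D ⊔ E) := by
  classical
  rw [mem_weilDifferentials] at hD hE ⊢
  refine ⟨fun α hα => ?_, hD.2⟩
  let β : Place k F → F := fun v => if E v ≤ D v then (α : Place k F → F) v else 0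
  let γ : Place k F → F := fun v => if E v ≤ D v then 0 else (α : Place k F → F) v
  have hβ : β ∈ box D := fun v => by
    have := hα v
    rw [Finsupp.sup_apply] at this
    by_cases h : E v ≤ D v
    · simp only [β, if_pos h]; rwa [sup_eq_left.mpr h] at this
    · simp [β, if_neg h]
  have hγ : γ ∈ box E := fun v => by
    have := hα v
    rw [Finsupp.sup_apply] at this
    by_cases h : E v ≤ D v
    · simp [γ, if_pos h]
    · simp only [γ, if_neg h]; rwa [sup_eq_right.mpr (by omega)] at this
  have : α = (⟨β, box_le_adeles D hβ⟩ : adeles k F) + ⟨γ, box_le_adeles E hγ⟩ := by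
    refine Subtype.ext (funext fun v => ?_)
    change (α : Place k F → F) v = β v + γ v
    by_cases h : E v ≤ D v <;> simp [β, γ, h]
  rw [this, map_add, hD.1 _ hβ, hE.1 _ hγ, add_zero]

variable [Finite k] (hF : IsCurveFunctionField k F)
include hF

lemma IsCurveFunctionField.principalAdeles_le : principalAdeles k F ≤ adeles k F := by
  rintro _ ⟨f, rfl⟩
  by_cases hf : f = 0
  · rw [hf, map_zero]; exact Submodule.zero_mem _
  · exact ⟨-divisorOf f, fun v => (hF.val_eq_exp_neg_divisorOf hf v).le⟩

lemma IsCurveFunctionField.mul_mem_box {f : F} (hf : f ≠ 0) {D : Place k F →₀ ℤ}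
    {α : Place k F → F} : (fun v => f * α v) ∈ box D ↔ α ∈ box (D + divisorOf f) := by
  refine forall_congr' fun v => ?_
  have hpos : (0 : ℤᵐ⁰) < WithZero.exp (divisorOf f v : ℤ) := WithZero.exp_pos
  rw [map_mul, hF.val_eq_exp_neg_divisorOf hf, Finsupp.add_apply, WithZero.exp_add,
    WithZero.exp_neg, inv_mul_le_iff₀ hpos, mul_comm]

/-- Multiplication of adeles by a function. -/
def IsCurveFunctionField.mulAdele (f : F) : adeles k F →ₗ[k] adeles k F :=
  (LinearMap.pi fun v => (LinearMap.mulLeft k f).comp (LinearMap.proj v)).restrict (by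
    rintro α ⟨D, hD⟩
    by_cases hf : f = 0
    · refine ⟨0, fun v => ?_⟩
      simp [hf]
    · refine ⟨D - divisorOf f, ?_⟩
      change (fun v => f * α v) ∈ _
      rw [hF.mul_mem_box hf, sub_add_cancel]
      exact hD)

lemma IsCurveFunctionField.coe_mulAdele (f : F) (α : adeles k F) :
    (hF.mulAdele f α : Place k F → F) = fun v => f * (α : Place k F → F) v := rfl

lemma IsCurveFunctionField.mulAdele_mul (f g : F) :
    hF.mulAdele (f * g) = hF.mulAdele f ∘ₗ hF.mulAdele g :=
  LinearMap.ext fun _ => Subtype.ext (funext fun _ => mul_assoc _ _ _)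

lemma IsCurveFunctionField.mulAdele_one : hF.mulAdele 1 = LinearMap.id :=
  LinearMap.ext fun _ => Subtype.ext (funext fun _ => one_mul _)

/-- The product of a Weil differential with functions, as a linear map. -/
def IsCurveFunctionField.mulDifferential (ω : Module.Dual k (adeles k F)) :
    F →ₗ[k] Module.Dual k (adeles k F) where
  toFun f := ω ∘ₗ hF.mulAdele f
  map_add' f g := LinearMap.ext fun α => by
    have : hF.mulAdele (f + g) α = hF.mulAdele f α + hF.mulAdele g α :=
      Subtype.ext (funext fun v => add_mul _ _ _)
    simp [this]
  map_smul' a f := LinearMap.ext fun α => by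
    have : hF.mulAdele (a • f) α = a • hF.mulAdele f α :=
      Subtype.ext (funext fun v => smul_mul_assoc _ _ _)
    simp [this]

lemma IsCurveFunctionField.mulDifferential_apply (ω : Module.Dual k (adeles k F)) (f : F)
    (α : adeles k F) : hF.mulDifferential ω f α = ω (hF.mulAdele f α) := rfl

lemma IsCurveFunctionField.mulDifferential_mul (ω : Module.Dual k (adeles k F)) (f g : F) :
    hF.mulDifferential ω (f * g) = hF.mulDifferential (hF.mulDifferential ω f) g := by
  ext α
  simp [hF.mulDifferential_apply, hF.mulAdele_mul]

lemma IsCurveFunctionField.mulDifferential_one (ω : Module.Dual k (adeles k F)) :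
    hF.mulDifferential ω 1 = ω := by
  ext α
  simp [hF.mulDifferential_apply, hF.mulAdele_one]

lemma IsCurveFunctionField.mulDifferential_injective {ω : Module.Dual k (adeles k F)}
    (hω : ω ≠ 0) : Function.Injective (hF.mulDifferential ω) := by
  rw [← LinearMap.ker_eq_bot, LinearMap.ker_eq_bot']
  intro f hf
  by_contra hne
  apply hω
  rw [← hF.mulDifferential_one ω, ← mul_inv_cancel₀ hne, hF.mulDifferential_mul, hf]
  ext α
  simp [hF.mulDifferential_apply]

/-- Multiplication by f preserves the principal adeles and carries `box D` onto `box (D - divisorOf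
f)`. -/
lemma IsCurveFunctionField.mulDifferential_mem_iff {ω : Module.Dual k (adeles k F)} {f : F}
    (hf : f ≠ 0) {D : Place k F →₀ ℤ} :
    hF.mulDifferential ω f ∈ weilDifferentials D ↔ ω ∈ weilDifferentials (D - divisorOf f) := by
  have half : ∀ {ω : Module.Dual k (adeles k F)} {f : F}, f ≠ 0 → ∀ {D : Place k F →₀ ℤ},
      ω ∈ weilDifferentials (D - divisorOf f) → hF.mulDifferential ω f ∈ weilDifferentials D := by
    intro ω f hf D h
    rw [mem_weilDifferentials] at h ⊢
    refine ⟨fun α hα => h.1 _ ?_, fun α hα => h.2 _ ?_⟩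
    · rw [hF.coe_mulAdele, hF.mul_mem_box hf, sub_add_cancel]
      exact hα
    · obtain ⟨g, hg⟩ := hα
      refine ⟨f * g, funext fun v => ?_⟩
      rw [hF.coe_mulAdele, ← hg]
      rfl
  refine ⟨fun h => ?_, half hf⟩
  have h2 := half (D := D - divisorOf f) (inv_ne_zero hf) (by
    rwa [hF.divisorOf_inv, sub_neg_eq_add, sub_add_cancel])
  rwa [← hF.mulDifferential_mul, mul_inv_cancel₀ hf, hF.mulDifferential_one] at h2

/-- The index of `box D` in `box E` splits into the part filled by global sections, of index
q^{h⁰(E) - h⁰(D)}, and the part that survives modulo the principal adeles. -/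
lemma IsCurveFunctionField.relIndex_box_sup {D E : Place k F →₀ ℤ} (h : D ≤ E) :
    (box D ⊔ principalAdeles k F).toAddSubgroup.relIndex
        (box E ⊔ principalAdeles k F).toAddSubgroup =
      Nat.card k ^ ((divisorDegree E - hZero E) - (divisorDegree D - hZero D)).toNat := by
  have hbox := hF.relIndex_box h
  have e1 : (box E ⊔ principalAdeles k F) = box E ⊔ (box D ⊔ principalAdeles k F) := by
    rw [← sup_assoc, sup_eq_left.mpr (box_mono h)]
  have hr : (box D ⊔ principalAdeles k F).toAddSubgroup.relIndex
        (box E ⊔ principalAdeles k F).toAddSubgroup =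
      (box D ⊔ principalAdeles k F).toAddSubgroup.relIndex (box E).toAddSubgroup := by
    rw [e1, Submodule.sup_toAddSubgroup (box E), AddSubgroup.relIndex_sup_right]
  -- The modular law, available since `box D` lies in `box E`.
  have hmod : (box D ⊔ principalAdeles k F) ⊓ box E = (principalAdeles k F ⊓ box E) ⊔ box D := by
    rw [sup_comm (principalAdeles k F ⊓ box E), sup_inf_assoc_of_le _ (box_mono h)]
  have hmap : (principalAdeles k F ⊓ box E).toAddSubgroup =
      (riemannRochSpace E).toAddSubgroup.map (diag (k := k) (F := F)).toAddMonoidHom := by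
    ext α
    constructor
    · rintro ⟨⟨f, rfl⟩, hf⟩
      exact ⟨f, hf, rfl⟩
    · rintro ⟨f, hf, rfl⟩
      exact ⟨⟨f, rfl⟩, hf⟩
  have h2 : (box D).toAddSubgroup.relIndex
      ((box D ⊔ principalAdeles k F) ⊓ box E).toAddSubgroup =
      (riemannRochSpace D).toAddSubgroup.relIndex (riemannRochSpace E).toAddSubgroup := by
    rw [hmod, Submodule.sup_toAddSubgroup, AddSubgroup.relIndex_sup_right, hmap,
      ← AddSubgroup.relIndex_comap]
    rfl
  have h3 := AddSubgroup.relIndex_mul_relIndex (box D).toAddSubgroup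
    ((box D ⊔ principalAdeles k F) ⊓ box E).toAddSubgroup (box E).toAddSubgroup
    (Submodule.toAddSubgroup_mono (le_inf le_sup_left (box_mono h)))
    (Submodule.toAddSubgroup_mono inf_le_right)
  have h4 : ((box D ⊔ principalAdeles k F) ⊓ box E).toAddSubgroup.relIndex (box E).toAddSubgroup =
      (box D ⊔ principalAdeles k F).toAddSubgroup.relIndex (box E).toAddSubgroup :=
    AddSubgroup.inf_relIndex_right (box D ⊔ principalAdeles k F).toAddSubgroup
      (box E).toAddSubgroup
  have hcard := AddSubgroup.relIndex_mul_relIndex ⊥ (riemannRochSpace D).toAddSubgroup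
    (riemannRochSpace E).toAddSubgroup bot_le (riemannRochSpace_mono h)
  rw [AddSubgroup.relIndex_bot_left, AddSubgroup.relIndex_bot_left] at hcard
  change Nat.card (riemannRochSpace D) * _ = Nat.card (riemannRochSpace E) at hcard
  rw [hF.card_riemannRochSpace, hF.card_riemannRochSpace] at hcard
  rw [h2, h4, hbox] at h3
  have hq : 0 < Nat.card k := Nat.card_pos
  have h5 : Nat.card k ^ (hZero E) * (box D ⊔ principalAdeles k F).toAddSubgroup.relIndex
      (box E).toAddSubgroup =
      Nat.card k ^ (hZero D + (divisorDegree E - divisorDegree D).toNat) := by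
    rw [← hcard, mul_assoc, h3, pow_add]
  rw [hr]
  have h6 := hF.hZero_le h
  have h7 := divisorDegree_mono h
  refine Nat.eq_of_mul_eq_mul_left (pow_pos hq (hZero E)) ?_
  rw [h5, ← pow_add]
  congr 1
  omega

lemma IsCurveFunctionField.exists_ge_degree (D : Place k F →₀ ℤ) (c : ℤ) :
    ∃ E, D ≤ E ∧ c ≤ divisorDegree E := by
  obtain ⟨x, hx, -⟩ := hF.exists_transcendental
  obtain ⟨v, -⟩ := hF.exists_place hx
  set n := (c - divisorDegree D).toNat
  refine ⟨D + Finsupp.single v (n : ℤ),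
    le_add_of_nonneg_right (Finsupp.single_nonneg.mpr (by positivity)), ?_⟩
  rw [divisorDegree_add, divisorDegree_single]
  have h1 := hF.degree_pos v
  have h2 : (n : ℤ) * 1 ≤ n * v.degree := mul_le_mul_of_nonneg_left (by omega) (by positivity)
  omega

lemma IsCurveFunctionField.relIndex_adeles (D : Place k F →₀ ℤ) :
    (box D ⊔ principalAdeles k F).toAddSubgroup.relIndex (adeles k F).toAddSubgroup =
      Nat.card k ^ (hZero D - divisorDegree D - 1 + genus k F).toNat := by
  obtain ⟨c, hc⟩ := hF.exists_forall_degree_le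
  obtain ⟨E, hDE, hEc⟩ := hF.exists_ge_degree D c
  -- Beyond a nonspecial E, enlarging the divisor does not change deg - h⁰, so the index formula
  -- gives 1 and nothing new is added.
  have hA : box E ⊔ principalAdeles k F = adeles k F := by
    refine le_antisymm (sup_le (box_le_adeles E) hF.principalAdeles_le) ?_
    rintro α ⟨E', hα⟩
    have h1 := hF.relIndex_box_sup (le_sup_left : E ≤ E ⊔ E')
    have h2 := divisorDegree_mono (le_sup_left : E ≤ E ⊔ E')
    rw [hc E hEc, hc (E ⊔ E') (hEc.trans h2), show
      ((divisorDegree (E ⊔ E') - (divisorDegree (E ⊔ E') + 1 - genus k F) -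
        (divisorDegree E - (divisorDegree E + 1 - genus k F))) : ℤ).toNat = 0 by omega, pow_zero,
      AddSubgroup.relIndex_eq_one] at h1
    exact h1 (le_sup_left (b := principalAdeles k F) (box_mono le_sup_right hα))
  rw [← hA, hF.relIndex_box_sup hDE, hc E hEc]
  congr 2
  ring

/-- The Weil differentials for D are dual to the finite quotient whose order is `relIndex_adeles`.
-/
lemma IsCurveFunctionField.finite_finrank_weilDifferentials (D : Place k F →₀ ℤ) :
    Module.Finite k (weilDifferentials D) ∧
      (Module.finrank k (weilDifferentials D) : ℤ) =
        hZero D - divisorDegree D - 1 + genus k F := by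
  set T := (box D ⊔ principalAdeles k F).comap (adeles k F).subtype with hT
  have hcard : Nat.card (adeles k F ⧸ T) =
      Nat.card k ^ (hZero D - divisorDegree D - 1 + genus k F).toNat := by
    rw [← hF.relIndex_adeles D]; rfl
  have hq := Finite.one_lt_card (α := k)
  have hfin : Finite (adeles k F ⧸ T) :=
    Nat.finite_of_card_ne_zero (by rw [hcard]; exact pow_ne_zero _ (by omega))
  have hmf : Module.Finite k (adeles k F ⧸ T) := Module.Finite.of_finite
  have hfr : Module.finrank k (adeles k F ⧸ T) =
      (hZero D - divisorDegree D - 1 + genus k F).toNat := by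
    rw [Module.natCard_eq_pow_finrank (K := k)] at hcard
    exact Nat.pow_right_injective hq hcard
  have hge := hF.degree_add_one_sub_hZero_le D
  have e := T.dualQuotEquivDualAnnihilator
  refine ⟨Module.Finite.equiv e, ?_⟩
  have : Module.finrank k (weilDifferentials D) = Module.finrank k (adeles k F ⧸ T) := by
    rw [← Subspace.dual_finrank_eq]
    exact e.finrank_eq.symm
  rw [this, hfr]
  omega

/-- Weil differentials form a one-dimensional space over the function field. -/
lemma IsCurveFunctionField.exists_eq_mulDifferential {D D' : Place k F →₀ ℤ}
    {ω ω' : Module.Dual k (adeles k F)} (hω : ω ≠ 0) (h : ω ∈ weilDifferentials D)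
    (h' : ω' ∈ weilDifferentials D') : ∃ f : F, ω' = hF.mulDifferential ω f := by
  by_contra! hcon
  set B := D ⊓ D'
  have hB : ω ∈ weilDifferentials B := weilDifferentials_anti inf_le_left h
  have hB' : ω' ∈ weilDifferentials B := weilDifferentials_anti inf_le_right h'
  -- If ω' is not a multiple of ω, then (f, g) ↦ fω + gω' embeds L(E) × L(E) into the differentials
  -- for B - E. Dimensions grow like 2 deg E on the left and deg E on the right; this degree of E
  -- makes them clash and makes h⁰(B - E) vanish.
  obtain ⟨E, -, hE⟩ := hF.exists_ge_degree 0 (|divisorDegree B| + 3 * genus k F + 1)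
  have hg := hF.genus_nonneg
  let ψ : (riemannRochSpace E × riemannRochSpace E) →ₗ[k] Module.Dual k (adeles k F) :=
    ((hF.mulDifferential ω).comp (riemannRochSpace E).subtype).coprod
      ((hF.mulDifferential ω').comp (riemannRochSpace E).subtype)
  have hmem : ∀ {η : Module.Dual k (adeles k F)}, η ∈ weilDifferentials B →
      ∀ f ∈ riemannRochSpace E, hF.mulDifferential η f ∈ weilDifferentials (B - E) := by
    intro η hη f hf
    by_cases hf0 : f = 0
    · rw [hf0, map_zero]; exact Submodule.zero_mem _
    rw [hF.mulDifferential_mem_iff hf0]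
    refine weilDifferentials_anti ?_ hη
    have := (hF.mem_riemannRochSpace hf0).mp hf
    rw [sub_sub, add_comm E]
    exact sub_le_self _ this
  have hψ : ∀ p, ψ p ∈ weilDifferentials (B - E) := fun p =>
    Submodule.add_mem _ (hmem hB _ p.1.2) (hmem hB' _ p.2.2)
  have hinj : Function.Injective ψ := by
    rw [← LinearMap.ker_eq_bot, LinearMap.ker_eq_bot']
    rintro ⟨⟨f, hf⟩, ⟨g, hg⟩⟩ hz
    have hz' : hF.mulDifferential ω f + hF.mulDifferential ω' g = 0 := hz
    by_cases hg0 : g = 0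
    · rw [hg0, map_zero, add_zero, ← map_zero (hF.mulDifferential ω)] at hz'
      have hf0 := hF.mulDifferential_injective hω hz'
      ext <;> simp [hf0, hg0]
    · refine (hcon (-(f * g⁻¹)) ?_).elim
      rw [map_neg, hF.mulDifferential_mul, eq_neg_of_add_eq_zero_left hz']
      have : hF.mulDifferential (-hF.mulDifferential ω' g) g⁻¹ =
          -hF.mulDifferential (hF.mulDifferential ω' g) g⁻¹ := by
        ext α; simp [hF.mulDifferential_apply]
      rw [this, neg_neg, ← hF.mulDifferential_mul, mul_inv_cancel₀ hg0, hF.mulDifferential_one]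
  obtain ⟨hfin, hfr⟩ := hF.finite_finrank_weilDifferentials (B - E)
  have := hF.finite_riemannRochSpace E
  have : Module.Finite k (riemannRochSpace E) := Module.Finite.of_finite
  have hle := LinearMap.finrank_le_finrank_of_injective (f := ψ.codRestrict _ hψ)
    (fun a b hab => hinj (congrArg Subtype.val hab))
  rw [Module.finrank_prod] at hle
  have h1 := hF.degree_add_one_sub_hZero_le E
  have h2 : hZero (B - E) = 0 := by
    by_contra hne
    have := hF.divisorDegree_nonneg_of_hZero_pos (Nat.pos_of_ne_zero hne)
    rw [divisorDegree_sub] at this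
    have := le_abs_self (divisorDegree B)
    omega
  rw [h2, divisorDegree_sub] at hfr
  have h3 := neg_abs_le (divisorDegree B)
  have hle' : (hZero E : ℤ) + hZero E ≤ Module.finrank k (weilDifferentials (B - E)) := by
    exact_mod_cast hle
  omega

/-- The **Riemann-Roch theorem**. -/
theorem IsCurveFunctionField.riemannRoch :
    ∃ W : Place k F →₀ ℤ, ∀ D : Place k F →₀ ℤ,
      (hZero D : ℤ) - hZero (W - D) = divisorDegree D + 1 - genus k F := by
  -- Degree 2 makes the space of differentials for -D₁ of dimension at least deg D₁ - 1 + g > 0.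
  obtain ⟨D₁, -, hD₁⟩ := hF.exists_ge_degree 0 2
  have hg := hF.genus_nonneg
  obtain ⟨ω, hω, hω0⟩ : ∃ ω ∈ weilDifferentials (-D₁), ω ≠ 0 := by
    have h1 := (hF.finite_finrank_weilDifferentials (-D₁)).2
    rw [divisorDegree_neg] at h1
    have : Nontrivial (weilDifferentials (-D₁)) :=
      Module.nontrivial_of_finrank_pos (R := k) (by omega)
    obtain ⟨⟨ω, hω⟩, hne⟩ := exists_ne (0 : weilDifferentials (-D₁))
    exact ⟨ω, hω, fun h => hne (Subtype.ext h)⟩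
  obtain ⟨c, hc⟩ := hF.exists_forall_degree_le
  have hbdd : ∀ D, ω ∈ weilDifferentials D → divisorDegree D ≤ c := by
    intro D hD
    by_contra! hlt
    obtain ⟨hfin, hfr⟩ := hF.finite_finrank_weilDifferentials D
    rw [hc D hlt.le] at hfr
    have h0 : Module.finrank k (weilDifferentials D) = 0 := by omega
    rw [Submodule.finrank_eq_zero.mp h0] at hD
    exact hω0 ((Submodule.mem_bot k).mp hD)
  -- A divisor of maximal degree among those admitting ω; closure under suprema makes it the
  -- greatest one, the divisor of ω.
  obtain ⟨d, ⟨W, hW, hdW⟩, hmax⟩ := Int.exists_greatest_of_bdd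
    (P := fun d => ∃ D, ω ∈ weilDifferentials D ∧ divisorDegree D = d)
    ⟨c, by rintro _ ⟨D, hD, rfl⟩; exact hbdd D hD⟩ ⟨_, -D₁, hω, rfl⟩
  have hWmax : ∀ D, ω ∈ weilDifferentials D ↔ D ≤ W := by
    refine fun D => ⟨fun hD => ?_, fun hD => weilDifferentials_anti hD hW⟩
    have h1 := hmax _ ⟨_, weilDifferentials_sup hD hW, rfl⟩
    intro v
    by_contra! hv
    have h2 : W + Finsupp.single v 1 ≤ D ⊔ W := by
      intro w
      rw [Finsupp.add_apply, Finsupp.sup_apply]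
      by_cases hw : w = v
      · subst hw; rw [Finsupp.single_eq_same]; exact le_sup_of_le_left (by omega)
      · rw [Finsupp.single_eq_of_ne hw, add_zero]; exact le_sup_right
    have h3 := divisorDegree_mono h2
    rw [divisorDegree_add, divisorDegree_single] at h3
    have := hF.degree_pos v
    omega
  refine ⟨W, fun D => ?_⟩
  -- Hence f ↦ fω identifies L(W - D) with the Weil differentials for D, whose dimension is known.
  have hmemW : ∀ f, hF.mulDifferential ω f ∈ weilDifferentials D ↔
      f ∈ riemannRochSpace (W - D) := by
    intro f
    by_cases hf : f = 0
    · rw [hf, map_zero]; simp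
    rw [hF.mulDifferential_mem_iff hf, hWmax, hF.mem_riemannRochSpace hf, ← sub_nonneg]
    rw [show W - (D - divisorOf f) = divisorOf f + (W - D) by abel]
  have hmapeq : (riemannRochSpace (W - D)).map (hF.mulDifferential ω) = weilDifferentials D := by
    ext η
    constructor
    · rintro ⟨f, hf, rfl⟩
      exact (hmemW f).mpr hf
    · intro hη
      obtain ⟨f, rfl⟩ := hF.exists_eq_mulDifferential hω0 hω hη
      exact ⟨f, (hmemW f).mp hη, rfl⟩
  have hfr := (hF.finite_finrank_weilDifferentials D).2
  rw [← hmapeq, ← (Submodule.equivMapOfInjective _ (hF.mulDifferential_injective hω0)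
    (riemannRochSpace (W - D))).finrank_eq] at hfr
  change (hZero (W - D) : ℤ) = _ at hfr
  omega

end RiemannRoch

end GroupZeta

namespace GroupZeta

/-! ### Divisor classes and the number of effective divisors -/

section Counting

variable {k F : Type*} [Field k] [Field F] [Algebra k F]

lemma effectiveDegree_eq (D : Place k F →₀ ℕ) :
    (effectiveDegree D : ℤ) = divisorDegree (D.mapRange (Nat.cast : ℕ → ℤ) rfl) := by
  rw [divisorDegree, Finsupp.sum_mapRange_index (by simp), effectiveDegree, Finsupp.sum,
    Finsupp.sum]
  push_cast
  rfl

/-- Effective divisors as divisors. -/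
noncomputable def effectiveEquiv : (Place k F →₀ ℕ) ≃ {E : Place k F →₀ ℤ // 0 ≤ E} where
  toFun D := ⟨D.mapRange (Nat.cast : ℕ → ℤ) rfl, fun v => by simp⟩
  invFun E := E.1.mapRange Int.toNat rfl
  left_inv D := by ext v; simp
  right_inv E := by
    refine Subtype.ext (Finsupp.ext fun v => ?_)
    simpa using E.2 v

variable [Finite k] (hF : IsCurveFunctionField k F)
include hF

lemma IsCurveFunctionField.finite_places (d : ℕ) : {v : Place k F | v.degree = d}.Finite := by
  obtain ⟨x, hx, -⟩ := hF.exists_transcendental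
  have hx0 : x ≠ 0 := fun h => hx (h ▸ isAlgebraic_zero)
  by_cases hd : d = 0
  · convert Set.finite_empty
    ext v
    simpa [hd] using (hF.degree_pos v).ne'
  -- At a place of degree d where x is integral, the residue of x lies in a field with q^d elements,
  -- so y vanishes there. Thus all places of degree d are poles of x or zeros of y.
  set y := x ^ (Nat.card k ^ d) - x with hy
  have hq := Finite.one_lt_card (α := k)
  have hy0 : y ≠ 0 := by
    intro h0
    refine hx ⟨Polynomial.X ^ (Nat.card k ^ d) - Polynomial.X, ?_, by simpa [hy] using h0⟩
    exact FiniteField.X_pow_card_sub_X_ne_zero k (Nat.one_lt_pow hd hq)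
  refine ((hF.finite_support hx0).union (hF.finite_support hy0)).subset fun v hv => ?_
  by_cases hvx : v.val x ≤ 1
  · right
    have hfin := hF.finite_residueField v
    let _ := Fintype.ofFinite (IsLocalRing.ResidueField v.localRing)
    have hcard := hF.card_residueField v
    rw [show v.degree = d from hv, Nat.card_eq_fintype_card] at hcard
    set X : v.localRing := ⟨x, hvx⟩
    have h1 := FiniteField.pow_card (IsLocalRing.residue v.localRing X)
    rw [hcard, ← map_pow, ← sub_eq_zero, ← map_sub, IsLocalRing.residue_eq_zero_iff,
      IsLocalRing.mem_maximalIdeal] at h1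
    have h2 : v.val y < 1 :=
      (Valuation.Integer.not_isUnit_iff_valuation_lt_one (v := v.val)
        (x := (X ^ (Nat.card k ^ d) - X : v.localRing))).mp h1
    rw [v.val_eq_exp hy0, ← WithZero.exp_zero, WithZero.exp_lt_exp] at h2
    exact h2.ne
  · left
    rw [not_le, v.val_eq_exp hx0, ← WithZero.exp_zero, WithZero.exp_lt_exp] at hvx
    exact hvx.ne'

lemma IsCurveFunctionField.finite_effective (n : ℕ) :
    Finite {D : Place k F →₀ ℕ // effectiveDegree D = n} := by
  classical
  have hT : {v : Place k F | v.degree ≤ n}.Finite := by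
    refine ((Set.finite_Iic n).biUnion fun d _ => hF.finite_places d).subset fun v hv => ?_
    exact Set.mem_biUnion (x := v.degree) hv rfl
  have := hT.to_subtype
  have hle : ∀ D : {D : Place k F →₀ ℕ // effectiveDegree D = n}, ∀ v,
      D.1 v * v.degree ≤ n := by
    rintro ⟨D, hD⟩ v
    by_cases hv : v ∈ D.support
    · exact (Finset.single_le_sum (f := fun v => D v * v.degree) (fun _ _ => Nat.zero_le _)
        hv).trans hD.le
    · simp [Finsupp.notMem_support_iff.mp hv]
  refine Finite.of_injective (β := {v : Place k F | v.degree ≤ n} → Fin (n + 1))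
    (fun D v => ⟨D.1 v, ?_⟩) fun D E hDE => ?_
  · have h1 := hle D v
    have h2 := hF.degree_pos v.1
    exact Nat.lt_succ_of_le ((Nat.le_mul_of_pos_right _ h2).trans h1)
  · refine Subtype.ext (Finsupp.ext fun v => ?_)
    by_cases hv : v.degree ≤ n
    · have := congrFun hDE ⟨v, hv⟩
      simpa using this
    · have hz : ∀ D : {D : Place k F →₀ ℕ // effectiveDegree D = n}, D.1 v = 0 := fun D => by
        by_contra hne
        have := hle D v
        have := Nat.le_mul_of_pos_left v.degree (Nat.pos_of_ne_zero hne)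
        omega
      rw [hz, hz]

/-- The principal divisors. -/
def IsCurveFunctionField.principalDivisors : AddSubgroup (Place k F →₀ ℤ) where
  carrier := {D | ∃ f : F, f ≠ 0 ∧ divisorOf f = D}
  add_mem' := by
    rintro _ _ ⟨f, hf, rfl⟩ ⟨g, hg, rfl⟩
    exact ⟨f * g, mul_ne_zero hf hg, hF.divisorOf_mul hf hg⟩
  zero_mem' := ⟨1, one_ne_zero, hF.divisorOf_one⟩
  neg_mem' := by
    rintro _ ⟨f, hf, rfl⟩
    exact ⟨f⁻¹, inv_ne_zero hf, hF.divisorOf_inv f⟩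

/-- The divisor class group. -/
abbrev IsCurveFunctionField.Cl : Type _ := (Place k F →₀ ℤ) ⧸ hF.principalDivisors

/-- The degree of a divisor class. -/
noncomputable def IsCurveFunctionField.clDegree : hF.Cl →+ ℤ :=
  QuotientAddGroup.lift hF.principalDivisors
    { toFun := divisorDegree, map_zero' := divisorDegree_zero, map_add' := divisorDegree_add }
    (by rintro _ ⟨f, hf, rfl⟩; exact hF.divisorDegree_divisorOf hf)

lemma IsCurveFunctionField.clDegree_mk (D : Place k F →₀ ℤ) :
    hF.clDegree (D : hF.Cl) = divisorDegree D := rfl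

lemma IsCurveFunctionField.mk_eq_iff {D E : Place k F →₀ ℤ} :
    (D : hF.Cl) = E ↔ ∃ f : F, f ≠ 0 ∧ divisorOf f = E - D := by
  rw [QuotientAddGroup.eq, neg_add_eq_sub]
  rfl

/-- The dimension of the space of sections of a divisor class. -/
noncomputable def IsCurveFunctionField.clHZero : hF.Cl → ℕ :=
  Quotient.lift hZero fun D E h => by
    obtain ⟨f, hf, hfe⟩ := hF.mk_eq_iff.mp (Quotient.sound h : (D : hF.Cl) = E)
    rw [← hF.hZero_add_divisorOf hf D, hfe, add_sub_cancel]

lemma IsCurveFunctionField.clHZero_mk (D : Place k F →₀ ℤ) :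
    hF.clHZero (D : hF.Cl) = hZero D := rfl

/-- The effective divisors in a divisor class. -/
abbrev IsCurveFunctionField.LinearSystem (c : hF.Cl) : Type _ :=
  {E : Place k F →₀ ℤ // 0 ≤ E ∧ (E : hF.Cl) = c}

/-- The effective divisors in the class of D are (f) + D for nonzero f in L(D), and f is unique up
to k^×, since a function with divisor 0 is constant. -/
lemma IsCurveFunctionField.card_linearSystem (c : hF.Cl) :
    (Nat.card k - 1) * Nat.card (hF.LinearSystem c) = Nat.card k ^ hF.clHZero c - 1 := by
  induction c using QuotientAddGroup.induction_on with
  | H D =>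
  have hex : ∀ E : hF.LinearSystem D, ∃ f : F, f ≠ 0 ∧ divisorOf f = E.1 - D := fun E =>
    hF.mk_eq_iff.mp E.2.2.symm
  choose φ hφ0 hφ using hex
  have hdiv : ∀ (a : kˣ) (f : F), f ≠ 0 →
      (divisorOf (algebraMap k F a * f) : Place k F →₀ ℤ) = divisorOf f := by
    intro a f hf
    ext v
    rw [hF.divisorOf_apply, hF.divisorOf_apply, v.val_algebraMap_mul a.ne_zero]
  let ψ : kˣ × hF.LinearSystem D → {f : riemannRochSpace D // f ≠ 0} := fun p =>
    ⟨⟨algebraMap k F p.1 * φ p.2, by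
      rw [hF.mem_riemannRochSpace (mul_ne_zero (by simp) (hφ0 _)), hdiv _ _ (hφ0 _), hφ,
        sub_add_cancel]
      exact p.2.2.1⟩, fun h => mul_ne_zero (by simp) (hφ0 p.2) (congrArg Subtype.val h)⟩
  have hψ : Function.Bijective ψ := by
    constructor
    · rintro ⟨a, E⟩ ⟨a', E'⟩ h
      have h1 : algebraMap k F a * φ E = algebraMap k F a' * φ E' :=
        congrArg (fun z => (z.1 : F)) h
      have h2 := congrArg (divisorOf (k := k)) h1
      rw [hdiv _ _ (hφ0 _), hdiv _ _ (hφ0 _), hφ, hφ, sub_left_inj] at h2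
      have h3 : E = E' := Subtype.ext h2
      subst h3
      have h4 := (algebraMap k F).injective (mul_right_cancel₀ (hφ0 E) h1)
      rw [Units.ext h4]
    · rintro ⟨⟨f, hf⟩, hne⟩
      have hf0 : f ≠ 0 := fun h => hne (Subtype.ext h)
      have hE : 0 ≤ divisorOf f + D := (hF.mem_riemannRochSpace hf0).mp hf
      let E : hF.LinearSystem D := ⟨divisorOf f + D, hE, by
        rw [eq_comm, hF.mk_eq_iff]
        exact ⟨f, hf0, by rw [add_sub_cancel_right]⟩⟩
      have hdivE : (divisorOf (f * (φ E)⁻¹) : Place k F →₀ ℤ) = 0 := by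
        rw [hF.divisorOf_mul hf0 (inv_ne_zero (hφ0 E)), hF.divisorOf_inv, hφ]
        simp [E]
      have hfE : f * (φ E)⁻¹ ≠ 0 := mul_ne_zero hf0 (inv_ne_zero (hφ0 E))
      obtain ⟨a, ha⟩ := hF.mem_riemannRochSpace_zero.mp ((hF.mem_riemannRochSpace hfE
        (D := 0)).mpr (by rw [hdivE, add_zero]))
      have ha0 : a ≠ 0 := by
        rintro rfl
        rw [map_zero] at ha
        exact hfE ha.symm
      refine ⟨(Units.mk0 a ha0, E), Subtype.ext (Subtype.ext ?_)⟩
      change algebraMap k F a * φ E = f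
      rw [ha, inv_mul_cancel_right₀ (hφ0 E)]
  have := hF.finite_riemannRochSpace D
  have h1 := Nat.card_congr (Equiv.ofBijective ψ hψ)
  rw [Nat.card_prod, Nat.card_units] at h1
  rw [h1, hF.clHZero_mk, ← hF.card_riemannRochSpace]
  classical
  let _ := Fintype.ofFinite (riemannRochSpace D)
  rw [Nat.card_eq_fintype_card, Nat.card_eq_fintype_card, Fintype.card_subtype_compl,
    Fintype.card_subtype_eq]

/-- The divisor classes of degree `n`. -/
abbrev IsCurveFunctionField.ClOfDegree (n : ℤ) : Type _ := {c : hF.Cl // hF.clDegree c = n}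

/-- Translation by a class of degree `m`. -/
noncomputable def IsCurveFunctionField.clTranslate (b : hF.Cl) (n : ℤ) :
    hF.ClOfDegree n ≃ hF.ClOfDegree (n + hF.clDegree b) where
  toFun c := ⟨c + b, by rw [map_add, c.2]⟩
  invFun c := ⟨c - b, by rw [map_sub, c.2, add_sub_cancel_right]⟩
  left_inv c := by simp
  right_inv c := by simp

/-- Reflection of the divisor classes. -/
noncomputable def IsCurveFunctionField.clReflect (b : hF.Cl) (n : ℤ) :
    hF.ClOfDegree n ≃ hF.ClOfDegree (hF.clDegree b - n) where
  toFun c := ⟨b - c, by rw [map_sub, c.2]⟩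
  invFun c := ⟨b - c, by rw [map_sub, c.2, sub_sub_cancel]⟩
  left_inv c := by simp
  right_inv c := by simp

lemma IsCurveFunctionField.sigma_linearSystem_ext {n : ℤ}
    {p r : Σ c : hF.ClOfDegree n, hF.LinearSystem c} (h : p.2.1 = r.2.1) : p = r := by
  obtain ⟨⟨c, hc⟩, ⟨E, hE, hEc⟩⟩ := p
  obtain ⟨⟨d, hd⟩, ⟨E', hE', hEd⟩⟩ := r
  obtain rfl : E = E' := h
  obtain rfl : (E : hF.Cl) = c := hEc
  obtain rfl : (E : hF.Cl) = d := hEd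
  rfl

/-- Effective divisors of degree `n`, sorted by divisor class. -/
noncomputable def IsCurveFunctionField.effectiveSigma (n : ℕ) :
    {D : Place k F →₀ ℕ // effectiveDegree D = n} ≃
      Σ c : hF.ClOfDegree n, hF.LinearSystem c where
  toFun D := ⟨⟨(effectiveEquiv D.1).1, by
      rw [hF.clDegree_mk]; exact (effectiveDegree_eq D.1).symm.trans (by rw [D.2])⟩,
    ⟨(effectiveEquiv D.1).1, (effectiveEquiv D.1).2, rfl⟩⟩
  invFun p := ⟨effectiveEquiv.symm ⟨p.2.1, p.2.2.1⟩, by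
    have h1 := effectiveDegree_eq (effectiveEquiv.symm ⟨p.2.1, p.2.2.1⟩)
    have h2 : (effectiveEquiv (effectiveEquiv.symm ⟨p.2.1, p.2.2.1⟩)).1 = p.2.1 := by
      rw [Equiv.apply_symm_apply]
    change _ = divisorDegree (effectiveEquiv (effectiveEquiv.symm ⟨p.2.1, p.2.2.1⟩)).1 at h1
    have h3 : divisorDegree p.2.1 = n :=
      (hF.clDegree_mk p.2.1).symm.trans ((congrArg hF.clDegree p.2.2.2).trans p.1.2)
    rw [h2, h3] at h1
    exact_mod_cast h1⟩
  left_inv D := by simp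
  right_inv p := hF.sigma_linearSystem_ext (by simp)

lemma IsCurveFunctionField.finite_clOfDegree (n : ℤ) : Finite (hF.ClOfDegree n) := by
  -- Translating by B moves degree n into the range where Riemann's inequality puts an effective
  -- divisor in every class; there are finitely many effective divisors of given degree.
  obtain ⟨B, -, hB⟩ := hF.exists_ge_degree 0 (|n| + genus k F + 1)
  set m := n + divisorDegree B
  have hg := hF.genus_nonneg
  have hn := neg_abs_le n
  have hm : 0 ≤ m := by omega
  obtain ⟨m', hm'⟩ := Int.eq_ofNat_of_zero_le hm
  have hfin := hF.finite_effective m'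
  have hfin2 : Finite (Σ c : hF.ClOfDegree m', hF.LinearSystem c) :=
    Finite.of_equiv _ (hF.effectiveSigma m')
  have hfin3 : Finite (hF.ClOfDegree m') := by
    refine Finite.of_surjective (fun p : Σ c : hF.ClOfDegree m', hF.LinearSystem c => p.1) ?_
    intro c
    have hpos : 0 < Nat.card (hF.LinearSystem c.1) := by
      have h1 := hF.card_linearSystem c.1
      have h2 : 0 < hF.clHZero c.1 := by
        obtain ⟨⟨D, hD⟩, hc⟩ : ∃ D : {D : Place k F →₀ ℤ // (D : hF.Cl) = c.1}, True :=
          ⟨⟨_, (QuotientAddGroup.mk_surjective c.1).choose_spec⟩, trivial⟩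
        rw [← hD, hF.clHZero_mk]
        have h3 := hF.degree_add_one_sub_hZero_le D
        have h4 : divisorDegree D = m' := by rw [← hF.clDegree_mk, hD, c.2]
        omega
      have hq := Finite.one_lt_card (α := k)
      have h5 : 1 < Nat.card k ^ hF.clHZero c.1 := Nat.one_lt_pow h2.ne' hq
      by_contra h0
      rw [Nat.eq_zero_of_not_pos h0, mul_zero] at h1
      omega
    obtain ⟨E⟩ := (Nat.card_pos_iff.mp hpos).1
    exact ⟨⟨c, E⟩, rfl⟩
  rw [← hm'] at hfin3
  have hfin4 : Finite (hF.ClOfDegree (n + hF.clDegree (B : hF.Cl))) := hfin3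
  exact Finite.of_equiv _ (hF.clTranslate (B : hF.Cl) n).symm

/-- The number of effective divisors of degree `n`. -/
noncomputable def effectiveCount (k F : Type*) [Field k] [Field F] [Algebra k F] (n : ℤ) : ℕ :=
  if 0 ≤ n then Nat.card {D : Place k F →₀ ℕ // effectiveDegree D = n.toNat} else 0

lemma IsCurveFunctionField.effectiveCount_zero : effectiveCount k F 0 = 1 := by
  rw [effectiveCount, if_pos le_rfl, Nat.card_eq_one_iff_unique]
  refine ⟨⟨?_⟩, ⟨0, by simp [effectiveDegree]⟩⟩
  have hz : ∀ D : {D : Place k F →₀ ℕ // effectiveDegree D = (0 : ℤ).toNat}, D.1 = 0 := by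
    rintro ⟨D, hD⟩
    ext v
    by_contra hne
    have hv : v ∈ D.support := Finsupp.mem_support_iff.mpr hne
    have h1 := (Finset.sum_eq_zero_iff.mp hD) v hv
    rcases Nat.mul_eq_zero.mp h1 with h | h
    · exact hne h
    · exact (hF.degree_pos v).ne' h
  exact fun D E => Subtype.ext ((hz D).trans (hz E).symm)

lemma IsCurveFunctionField.card_sub_one_mul_effectiveCount (n : ℤ)
    [Fintype (hF.ClOfDegree n)] :
    ((Nat.card k : ℝ) - 1) * effectiveCount k F n =
      ∑ c : hF.ClOfDegree n, ((Nat.card k : ℝ) ^ hF.clHZero c.1 - 1) := by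
  have hq := Finite.one_lt_card (α := k)
  by_cases hn : 0 ≤ n
  · obtain ⟨m, rfl⟩ := Int.eq_ofNat_of_zero_le hn
    have hfin := hF.finite_effective m
    have hfin2 : Finite (Σ c : hF.ClOfDegree m, hF.LinearSystem c) :=
      Finite.of_equiv _ (hF.effectiveSigma m)
    have hfin3 : ∀ c : hF.ClOfDegree m, Finite (hF.LinearSystem c) := fun c =>
      Finite.of_injective (fun E => (⟨c, E⟩ : Σ c : hF.ClOfDegree m, hF.LinearSystem c))
        fun a b h => by simpa using h
    rw [effectiveCount, if_pos hn, Int.toNat_natCast, Nat.card_congr (hF.effectiveSigma m),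
      Nat.card_sigma, Nat.cast_sum, Finset.mul_sum]
    refine Finset.sum_congr rfl fun c _ => ?_
    have h1 := hF.card_linearSystem c.1
    have h2 : (((Nat.card k - 1) * Nat.card (hF.LinearSystem c.1) : ℕ) : ℝ) =
        ((Nat.card k ^ hF.clHZero c.1 - 1 : ℕ) : ℝ) := by rw [h1]
    rw [Nat.cast_mul, Nat.cast_sub hq.le, Nat.cast_sub (Nat.one_le_pow _ _ (by omega))] at h2
    push_cast at h2
    exact h2
  · rw [effectiveCount, if_neg hn, Nat.cast_zero, mul_zero]
    refine (Finset.sum_eq_zero fun c _ => ?_).symm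
    have h0 : hF.clHZero c.1 = 0 := by
      obtain ⟨D, hD⟩ := QuotientAddGroup.mk_surjective c.1
      have h4 : divisorDegree D = n := by rw [← hF.clDegree_mk, ← c.2, ← hD]
      rw [← hD, hF.clHZero_mk]
      by_contra hne
      have := hF.divisorDegree_nonneg_of_hZero_pos (Nat.pos_of_ne_zero hne)
      omega
    rw [h0, pow_zero, sub_self]

/-- The symmetry of the numbers of effective divisors. -/
theorem IsCurveFunctionField.exists_symmetry :
    ∃ (e : ℕ) (a : ℤ → ℝ), 0 < e ∧ (∀ n, a (n + e) = a n) ∧ ∀ n : ℤ,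
      ((Nat.card k : ℝ) - 1) * effectiveCount k F n -
        (Nat.card k : ℝ) ^ (n + 1 - genus k F) *
          (((Nat.card k : ℝ) - 1) * effectiveCount k F (2 * genus k F - 2 - n)) =
      ((Nat.card k : ℝ) ^ (n + 1 - genus k F) - 1) * a n := by
  obtain ⟨x, hx, -⟩ := hF.exists_transcendental
  obtain ⟨v, -⟩ := hF.exists_place hx
  obtain ⟨W, hW⟩ := hF.riemannRoch
  have hWdeg : divisorDegree W = 2 * genus k F - 2 := by
    have h1 := hW 0
    have h2 := hW W
    rw [sub_zero, hF.hZero_zero, divisorDegree_zero] at h1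
    rw [sub_self, hF.hZero_zero] at h2
    push_cast at h1 h2
    omega
  have hq : (Nat.card k : ℝ) ≠ 0 := by
    have := Finite.one_lt_card (α := k)
    positivity
  -- Here a(n) is the number of classes of degree n, periodic under translation by the class of v.
  -- The symmetry is Riemann-Roch summed over classes, paired by c ↦ W - c.
  refine ⟨v.degree, fun n => Nat.card (hF.ClOfDegree n), hF.degree_pos v, fun n => ?_, fun n => ?_⟩
  · have h := Nat.card_congr (hF.clTranslate (Finsupp.single v (1 : ℤ) : Place k F →₀ ℤ) n)
    rw [hF.clDegree_mk, divisorDegree_single, one_mul] at h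
    simp only [h]
  · have := hF.finite_clOfDegree n
    have := hF.finite_clOfDegree (2 * genus k F - 2 - n)
    let _ := Fintype.ofFinite (hF.ClOfDegree n)
    let _ := Fintype.ofFinite (hF.ClOfDegree (2 * genus k F - 2 - n))
    have hrefl : hF.clDegree (W : hF.Cl) - n = 2 * genus k F - 2 - n := by
      rw [hF.clDegree_mk, hWdeg]
    let e : hF.ClOfDegree n ≃ hF.ClOfDegree (2 * genus k F - 2 - n) :=
      (hF.clReflect (W : hF.Cl) n).trans (Equiv.subtypeEquivRight fun c => by rw [hrefl])
    rw [hF.card_sub_one_mul_effectiveCount, hF.card_sub_one_mul_effectiveCount,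
      ← Equiv.sum_comp e, Finset.mul_sum, ← Finset.sum_sub_distrib, mul_comm _ (Nat.cast _),
      ← nsmul_eq_mul, Nat.card_eq_fintype_card (α := hF.ClOfDegree n), ← Finset.card_univ,
      ← Finset.sum_const]
    refine Finset.sum_congr rfl fun c _ => ?_
    have hec : ((e c).1 : hF.Cl) = (W : hF.Cl) - c.1 := rfl
    obtain ⟨D, hD⟩ := QuotientAddGroup.mk_surjective c.1
    have h4 : divisorDegree D = n := by rw [← hF.clDegree_mk, ← c.2, ← hD]
    rw [hec, ← hD, ← QuotientAddGroup.mk_sub, hF.clHZero_mk, hF.clHZero_mk]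
    have h5 := hW D
    have h6 : (Nat.card k : ℝ) ^ hZero D =
        (Nat.card k : ℝ) ^ (n + 1 - genus k F) * (Nat.card k : ℝ) ^ hZero (W - D) := by
      rw [← zpow_natCast, ← zpow_natCast, ← zpow_add₀ hq]
      congr 1
      omega
    rw [h6]
    ring

end Counting

end GroupZeta

namespace GroupZeta

/-! ### Rationality of the zeta function and symmetry of its numerator -/

section ZetaFunction

/-- Multiplication of a two-sided sequence of coefficients by `(1 - T ^ e) (1 - (q T) ^ e)`. -/
def eulerTwist (q : ℝ) (e : ℕ) (A : ℤ → ℝ) (n : ℤ) : ℝ :=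
  A n - (1 + q ^ e) * A (n - e) + q ^ e * A (n - 2 * e)

/-- The hypothesis is a symmetry of A up to the error (q^{n+1-g} - 1) a(n). The factor 1 - T^e
annihilates the e-periodic part of the error, and 1 - (qT)^e annihilates q^n times an e-periodic
sequence. -/
lemma eulerTwist_symm {q : ℝ} (hq : 1 < q) {e : ℕ} {A a : ℤ → ℝ} {g : ℤ}
    (ha : ∀ n, a (n + e) = a n)
    (h : ∀ n : ℤ, (q - 1) * A n - q ^ (n + 1 - g) * ((q - 1) * A (2 * g - 2 - n)) =
      (q ^ (n + 1 - g) - 1) * a n) (n : ℤ) :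
    eulerTwist q e A n =
      q ^ (n + 1 - g - e) * eulerTwist q e A (2 * g - 2 + 2 * e - n) := by
  have hq0 : q ≠ 0 := by positivity
  have hq1 : q - 1 ≠ 0 := by linarith
  have h0 := h n
  have h1 := h (n - e)
  have h2 := h (n - 2 * e)
  have a1 : a (n - e) = a n := by rw [← ha (n - e), sub_add_cancel]
  have a2 : a (n - 2 * e) = a n := by
    rw [← ha (n - 2 * e), show n - 2 * (e : ℤ) + e = n - e by ring, a1]
  have p1 : q ^ (n + 1 - g) = q ^ (n + 1 - g - e) * q ^ e := by
    rw [← zpow_natCast, ← zpow_add₀ hq0]; congr 1; ring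
  have p2 : q ^ (n - e + 1 - g) = q ^ (n + 1 - g - e) := by congr 1; ring
  have p3 : q ^ (n - 2 * e + 1 - g) * q ^ e = q ^ (n + 1 - g - e) := by
    rw [← zpow_natCast, ← zpow_add₀ hq0]; congr 1; ring
  rw [p1] at h0
  rw [p2, a1] at h1
  rw [a2] at h2
  simp only [eulerTwist]
  rw [show 2 * g - 2 + 2 * e - n - e = 2 * g - 2 - (n - e) by ring,
    show 2 * g - 2 + 2 * e - n - 2 * e = 2 * g - 2 - n by ring,
    show 2 * g - 2 + 2 * e - n = 2 * g - 2 - (n - 2 * e) by ring]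
  refine mul_left_cancel₀ hq1 ?_
  linear_combination h0 - (1 + q ^ e) * h1 + q ^ e * h2 + (a n + (q - 1) * A (2 * g - 2 - (n - 2 * e))) * p3

lemma bounded_of_periodic {a : ℤ → ℝ} {e : ℕ} (he : 0 < e) (ha : ∀ n, a (n + e) = a n) :
    ∃ C, 0 ≤ C ∧ ∀ n, |a n| ≤ C := by
  have hper : Function.Periodic a (e : ℤ) := ha
  refine ⟨∑ i ∈ Finset.range e, |a i|, Finset.sum_nonneg fun _ _ => abs_nonneg _, fun n => ?_⟩
  have he' : (0 : ℤ) < e := by exact_mod_cast he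
  have h1 : a n = a ((n % e).toNat) := by
    rw [Int.toNat_of_nonneg (Int.emod_nonneg _ he'.ne')]
    have := hper.sub_zsmul_eq (x := n) (n / e)
    rw [← this, smul_eq_mul, mul_comm, Int.emod_def]
  rw [h1]
  refine Finset.single_le_sum (f := fun i : ℕ => |a i|) (fun _ _ => abs_nonneg _) ?_
  rw [Finset.mem_range]
  have := Int.emod_lt_of_pos n he'
  omega

variable {k F : Type*} [Field k] [Field F] [Algebra k F]

/-- The denominator of the zeta function. -/
noncomputable def zetaDenom (q : ℂ) (e : ℕ) : Polynomial ℂ :=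
  (1 - Polynomial.X ^ e) * (1 - Polynomial.C (q ^ e) * Polynomial.X ^ e)

lemma eval_zetaDenom (q : ℂ) (e : ℕ) (T : ℂ) :
    (zetaDenom q e).eval T = (1 - T ^ e) * (1 - (q * T) ^ e) := by
  simp [zetaDenom, mul_pow]

lemma zetaDenom_ne_zero (q : ℂ) {e : ℕ} (he : 0 < e) : zetaDenom q e ≠ 0 := by
  intro h
  have := congrArg (Polynomial.eval 0) h
  rw [eval_zetaDenom] at this
  simp [he.ne'] at this

/-- Evaluation of a rational function refers to its reduced fraction; coprimality ensures that the
reduced denominator is nonzero wherever D is. -/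
lemma eval_zetaRatFunc {L D : Polynomial ℂ} (hD : D ≠ 0)
    (h : (D : ℂ⟦X⟧) * zetaSeries k F = L) {T : ℂ} (hT : D.eval T ≠ 0) :
    (zetaRatFunc k F).eval (RingHom.id ℂ) T = L.eval T / D.eval T := by
  have hcoe : Function.Injective (Polynomial.toPowerSeries : Polynomial ℂ → ℂ⟦X⟧) :=
    Polynomial.coe_injective ℂ
  have hD' : (D : ℂ⟦X⟧) ≠ 0 := fun h0 => hD (hcoe (by simpa using h0))
  have hex : ∃ R : RatFunc ℂ, (R.denom : ℂ⟦X⟧) * zetaSeries k F = (R.num : ℂ⟦X⟧) := by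
    set R : RatFunc ℂ := algebraMap _ _ L / algebraMap _ _ D
    refine ⟨R, mul_left_cancel₀ hD' ?_⟩
    have hR : R.num * D = L * R.denom :=
      (RatFunc.num_mul_eq_mul_denom_iff hD).mpr rfl
    rw [mul_left_comm, h, ← Polynomial.coe_mul, ← Polynomial.coe_mul, mul_comm, ← hR, mul_comm]
  have hspec : ((zetaRatFunc k F).denom : ℂ⟦X⟧) * zetaSeries k F = ((zetaRatFunc k F).num : ℂ⟦X⟧) := by
    rw [zetaRatFunc, dif_pos hex]
    exact hex.choose_spec
  set R := zetaRatFunc k F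
  have hpoly : L * R.denom = R.num * D := by
    apply hcoe
    rw [Polynomial.coe_mul, Polynomial.coe_mul, ← h, ← hspec]
    ring
  have hden : R.denom.eval T ≠ 0 := by
    intro h0
    obtain ⟨a, b, hab⟩ := R.isCoprime_num_denom
    have h1 := congrArg (Polynomial.eval T) hpoly
    have h2 := congrArg (Polynomial.eval T) hab
    simp only [Polynomial.eval_mul, Polynomial.eval_add, Polynomial.eval_one, h0, mul_zero,
      add_zero] at h1 h2
    rcases mul_eq_zero.mp h1.symm with h3 | h3
    · rw [h3, mul_zero] at h2; exact zero_ne_one h2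
    · exact hT h3
  have h1 := congrArg (Polynomial.eval T) hpoly
  rw [Polynomial.eval_mul, Polynomial.eval_mul] at h1
  rw [RatFunc.eval, Polynomial.eval₂_id, Polynomial.eval₂_id, div_eq_div_iff hden hT, h1]

variable [Finite k] (hF : IsCurveFunctionField k F)
include hF

/-- Rationality of the zeta function, and the symmetry of its numerator. -/
lemma IsCurveFunctionField.exists_numerator :
    ∃ (e : ℕ) (L : Polynomial ℂ), 0 < e ∧
      ((zetaDenom (Nat.card k) e : Polynomial ℂ) : ℂ⟦X⟧) * zetaSeries k F = L ∧
      (∀ T : ℂ, T ≠ 0 → L.eval ((Nat.card k : ℂ) * T)⁻¹ =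
        (Nat.card k : ℂ) ^ (1 - genus k F - e) * T ^ (-(2 * genus k F - 2 + 2 * e)) * L.eval T) ∧
      ∀ T : ℝ, 0 < T → (Nat.card k : ℝ) * T < 1 → L.eval (T : ℂ) ≠ 0 := by
  obtain ⟨e, a, he, ha, hsymm⟩ := hF.exists_symmetry
  have hq : (1 : ℝ) < Nat.card k := by exact_mod_cast Finite.one_lt_card (α := k)
  set q : ℝ := (Nat.card k : ℝ) with hqdef
  have hq0 : q ≠ 0 := by positivity
  set g := genus k F
  set A : ℤ → ℝ := fun n => effectiveCount k F n with hA
  have hAneg : ∀ n < 0, A n = 0 := fun n hn => by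
    simp [hA, effectiveCount, not_le.mpr hn]
  have hA0 : A 0 = 1 := by simp [hA, hF.effectiveCount_zero]
  have hAnonneg : ∀ n, 0 ≤ A n := fun n => by simp [hA]
  set d := eulerTwist q e A with hd
  have hdsymm := eulerTwist_symm hq (A := A) ha hsymm
  rw [← hd] at hdsymm
  have he' : (0 : ℤ) < e := by exact_mod_cast he
  have hdneg : ∀ n < 0, d n = 0 := fun n hn => by
    simp only [hd, eulerTwist]
    rw [hAneg n hn, hAneg (n - e) (by omega), hAneg (n - 2 * e) (by omega)]; ring
  have hd0 : d 0 = 1 := by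
    simp only [hd, eulerTwist]
    rw [hA0, hAneg (0 - e) (by omega), hAneg (0 - 2 * e) (by omega)]; ring
  -- The symmetry exchanges large degrees with negative ones, where there are no effective divisors;
  -- so the numerator is a polynomial.
  have hdlarge : ∀ n, 2 * g - 2 + 2 * e < n → d n = 0 := fun n hn => by
    rw [hdsymm n, hdneg _ (by omega), mul_zero]
  have hM : 0 ≤ 2 * g - 2 + 2 * (e : ℤ) := by
    by_contra! hlt
    have := hdlarge 0 hlt
    rw [hd0] at this
    exact one_ne_zero this
  obtain ⟨M, hMeq⟩ := Int.eq_ofNat_of_zero_le hM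
  set L : Polynomial ℂ := ∑ n ∈ Finset.range (M + 1), Polynomial.C (d n : ℂ) * Polynomial.X ^ n
    with hL
  have hLeval : ∀ T : ℂ, L.eval T = ∑ n ∈ Finset.range (M + 1), (d n : ℂ) * T ^ n := fun T => by
    simp [hL, Polynomial.eval_finsetSum]
  have hqc : ((q : ℝ) : ℂ) = (Nat.card k : ℂ) := by simp [hqdef]
  have hqc0 : (Nat.card k : ℂ) ≠ 0 := by rw [← hqc]; exact_mod_cast hq0
  refine ⟨e, L, he, ?_, ?_, ?_⟩
  · have hcoeff : ∀ n : ℕ, PowerSeries.coeff n (zetaSeries k F) = (A n : ℂ) := fun n => by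
      simp [zetaSeries, hA, effectiveCount]
    have hshift : ∀ (m n : ℕ), PowerSeries.coeff n
        ((PowerSeries.X : ℂ⟦X⟧) ^ m * zetaSeries k F) = (A (n - m) : ℂ) := by
      intro m n
      rw [PowerSeries.coeff_X_pow_mul']
      split_ifs with h
      · rw [hcoeff, Nat.cast_sub h]
      · rw [hAneg _ (by omega)]; simp
    ext n
    have hexp : ((zetaDenom (Nat.card k) e : Polynomial ℂ) : ℂ⟦X⟧) * zetaSeries k F =
        zetaSeries k F - PowerSeries.C (1 + (Nat.card k : ℂ) ^ e) *
          ((PowerSeries.X : ℂ⟦X⟧) ^ e * zetaSeries k F) +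
        PowerSeries.C ((Nat.card k : ℂ) ^ e) *
          ((PowerSeries.X : ℂ⟦X⟧) ^ (2 * e) * zetaSeries k F) := by
      simp only [zetaDenom, Polynomial.coe_mul, Polynomial.coe_sub, Polynomial.coe_one,
        Polynomial.coe_pow, Polynomial.coe_X, Polynomial.coe_C, map_add, map_one]
      ring
    rw [hexp, map_add, map_sub, PowerSeries.coeff_C_mul, PowerSeries.coeff_C_mul, hshift, hshift,
      hcoeff, Polynomial.coeff_coe]
    have hLc : L.coeff n = (d n : ℂ) := by
      simp only [hL, Polynomial.finsetSum_coeff, Polynomial.coeff_C_mul_X_pow]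
      rw [Finset.sum_ite_eq]
      split_ifs with h
      · rfl
      · rw [hdlarge n (by rw [Finset.mem_range] at h; omega)]; simp
    rw [hLc]
    simp only [hd, eulerTwist]
    push_cast
    rw [hqc]
  · intro T hT
    rw [hLeval, hLeval, ← Finset.sum_range_reflect, Finset.mul_sum]
    refine Finset.sum_congr rfl fun n hn => ?_
    rw [Finset.mem_range] at hn
    rw [Nat.add_sub_cancel]
    have hcast : ((M - n : ℕ) : ℤ) = 2 * g - 2 + 2 * e - n := by omega
    have h1 := hdsymm ((M - n : ℕ) : ℤ)
    have h1' : d ((M - n : ℕ) : ℤ) = q ^ (2 * g - 2 + 2 * e - n + 1 - g - e) * d n := by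
      rw [h1, hcast]; congr 2; ring
    rw [h1']
    push_cast
    rw [hqc, inv_pow, mul_pow, mul_inv, ← zpow_natCast, ← zpow_natCast T, ← zpow_natCast T,
      ← zpow_neg, ← zpow_neg, hcast]
    have e1 : (Nat.card k : ℂ) ^ (1 - g - (e : ℤ)) =
        (Nat.card k : ℂ) ^ (2 * g - 2 + 2 * e - n + 1 - g - (e : ℤ)) *
          (Nat.card k : ℂ) ^ (-(2 * g - 2 + 2 * (e : ℤ) - n)) := by
      rw [← zpow_add₀ hqc0]; congr 1; ring
    have e2 : T ^ (-(2 * g - 2 + 2 * (e : ℤ) - n)) =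
        T ^ (-(2 * g - 2 + 2 * (e : ℤ))) * T ^ (n : ℤ) := by
      rw [← zpow_add₀ hT]; congr 1; ring
    rw [e1, e2]
    ring
  -- For 0 < T < 1/q the series converges, and L(T) is a product of positive numbers: its two Euler
  -- factors and a sum of nonnegative terms starting with 1.
  · intro T hT0 hT1
    have hTne : T ≠ 0 := hT0.ne'
    obtain ⟨C, hC0, hC⟩ := bounded_of_periodic he ha
    -- Past degree 2g - 2 the reflected count is 0, so the symmetry computes A n exactly, with
    -- growth at most a constant times q^n.
    have hbound : ∀ n : ℕ, 2 * g - 2 < n → g - 1 ≤ n →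
        A n * T ^ n ≤ (q ^ (1 - g) * C / (q - 1)) * (q * T) ^ n := by
      intro n hn hn'
      have h1 := hsymm n
      have h2 : A (2 * g - 2 - n) = 0 := hAneg _ (by omega)
      change (q - 1) * A n - q ^ ((n : ℤ) + 1 - g) * ((q - 1) * A (2 * g - 2 - n)) = _ at h1
      rw [h2, mul_zero, mul_zero, sub_zero] at h1
      have h3 : (q - 1) * A n ≤ q ^ ((n : ℤ) + 1 - g) * C := by
        rw [h1]
        have h4 : 1 ≤ q ^ ((n : ℤ) + 1 - g) := one_le_zpow₀ hq.le (by omega)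
        have h5 := (le_abs_self _).trans (hC n)
        nlinarith
      have h4 : q ^ ((n : ℤ) + 1 - g) = q ^ (1 - g) * q ^ n := by
        rw [← zpow_natCast q n, ← zpow_add₀ hq0]; congr 1; ring
      have h5 : A n ≤ q ^ (1 - g) * C / (q - 1) * q ^ n := by
        rw [div_mul_eq_mul_div, le_div_iff₀ (by linarith)]
        calc A n * (q - 1) = (q - 1) * A n := by ring
          _ ≤ _ := h3
          _ = _ := by rw [h4]; ring
      calc A n * T ^ n ≤ q ^ (1 - g) * C / (q - 1) * q ^ n * T ^ n := by gcongr
        _ = _ := by rw [mul_pow]; ring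
    have hsumN : Summable fun n : ℕ => A n * T ^ n := by
      refine Summable.of_norm_bounded_eventually_nat
        (g := fun n => (q ^ (1 - g) * C / (q - 1)) * (q * T) ^ n) ?_ ?_
      · exact (summable_geometric_of_lt_one (by positivity) hT1).mul_left _
      · filter_upwards [eventually_gt_atTop (2 * g - 2).toNat, eventually_gt_atTop (g - 1).toNat]
          with n hn hn'
        rw [Real.norm_of_nonneg (mul_nonneg (hAnonneg _) (by positivity))]
        exact hbound n (by omega) (by omega)
    have hsum : Summable fun n : ℤ => A n * T ^ n := by
      refine (Function.Injective.summable_iff (Nat.cast_injective (R := ℤ)) ?_).mp ?_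
      · intro n hn
        rw [hAneg n, zero_mul]
        by_contra hcon
        exact hn ⟨n.toNat, by simp; omega⟩
      · simpa [Function.comp_def] using hsumN
    have hshift : ∀ m : ℤ, HasSum (fun n : ℤ => A (n - m) * T ^ n)
        (T ^ m * ∑' n : ℤ, A n * T ^ n) := by
      intro m
      have h1 := (hsum.hasSum.mul_left (T ^ m))
      rw [← (Equiv.subRight m).hasSum_iff] at h1
      refine h1.congr_fun fun n => ?_
      change A (n - m) * T ^ n = T ^ m * (A (n - m) * T ^ (n - m))
      rw [mul_left_comm, ← zpow_add₀ hTne, add_sub_cancel]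
    have hS : 1 ≤ ∑' n : ℤ, A n * T ^ n := by
      have := hsum.le_tsum 0 fun n _ => mul_nonneg (hAnonneg n) (by positivity)
      simpa [hA0] using this
    have hdsum : HasSum (fun n : ℤ => d n * T ^ n)
        ((1 - T ^ e) * (1 - (q * T) ^ e) * ∑' n : ℤ, A n * T ^ n) := by
      have h := ((hshift 0).sub ((hshift e).mul_left (1 + q ^ e))).add
        ((hshift (2 * e)).mul_left (q ^ e))
      convert! h using 1
      · funext n
        simp only [hd, eulerTwist, sub_zero]
        ring
      · rw [zpow_zero, zpow_natCast, show T ^ (2 * (e : ℤ)) = T ^ e * T ^ e by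
          rw [two_mul, zpow_add₀ hTne, zpow_natCast], mul_pow]
        ring
    have hfin : HasSum (fun n : ℤ => d n * T ^ n)
        (∑ n ∈ (Finset.range (M + 1)).map Nat.castEmbedding, d n * T ^ n) := by
      refine hasSum_sum_of_ne_finset_zero fun n hn => ?_
      by_cases h0 : n < 0
      · rw [hdneg n h0, zero_mul]
      · rw [hdlarge n, zero_mul]
        by_contra! hle
        refine hn (Finset.mem_map.mpr ⟨n.toNat, ?_, ?_⟩)
        · rw [Finset.mem_range]; omega
        · simp; omega
    have heq := hfin.unique hdsum
    have hval : L.eval (T : ℂ) =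
        (((1 - T ^ e) * (1 - (q * T) ^ e) * ∑' n : ℤ, A n * T ^ n : ℝ) : ℂ) := by
      rw [← heq, hLeval, Finset.sum_map]
      push_cast
      simp
    rw [hval, Complex.ofReal_ne_zero]
    have hT2 : T < 1 := by nlinarith
    have h1 : T ^ e < 1 := pow_lt_one₀ hT0.le hT2 he.ne'
    have h2 : (q * T) ^ e < 1 := pow_lt_one₀ (by positivity) hT1 he.ne'
    have : 0 < (1 - T ^ e) * (1 - (q * T) ^ e) := mul_pos (by linarith) (by linarith)
    positivity

end ZetaFunction

end GroupZeta

namespace GroupZeta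

/-! ### Analytic properties of the completed zeta function -/

section CompletedZeta

/-- Injectivity sends punctured neighbourhoods into punctured neighbourhoods. Identities known off a
discrete set can therefore be pulled back along affine maps. -/
lemma tendsto_affine_codiscrete {a : ℂ} (ha : a ≠ 0) (c : ℂ) :
    Tendsto (fun s : ℂ => a * s + c) (codiscrete ℂ) (codiscrete ℂ) := by
  intro S hS
  rw [mem_map, mem_codiscrete]
  rw [mem_codiscrete] at hS
  intro x
  have h := hS (a * x + c)
  rw [disjoint_principal_right, compl_compl] at h ⊢
  have ht : Tendsto (fun s : ℂ => a * s + c) (𝓝[≠] x) (𝓝[≠] (a * x + c)) := by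
    refine tendsto_nhdsWithin_of_tendsto_nhds_of_eventually_within _ ?_ ?_
    · exact (Continuous.tendsto (by fun_prop) x).mono_left nhdsWithin_le_nhds
    · filter_upwards [self_mem_nhdsWithin] with s hs
      simpa [ha] using hs
  exact ht h

/-- The inverse of a function with a simple zero has a simple pole. -/
lemma exists_simple_pole {f : ℂ → ℂ} {z₀ : ℂ} (hf : AnalyticAt ℂ f z₀) (h0 : f z₀ = 0)
    (h1 : deriv f z₀ ≠ 0) :
    ∃ u : ℂ → ℂ, AnalyticAt ℂ u z₀ ∧ u z₀ = (deriv f z₀)⁻¹ ∧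
      ∀ z, (z ≠ z₀ → (f z)⁻¹ = u z / (z - z₀)) := by
  obtain ⟨p, hp⟩ := hf
  have han : AnalyticAt ℂ (dslope f z₀) z₀ := ⟨_, hp.has_fpower_series_dslope_fslope⟩
  refine ⟨fun z => (dslope f z₀ z)⁻¹, han.inv (by rwa [dslope_same]),
    by simp only [dslope_same], ?_⟩
  intro z hz
  have : f z = (z - z₀) * dslope f z₀ z := by
    rw [dslope_of_ne _ hz, slope_def_field, h0, sub_zero, mul_div_cancel₀ _ (sub_ne_zero.mpr hz)]
  rw [this, mul_inv, div_eq_inv_mul]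

/-- The analytic properties of the completed zeta function of a curve: `Z` is analytic on the
codiscrete set `U`. -/
structure IsCompletedZeta (Z : ℂ → ℂ) (U : Set ℂ) : Prop where
  meromorphic : Meromorphic Z
  analyticAt : ∀ s ∈ U, AnalyticAt ℂ Z s
  apply_one_sub : ∀ s ∈ U, Z (1 - s) = Z s
  mem_codiscrete : {s | s ∈ U ∧ Z s ≠ 0} ∈ codiscrete ℂ
  mem_of_re : ∀ s : ℂ, s.re ≠ 0 → s.re ≠ 1 → s ∈ U
  ne_zero : ∀ h : ℤ, 2 ≤ h → Z h ≠ 0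
  simple_pole : ∃ u : ℂ → ℂ, AnalyticAt ℂ u 0 ∧ ∀ᶠ z in 𝓝[≠] (0 : ℂ), Z (1 + z) = u z / z

lemma cpow_natCast_pow_ne_one {q : ℕ} (hq : 1 < q) {e : ℕ} (he : 0 < e) {s : ℂ}
    (hs : s.re ≠ 0) : ((q : ℂ) ^ s) ^ e ≠ 1 := by
  intro h
  have h1 : ‖(q : ℂ) ^ s‖ = 1 := by
    have := congrArg norm h
    rw [norm_pow, norm_one] at this
    exact (pow_eq_one_iff_of_nonneg (norm_nonneg _) he.ne').mp this
  rw [Complex.norm_natCast_cpow_of_pos (by omega)] at h1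
  have hq' : (1 : ℝ) < q := by exact_mod_cast hq
  have h2 := congrArg Real.log h1
  rw [Real.log_rpow (by positivity), Real.log_one] at h2
  exact hs ((mul_eq_zero.mp h2).resolve_right (Real.log_pos hq').ne')

variable {k F : Type*} [Field k] [Field F] [Algebra k F]
variable [Finite k] (hF : IsCurveFunctionField k F)
include hF

/-- The analytic continuation and the functional equation of the completed zeta function. -/
theorem IsCurveFunctionField.isCompletedZeta :
    ∃ U, IsCompletedZeta (completedZeta k F) U := by
  obtain ⟨e, L, he, hser, hsymm, hne⟩ := hF.exists_numerator
  have hq : 1 < Nat.card k := Finite.one_lt_card (α := k)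
  set q : ℕ := Nat.card k with hqdef
  have hq0 : (q : ℂ) ≠ 0 := by
    have : q ≠ 0 := by omega
    exact_mod_cast this
  set g := genus k F with hg
  set T : ℂ → ℂ := fun s => (q : ℂ) ^ (-s) with hTdef
  have hT0 : ∀ s, T s ≠ 0 := fun s => by simp [hTdef, Complex.cpow_eq_zero_iff, hq0]
  have hTdiff : Differentiable ℂ T := by
    intro s
    exact (differentiableAt_id.neg).const_cpow (Or.inl hq0)
  have hqT : ∀ s, (q : ℂ) * T s = (q : ℂ) ^ (1 - s) := fun s => by
    rw [hTdef, sub_eq_add_neg, Complex.cpow_add _ _ hq0, Complex.cpow_one]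
  set D : ℂ → ℂ := fun s => (1 - T s ^ e) * (1 - (q * T s) ^ e) with hD
  have hDdiff : Differentiable ℂ D := by
    intro s
    have := hTdiff s
    simp only [hD]
    fun_prop
  have hLdiff : Differentiable ℂ fun s => L.eval (T s) := fun s =>
    (L.differentiable (T s)).comp s (hTdiff s)
  have hDre : ∀ s : ℂ, s.re ≠ 0 → s.re ≠ 1 → D s ≠ 0 := by
    intro s h0 h1
    refine mul_ne_zero (sub_ne_zero.mpr (Ne.symm ?_)) (sub_ne_zero.mpr (Ne.symm ?_))
    · exact cpow_natCast_pow_ne_one hq he (by simpa using h0)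
    · rw [hqT]
      exact cpow_natCast_pow_ne_one hq he (by simpa [sub_eq_zero] using h1.symm)
  have hformula : ∀ s, D s ≠ 0 →
      completedZeta k F s = (q : ℂ) ^ (((g : ℂ) - 1) * s) * (L.eval (T s) / D s) := by
    intro s hs
    have h1 := eval_zetaRatFunc (k := k) (F := F) (zetaDenom_ne_zero (q : ℂ) he) hser
      (T := T s) (by rw [eval_zetaDenom]; exact hs)
    rw [eval_zetaDenom] at h1
    rw [completedZeta, artinZeta]
    change _ * RatFunc.eval (RingHom.id ℂ) (T s) (zetaRatFunc k F) = _
    rw [h1]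
  have hpow : Differentiable ℂ fun s : ℂ => (q : ℂ) ^ (((g : ℂ) - 1) * s) := fun s =>
    ((differentiableAt_id.const_mul _)).const_cpow (Or.inl hq0)
  have hqpow : ∀ z : ℂ, (q : ℂ) ^ z ≠ 0 := fun z => by simp [Complex.cpow_eq_zero_iff, hq0]
  have hLint : ∀ h : ℤ, 2 ≤ h → L.eval (T h) ≠ 0 := by
    intro h hh
    have h1 : T h = (((q : ℝ) ^ (-h) : ℝ) : ℂ) := by
      simp only [hTdef]
      rw [← Int.cast_neg, Complex.cpow_intCast]
      push_cast
      rfl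
    have hqr : (1 : ℝ) < q := by exact_mod_cast hq
    rw [h1]
    refine hne _ (by positivity) ?_
    rw [← zpow_one_add₀ (by positivity)]
    exact zpow_lt_one_of_neg₀ hqr (by omega)
  -- U is the set where the chosen denominator does not vanish, so that `hformula` holds pointwise
  -- on it. Its complement lies on the lines Re s = 0 and Re s = 1.
  refine ⟨{s | D s ≠ 0}, ?_, ?_, ?_, ?_, hDre, ?_, ?_⟩
  · intro s
    have h1 : MeromorphicAt (fun s => (zetaRatFunc k F).num.eval (T s) /
        (zetaRatFunc k F).denom.eval (T s)) s := by
      refine MeromorphicAt.div ?_ ?_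
      · exact (Differentiable.analyticAt (fun s =>
          ((zetaRatFunc k F).num.differentiable (T s)).comp s (hTdiff s)) s).meromorphicAt
      · exact (Differentiable.analyticAt (fun s =>
          ((zetaRatFunc k F).denom.differentiable (T s)).comp s (hTdiff s)) s).meromorphicAt
    refine ((hpow.analyticAt s).meromorphicAt.mul h1).congr (Eventually.of_forall fun z => ?_)
    simp [completedZeta, artinZeta, RatFunc.eval, Polynomial.eval₂_id, hTdef, hg, hqdef]
  · intro s hs
    have h1 : AnalyticAt ℂ
        (fun s => (q : ℂ) ^ (((g : ℂ) - 1) * s) * (L.eval (T s) / D s)) s :=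
      (hpow.analyticAt s).mul ((hLdiff.analyticAt s).div (hDdiff.analyticAt s) hs)
    refine h1.congr ?_
    filter_upwards [hDdiff.continuous.continuousAt.eventually_ne hs] with z hz
    exact (hformula z hz).symm
  · intro s hs
    have h1 : T (1 - s) = (q * T s)⁻¹ := by
      rw [hqT, ← Complex.cpow_neg]
    have h2 : (q : ℂ) * T (1 - s) = (T s)⁻¹ := by
      rw [h1, mul_inv, mul_inv_cancel_left₀ hq0]
    have h3 : D s ≠ 0 := hs
    have hqTe : ((q : ℂ) * T s) ^ e ≠ 0 := pow_ne_zero _ (mul_ne_zero hq0 (hT0 s))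
    have hTe : T s ^ e ≠ 0 := pow_ne_zero _ (hT0 s)
    have h4 : D (1 - s) = D s / (((q : ℂ) * T s) ^ e * T s ^ e) := by
      simp only [hD]
      rw [h2, h1, inv_pow, inv_pow]
      field_simp
      ring
    have h5 : D (1 - s) ≠ 0 := by rw [h4]; exact div_ne_zero h3 (mul_ne_zero hqTe hTe)
    have hpw : ∀ z, (q : ℂ) ^ (((g : ℂ) - 1) * z) = T z ^ (1 - g) := by
      intro z
      simp only [hTdef]
      rw [← Complex.cpow_mul_int]
      congr 1
      push_cast
      ring
    rw [hformula _ h5, hformula _ h3, hpw, hpw, h4, h1, hsymm _ (hT0 s)]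
    have e1 : ((q : ℂ) * T s)⁻¹ ^ (1 - g) = (q : ℂ) ^ (g - 1) * T s ^ (g - 1) := by
      rw [inv_zpow, ← zpow_neg, neg_sub, mul_zpow]
    have e2 : (q : ℂ) ^ (1 - g - (e : ℤ)) = (q : ℂ) ^ (1 - g) * ((q : ℂ) ^ e)⁻¹ := by
      rw [zpow_sub₀ hq0, zpow_natCast, div_eq_mul_inv]
    have e3 : T s ^ (-(2 * g - 2 + 2 * (e : ℤ))) =
        T s ^ (1 - g) * T s ^ (1 - g) * ((T s ^ e)⁻¹ * (T s ^ e)⁻¹) := by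
      rw [← zpow_natCast, ← zpow_neg, ← zpow_add₀ (hT0 s), ← zpow_add₀ (hT0 s),
        ← zpow_add₀ (hT0 s)]
      congr 1
      ring
    have e4 : (q : ℂ) ^ (g - 1) * (q : ℂ) ^ (1 - g) = 1 := by
      rw [← zpow_add₀ hq0]; simp
    have e5 : T s ^ (g - 1) * T s ^ (1 - g) = 1 := by
      rw [← zpow_add₀ (hT0 s)]; simp
    have e6 : ((q : ℂ) ^ e)⁻¹ * (q : ℂ) ^ e = 1 := inv_mul_cancel₀ (pow_ne_zero _ hq0)
    have e7 : (T s ^ e)⁻¹ * T s ^ e = 1 := inv_mul_cancel₀ hTe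
    rw [e1, e2, e3, mul_pow]
    rw [div_div_eq_mul_div]
    rw [← mul_div_assoc, ← mul_div_assoc]
    congr 1
    calc _ = ((q : ℂ) ^ (g - 1) * (q : ℂ) ^ (1 - g)) * (T s ^ (g - 1) * T s ^ (1 - g)) *
          (((q : ℂ) ^ e)⁻¹ * (q : ℂ) ^ e) * ((T s ^ e)⁻¹ * T s ^ e) * ((T s ^ e)⁻¹ * T s ^ e) *
          (T s ^ (1 - g) * L.eval (T s)) := by ring
      _ = _ := by rw [e4, e5, e6, e7]; ring
  · have h1 : (fun s => D s * L.eval (T s)) ⁻¹' {0}ᶜ ∈ codiscrete ℂ := by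
      refine AnalyticOnNhd.preimage_zero_mem_codiscrete (x := 2) ?_ ?_
      · exact fun s _ => (hDdiff.mul hLdiff).analyticAt s
      · refine mul_ne_zero (hDre 2 (by norm_num) (by norm_num)) ?_
        have := hLint 2 le_rfl
        simpa using this
    filter_upwards [h1] with s hs
    have hs' : D s * L.eval (T s) ≠ 0 := hs
    rw [mul_ne_zero_iff] at hs'
    refine ⟨hs'.1, ?_⟩
    rw [hformula s hs'.1]
    exact mul_ne_zero (hqpow _) (div_ne_zero hs'.2 hs'.1)
  · intro h hh
    have hDh : D h ≠ 0 := hDre _ (by simp; omega) (by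
      have : h ≠ 1 := by omega
      simpa using this)
    rw [hformula _ hDh]
    exact mul_ne_zero (hqpow _) (div_ne_zero (hLint h hh) hDh)
  -- Near s = 1 only the factor 1 - (qT)^e = 1 - q^{-ez} vanishes, to first order, with derivative e
  -- log q.
  · set f : ℂ → ℂ := fun z => 1 - (q * T (1 + z)) ^ e with hf
    have hfeq : f = fun z => 1 - (q : ℂ) ^ (-((e : ℂ) * z)) := by
      funext z
      simp only [hf]
      rw [hqT, ← Complex.cpow_nat_mul]
      congr 2
      ring
    have hlog : Complex.log (q : ℂ) ≠ 0 := by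
      rw [← Complex.natCast_log]
      have : 0 < Real.log q := Real.log_pos (by exact_mod_cast hq)
      exact_mod_cast this.ne'
    have hderiv : HasDerivAt f (e * Complex.log q) 0 := by
      rw [hfeq]
      have h1 : HasDerivAt (fun z : ℂ => -(e * z)) (-(e * 1)) 0 :=
        ((hasDerivAt_id (0 : ℂ)).const_mul (e : ℂ)).neg
      have h2 := (h1.const_cpow (c := (q : ℂ)) (Or.inl hq0)).const_sub 1
      convert! h2 using 1
      simp
      ring
    have hfan : AnalyticAt ℂ f 0 := by
      refine Differentiable.analyticAt (fun z => ?_) 0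
      rw [hfeq]
      exact (((differentiableAt_id.const_mul (e : ℂ)).neg).const_cpow (Or.inl hq0)).const_sub 1
    obtain ⟨u, hu, -, hueq⟩ := exists_simple_pole hfan (by simp [hfeq])
      (by rw [hderiv.deriv]; exact mul_ne_zero (by exact_mod_cast he.ne') hlog)
    have hD1 : (fun z => 1 - T (1 + z) ^ e) 0 ≠ 0 := by
      simp only [add_zero]
      exact sub_ne_zero.mpr (cpow_natCast_pow_ne_one hq he (by simp)).symm
    have hshift : ∀ {φ : ℂ → ℂ}, Differentiable ℂ φ → AnalyticAt ℂ (fun z => φ (1 + z)) 0 :=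
      fun hφ => (hφ.comp (differentiable_id.const_add 1)).analyticAt 0
    refine ⟨fun z => (q : ℂ) ^ (((g : ℂ) - 1) * (1 + z)) * (L.eval (T (1 + z)) /
      (1 - T (1 + z) ^ e)) * u z, ?_, ?_⟩
    · have hT1 : Differentiable ℂ fun s => 1 - T s ^ e := by
        intro s
        have := hTdiff s
        fun_prop
      exact ((hshift hpow).mul ((hshift hLdiff).div (hshift hT1) hD1)).mul hu
    · have hc : ∀ᶠ z in 𝓝[≠] (0 : ℂ), 1 - T (1 + z) ^ e ≠ 0 := by
        have : ContinuousAt (fun z => 1 - T (1 + z) ^ e) 0 := by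
          have := hTdiff.continuous
          fun_prop
        exact (this.eventually_ne hD1).filter_mono nhdsWithin_le_nhds
      have hfne : ∀ᶠ z in 𝓝[≠] (0 : ℂ), f z ≠ 0 := by
        have := hderiv.eventually_ne (c := 0)
          (mul_ne_zero (by exact_mod_cast he.ne') hlog)
        exact this
      filter_upwards [hc, hfne, self_mem_nhdsWithin] with z h1 h2 h3
      have hz : z ≠ 0 := h3
      have h4 := hueq z hz
      rw [sub_zero] at h4
      rw [hformula (1 + z) (mul_ne_zero h1 h2), mul_div_assoc, ← h4]
      change _ * (_ / (_ * f z)) = _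
      rw [← div_div, div_eq_mul_inv _ (f z), mul_assoc]

end CompletedZeta

end GroupZeta

namespace GroupZeta

/-! ### Iterated residues at simple poles -/

section Residues

/-- By Cauchy's formula the circle integrals are constant for small radii. The value g 0 may vanish,
so removable singularities are covered as well. -/
lemma residue_eq_of_simple_pole {f g : ℂ → ℂ} {ε : ℝ} (hε : 0 < ε)
    (hg : DifferentiableOn ℂ g (Metric.ball 0 ε))
    (hfg : ∀ z ∈ Metric.ball (0 : ℂ) ε, z ≠ 0 → f z = g z / z) : residue f 0 = g 0 := by
  refine Tendsto.limUnder_eq ?_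
  refine tendsto_const_nhds.congr' ?_
  filter_upwards [Ioo_mem_nhdsGT hε] with r hr
  have h1 : ∮ z in C((0 : ℂ), r), f z = ∮ z in C((0 : ℂ), r), (z - 0)⁻¹ • g z := by
    refine circleIntegral.integral_congr hr.1.le fun z hz => ?_
    have hz' : ‖z‖ = r := by simpa using hz
    have hz0 : z ≠ 0 := by
      rintro rfl
      rw [norm_zero] at hz'
      exact hr.1.ne hz'
    change f z = (z - 0)⁻¹ • g z
    rw [hfg z (by simpa [hz'] using hr.2) hz0, sub_zero, smul_eq_mul, div_eq_inv_mul]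
  have h2 : DiffContOnCl ℂ g (Metric.ball 0 r) := by
    refine DifferentiableOn.diffContOnCl ?_
    rw [closure_ball _ hr.1.ne']
    exact hg.mono (Metric.closedBall_subset_ball hr.2)
  rw [h1, h2.circleIntegral_sub_inv_smul (Metric.mem_ball_self hr.1), smul_eq_mul,
    inv_mul_cancel_left₀ Complex.two_pi_I_ne_zero]

lemma update_mem_ball {J : Type*} [Fintype J] [DecidableEq J] {s s₀ : J → ℂ} {ε : ℝ} {j : J}
    {z : ℂ} (hs : s ∈ Metric.ball s₀ ε) (h0 : s₀ j = 0) (hz : z ∈ Metric.ball (0 : ℂ) ε) :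
    Function.update s j z ∈ Metric.ball s₀ ε := by
  have hε : 0 < ε := Metric.pos_of_mem_ball hs
  rw [Metric.mem_ball, dist_pi_lt_iff hε] at hs ⊢
  intro i
  by_cases h : i = j
  · subst h
    rw [Function.update_self, h0]
    exact hz
  · rw [Function.update_of_ne h]
    exact hs i

/-- The iterated residue of a sum of products with at most simple poles along the coordinate
hyperplanes. -/
lemma iteratedResidue_sum_of_simple_poles {J W : Type*} [Fintype J] [Fintype W] (l : List J)
    (hl : l.Nodup) {s₀ : J → ℂ} (h0 : ∀ j ∈ l, s₀ j = 0) {ε : ℝ} (hε : 0 < ε)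
    {u : W → J → ℂ → ℂ} (hu : ∀ w j, DifferentiableOn ℂ (u w j) (Metric.ball 0 ε))
    {H : W → (J → ℂ) → ℂ} (hH : ∀ w, DifferentiableOn ℂ (H w) (Metric.ball s₀ ε))
    {Ψ : (J → ℂ) → ℂ}
    (hΨ : ∀ s ∈ Metric.ball s₀ ε, (∀ j ∈ l, s j ≠ 0) →
      Ψ s = ∑ w, H w s * (l.map fun j => u w j (s j) / s j).prod) :
    iteratedResidue l Ψ s₀ = ∑ w, H w s₀ * (l.map fun j => u w j 0).prod := by
  classical
  induction l generalizing Ψ H with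
  | nil => exact hΨ s₀ (Metric.mem_ball_self hε) (by simp)
  | cons j l ih =>
    rw [List.nodup_cons] at hl
    have hj0 : s₀ j = 0 := h0 j (by simp)
    have hball0 : (0 : ℂ) ∈ Metric.ball (0 : ℂ) ε := Metric.mem_ball_self hε
    have hdiffz : ∀ s ∈ Metric.ball s₀ ε, ∀ w,
        DifferentiableOn ℂ (fun z => H w (Function.update s j z)) (Metric.ball 0 ε) := by
      intro s hs w
      refine (hH w).comp (fun z _ => ?_) (fun z hz => update_mem_ball hs hj0 hz)
      exact (hasFDerivAt_update s z).differentiableAt.differentiableWithinAt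
    have hdiffs : ∀ w, DifferentiableOn ℂ (fun s => H w (Function.update s j 0) * u w j 0)
        (Metric.ball s₀ ε) := by
      intro w
      refine DifferentiableOn.mul_const ((hH w).comp (fun s _ => ?_)
        (fun s hs => update_mem_ball hs hj0 hball0)) _
      refine DifferentiableAt.differentiableWithinAt ?_
      rw [differentiableAt_pi]
      intro i
      by_cases h : i = j
      · subst h
        simp
      · simp only [Function.update_of_ne h]
        fun_prop
    -- A residue in the variable j replaces u_j(z)/z by u_j(0) and sets s_j = 0 in H. The result has
    -- the same shape in the remaining variables, so the induction closes.
    have hkey := ih hl.2 (fun i hi => h0 i (by simp [hi])) hdiffs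
      (Ψ := fun s => residue (fun z => Ψ (Function.update s j z)) 0) ?_
    · change iteratedResidue l (fun s => residue (fun z => Ψ (Function.update s j z)) 0) s₀ = _
      rw [hkey]
      refine Finset.sum_congr rfl fun w _ => ?_
      rw [← hj0, Function.update_eq_self, List.map_cons, List.prod_cons, hj0, mul_assoc]
    · intro s hs hne
      rw [residue_eq_of_simple_pole (g := fun z => ∑ w, H w (Function.update s j z) * u w j z *
        (l.map fun i => u w i (s i) / s i).prod) hε]
      · refine DifferentiableOn.fun_sum fun w _ => ?_
        exact ((hdiffz s hs w).mul (hu w j)).mul_const _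
      · intro z hz hz0
        have hupd : ∀ i ∈ l, Function.update s j z i = s i := fun i hi =>
          Function.update_of_ne (fun h : i = j => hl.1 (h ▸ hi)) _ _
        rw [hΨ _ (update_mem_ball hs hj0 hz) ?_, Finset.sum_div]
        · refine Finset.sum_congr rfl fun w _ => ?_
          rw [List.map_cons, List.prod_cons, Function.update_self,
            List.map_congr_left (g := fun i => u w i (s i) / s i) fun i hi => by rw [hupd i hi]]
          ring
        · intro i hi
          rcases List.mem_cons.mp hi with rfl | hi
          · rwa [Function.update_self]
          · rw [hupd i hi]
            exact hne i hi

end Residues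

end GroupZeta

namespace GroupZeta

/-! ### The Weyl group acting on roots and weights -/

section WeylGroupAction

variable {ι V V' : Type*} [AddCommGroup V] [Module ℂ V] [AddCommGroup V'] [Module ℂ V']
  {P : RootPairing ι ℂ V V'}

lemma root_smul (w : P.weylGroup) (i : ι) : P.root (w • i) = w • P.root i :=
  RootPairing.Equiv.root_indexEquiv_eq_smul P i w.1

lemma coroot'_smul_smul (w : P.weylGroup) (i : ι) (x : V) :
    P.coroot' (w • i) (w • x) = P.coroot' i x := by
  obtain ⟨w, hw⟩ := w
  induction hw using RootPairing.weylGroup.induction generalizing i x with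
  | mem r =>
    change P.coroot' (P.reflectionPerm r i) (P.reflection r x) = _
    rw [P.coroot'_reflection, P.reflectionPerm_self]
  | one => rfl
  | mul w₁ w₂ hw₁ hw₂ h₁ h₂ => exact (h₁ _ _).trans (h₂ _ _)

lemma coroot'_smul (w : P.weylGroup) (i : ι) (x : V) :
    P.coroot' i (w • x) = P.coroot' (w⁻¹ • i) x := by
  rw [← coroot'_smul_smul w (w⁻¹ • i) x, smul_inv_smul]

lemma smul_reflectionPerm_self (w : P.weylGroup) (i : ι) :
    w • P.reflectionPerm i i = P.reflectionPerm (w • i) (w • i) := by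
  apply P.root.injective
  rw [root_smul, P.root_reflectionPerm, P.root_reflectionPerm, P.reflection_apply_self,
    P.reflection_apply_self, root_smul, smul_neg]

lemma coroot'_reflectionPerm_self (i : ι) (x : V) :
    P.coroot' (P.reflectionPerm i i) x = -P.coroot' i x := by
  rw [P.coroot'_reflectionPerm]
  simp [RootPairing.reflection_apply]
  ring

lemma reflectionPerm_self_reflectionPerm_self (i : ι) :
    P.reflectionPerm (P.reflectionPerm i i) (P.reflectionPerm i i) = i := by
  apply P.root.injective
  rw [P.root_reflectionPerm, P.reflection_apply_self, P.root_reflectionPerm,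
    P.reflection_apply_self, neg_neg]

lemma ofIdx_smul_index (j i : ι) :
    RootPairing.weylGroup.ofIdx P j • i = P.reflectionPerm j i := rfl

instance [Finite ι] [P.IsRootSystem] : Finite P.weylGroup := by
  refine Finite.of_injective (fun (w : P.weylGroup) (i : ι) => w • i) fun w w' h => ?_
  have hroot : ∀ i, w • P.root i = w' • P.root i := fun i => by
    rw [← root_smul, ← root_smul]
    exact congrArg P.root (congrFun h i)
  apply Subtype.ext
  apply RootPairing.Equiv.weightHom_injective P
  apply LinearEquiv.toLinearMap_injective
  refine LinearMap.ext_on_range (v := P.root) ?_ hroot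
  exact RootPairing.IsRootSystem.span_root_eq_top

end WeylGroupAction

/-! ### Positivity and heights of coroots -/

section Heights

variable {ι V V' : Type*} [AddCommGroup V] [Module ℂ V] [AddCommGroup V'] [Module ℂ V']
  {P : RootPairing ι ℂ V V'} (b : P.Base)

lemma isPos_neg_iff (i : ι) : b.IsPos (P.reflectionPerm i i) ↔ ¬ b.IsPos i :=
  RootPairing.Base.IsPos.neg_iff_not b i

lemma exists_coroot_eq_sum (i : ι) :
    ∃ f : ι → ℤ, P.coroot i = ∑ j ∈ b.support, f j • P.coroot j ∧ (0 < f ∨ f < 0) ∧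
      f.support ⊆ b.support := by
  obtain ⟨f, h1, h2, h3⟩ := b.flip.exists_root_eq_sum_int i
  exact ⟨f, h3, h2, h1⟩

variable {b} in
lemma coroot'_eq_sum {i : ι} {f : ι → ℤ}
    (h : P.coroot i = ∑ j ∈ b.support, f j • P.coroot j) (x : V) :
    P.coroot' i x = ∑ j ∈ b.support, f j * P.coroot' j x := by
  change P.toLinearMap x (P.coroot i) = ∑ j ∈ b.support, f j * P.toLinearMap x (P.coroot j)
  rw [h, map_sum]
  refine Finset.sum_congr rfl fun j _ => ?_
  rw [map_zsmul, zsmul_eq_mul]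

variable [Finite ι] [P.IsCrystallographic] [P.IsReduced]

variable {b} in
lemma isPos_reflectionPerm_iff {i j : ι} (hj : j ∈ b.support) (hij : i ≠ j)
    (hij' : i ≠ P.reflectionPerm j j) : b.IsPos (P.reflectionPerm j i) ↔ b.IsPos i := by
  refine ⟨fun h => ?_, fun h => h.reflectionPerm hj hij⟩
  have := h.reflectionPerm hj (fun h' => hij' ?_)
  · rwa [P.reflectionPerm_self] at this
  · have := congrArg (P.reflectionPerm j) h'
    rwa [P.reflectionPerm_self] at this

/-- A root is positive if and only if its coroot is. -/
lemma isPos_iff_flip_isPos (i : ι) : b.IsPos i ↔ b.flip.IsPos i := by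
  -- Both notions of positivity hold for simple roots, flip under negation, and are preserved by a
  -- simple reflection away from ± its own root; every root is reached by these operations.
  refine RootPairing.Base.induction_reflect (b := b) i
    (p := fun i => b.IsPos i ↔ b.flip.IsPos i) ?_ ?_ ?_
  · intro i hi
    rw [isPos_neg_iff, hi, ← isPos_neg_iff b.flip i]
    rfl
  · intro i hi
    exact iff_of_true (RootPairing.Base.isPos_of_mem_support hi)
      (RootPairing.Base.isPos_of_mem_support (b := b.flip) hi)
  · intro i j hi hj
    by_cases h1 : i = j
    · subst h1
      rw [isPos_neg_iff, hi, ← isPos_neg_iff b.flip i]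
      rfl
    by_cases h2 : i = P.reflectionPerm j j
    · rw [h2, P.reflectionPerm_self]
      exact iff_of_true (RootPairing.Base.isPos_of_mem_support hj)
        (RootPairing.Base.isPos_of_mem_support (b := b.flip) hj)
    · rw [isPos_reflectionPerm_iff hj h1 h2, hi]
      exact (isPos_reflectionPerm_iff (b := b.flip) hj h1 h2).symm

lemma exists_coroot_eq_sum_nonneg {i : ι} (hi : b.IsPos i) :
    ∃ f : ι → ℤ, P.coroot i = ∑ j ∈ b.support, f j • P.coroot j ∧ 0 ≤ f := by
  obtain ⟨f, h1, h2 | h2, h3⟩ := exists_coroot_eq_sum b i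
  · exact ⟨f, h1, h2.le⟩
  · exfalso
    rw [isPos_iff_flip_isPos, RootPairing.Base.isPos_iff,
      RootPairing.Base.height_eq_sum (b := b.flip) h1] at hi
    exact hi.not_ge (Finset.sum_nonpos fun j _ => h2.le j)

/-- A positive coroot has nonnegative integer coordinates; if they sum to 1, exactly one of them is
1. -/
lemma flip_height_eq_one_iff (i : ι) : b.flip.height i = 1 ↔ i ∈ b.support := by
  refine ⟨fun h => ?_, fun h => RootPairing.Base.height_one_of_mem_support (b := b.flip) h⟩
  have hi : b.IsPos i := by
    rw [isPos_iff_flip_isPos, RootPairing.Base.isPos_iff, h]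
    exact one_pos
  obtain ⟨f, h1, h2⟩ := exists_coroot_eq_sum_nonneg b hi
  have h3 : ∑ j ∈ b.support, f j = 1 := by
    rw [← h]
    exact (RootPairing.Base.height_eq_sum (b := b.flip) h1).symm
  obtain ⟨j, hj, hj0⟩ : ∃ j ∈ b.support, f j ≠ 0 := by
    by_contra! hcon
    rw [Finset.sum_eq_zero hcon] at h3
    exact zero_ne_one h3
  have hj1 : 1 ≤ f j := by
    have : 0 ≤ f j := h2 j
    omega
  classical
  have h4 : f j + ∑ m ∈ b.support.erase j, f m = 1 := by
    rw [Finset.add_sum_erase _ _ hj, h3]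
  have h5 : 0 ≤ ∑ m ∈ b.support.erase j, f m := Finset.sum_nonneg fun m _ => h2 m
  have h6 : ∀ m ∈ b.support.erase j, f m = 0 :=
    (Finset.sum_eq_zero_iff_of_nonneg fun m _ => h2 m).mp (by omega)
  have h7 : P.coroot i = P.coroot j := by
    rw [h1, ← Finset.add_sum_erase _ _ hj, Finset.sum_eq_zero fun m hm => by rw [h6 m hm, zero_smul],
      add_zero, show f j = 1 by omega, one_smul]
  rw [P.coroot.injective h7]
  exact hj

end Heights

end GroupZeta

namespace GroupZeta

/-! ### Longest elements of standard parabolic subgroups -/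

section LongestElements

variable {ι V V' : Type*} [AddCommGroup V] [Module ℂ V] [AddCommGroup V'] [Module ℂ V']
  {P : RootPairing ι ℂ V V'} (b : P.Base)

/-- The roots in the span of a set `J` of roots. -/
def IsSpannedBy (J : Set ι) (i : ι) : Prop := P.root i ∈ Submodule.span ℂ (P.root '' J)

lemma isSpannedBy_reflectionPerm {J : Set ι} {j : ι} (hj : j ∈ J) (i : ι) :
    IsSpannedBy (P := P) J (P.reflectionPerm j i) ↔ IsSpannedBy (P := P) J i := by
  rw [IsSpannedBy, P.root_reflectionPerm, P.reflection_apply_root]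
  exact Submodule.sub_mem_iff_left _
    (Submodule.smul_mem _ _ (Submodule.subset_span ⟨j, hj, rfl⟩))

lemma isSpannedBy_neg_iff {J : Set ι} (i : ι) :
    IsSpannedBy (P := P) J (P.reflectionPerm i i) ↔ IsSpannedBy (P := P) J i := by
  rw [IsSpannedBy, P.root_reflectionPerm, P.reflection_apply_self, Submodule.neg_mem_iff]
  rfl

/-- The height of a root is linear in the root. -/
lemma exists_height_functional [P.IsRootSystem] :
    ∃ η : V →ₗ[ℂ] ℂ, ∀ i, η (P.root i) = b.height i := by
  refine ⟨b.toWeightBasis.constr ℂ fun _ => (1 : ℂ), fun i => ?_⟩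
  have hsimple : ∀ j ∈ b.support, b.toWeightBasis.constr ℂ (fun _ => (1 : ℂ)) (P.root j) = 1 := by
    intro j hj
    have := b.toWeightBasis.constr_basis ℂ (fun _ => (1 : ℂ)) ⟨j, hj⟩
    rwa [RootPairing.Base.toWeightBasis_apply] at this
  obtain ⟨f, -, -, hf⟩ := b.exists_root_eq_sum_int i
  rw [RootPairing.Base.height_eq_sum hf, hf, map_sum, Int.cast_sum]
  refine Finset.sum_congr rfl fun j hj => ?_
  rw [map_zsmul, hsimple j hj, zsmul_eq_mul, mul_one]

lemma eq_zero_of_isSpannedBy [P.IsRootSystem] {J : Set ι} (hJ : J ⊆ b.support) {i : ι}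
    (hi : IsSpannedBy (P := P) J i) {f : ι → ℤ} (hf : P.root i = ∑ j ∈ b.support, f j • P.root j)
    {l : ι} (hl : l ∈ b.support) (hlJ : l ∉ J) : f l = 0 := by
  set φ := b.toWeightBasis.coord ⟨l, hl⟩ with hφ
  have hsimple : ∀ j ∈ b.support, j ≠ l → φ (P.root j) = 0 := by
    intro j hj hjl
    have := b.toWeightBasis_repr_root ⟨j, hj⟩
    simp only at this
    rw [hφ, Module.Basis.coord_apply, this, Finsupp.single_eq_of_ne]
    exact fun h => hjl (congrArg Subtype.val h).symm
  have hself : φ (P.root l) = 1 := by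
    have := b.toWeightBasis_repr_root ⟨l, hl⟩
    simp only at this
    rw [hφ, Module.Basis.coord_apply, this, Finsupp.single_eq_same]
  have h1 : φ (P.root i) = 0 := by
    have hle : Submodule.span ℂ (P.root '' J) ≤ LinearMap.ker φ := by
      rw [Submodule.span_le]
      rintro _ ⟨j, hj, rfl⟩
      exact hsimple j (hJ hj) fun h => hlJ (h ▸ hj)
    exact hle hi
  rw [hf, map_sum, Finset.sum_eq_single_of_mem l hl fun j hj hjl => by
    rw [map_zsmul, hsimple j hj hjl, smul_zero], map_zsmul, hself, zsmul_eq_mul, mul_one] at h1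
  exact_mod_cast h1

variable [Fintype ι]

open Classical in
/-- The longest element of a standard parabolic subgroup sends `ρ` to `ρ - 2 ρ_J`. -/
lemma inv_smul_rho {J : Set ι} {w : P.weylGroup}
    (h1 : ∀ i, IsSpannedBy (P := P) J i → (b.IsPos (w • i) ↔ ¬ b.IsPos i))
    (h2 : ∀ i, ¬ IsSpannedBy (P := P) J i → (b.IsPos (w • i) ↔ b.IsPos i)) :
    w⁻¹ • rho b = rho b - ∑ i with b.IsPos i ∧ IsSpannedBy (P := P) J i, P.root i := by
  have hreindex : w⁻¹ • ∑ i with b.IsPos i, P.root i = ∑ i with b.IsPos (w • i), P.root i := by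
    rw [Finset.smul_sum]
    refine Finset.sum_nbij' (fun i => w⁻¹ • i) (fun i => w • i) ?_ ?_ ?_ ?_ ?_
    · simp
    · simp
    · simp
    · simp
    · intro i _
      rw [root_smul]
  have hneg : ∑ i with ¬ b.IsPos i ∧ IsSpannedBy (P := P) J i, P.root i =
      -∑ i with b.IsPos i ∧ IsSpannedBy (P := P) J i, P.root i := by
    rw [← Finset.sum_neg_distrib]
    refine Finset.sum_nbij' (fun i => P.reflectionPerm i i) (fun i => P.reflectionPerm i i)
      ?_ ?_ ?_ ?_ ?_
    · intro i hi
      simpa [isPos_neg_iff, isSpannedBy_neg_iff] using hi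
    · intro i hi
      simpa [isPos_neg_iff, isSpannedBy_neg_iff] using hi
    · exact fun i _ => reflectionPerm_self_reflectionPerm_self i
    · exact fun i _ => reflectionPerm_self_reflectionPerm_self i
    · intro i _
      simp
  have hsplit : ∀ Q : ι → Prop, ∑ i with Q i, P.root i =
      ∑ i with Q i ∧ IsSpannedBy (P := P) J i, P.root i +
        ∑ i with Q i ∧ ¬ IsSpannedBy (P := P) J i, P.root i := by
    intro Q
    rw [← Finset.filter_filter, ← Finset.filter_filter, Finset.sum_filter_add_sum_filter_not]
  have hA : ∑ i with b.IsPos (w • i) ∧ IsSpannedBy (P := P) J i, P.root i =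
      ∑ i with ¬ b.IsPos i ∧ IsSpannedBy (P := P) J i, P.root i := by
    refine Finset.sum_congr (Finset.filter_congr fun i _ => ?_) fun _ _ => rfl
    exact and_congr_left fun h => h1 i h
  have hB : ∑ i with b.IsPos (w • i) ∧ ¬ IsSpannedBy (P := P) J i, P.root i =
      ∑ i with b.IsPos i ∧ ¬ IsSpannedBy (P := P) J i, P.root i := by
    refine Finset.sum_congr (Finset.filter_congr fun i _ => ?_) fun _ _ => rfl
    exact and_congr_left fun h => h2 i h
  rw [rho, smul_comm, hreindex, hsplit, hA, hB, hneg, hsplit b.IsPos]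
  module

variable [P.IsCrystallographic] [P.IsReduced]

open Classical in
/-- The pairing of half the sum of the positive roots with a simple coroot. -/
lemma sum_coroot'_root_of_mem {J : Set ι} (hJ : J ⊆ b.support) {j : ι} (hj : j ∈ J) :
    ∑ i with b.IsPos i ∧ IsSpannedBy (P := P) J i, P.coroot' j (P.root i) = 2 := by
  have hjb : j ∈ b.support := hJ hj
  have hpos : b.IsPos j := RootPairing.Base.isPos_of_mem_support hjb
  set S : Finset ι := {i | b.IsPos i ∧ IsSpannedBy (P := P) J i} with hS
  have hjS : j ∈ S := by
    rw [hS, Finset.mem_filter]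
    exact ⟨Finset.mem_univ _, hpos, Submodule.subset_span ⟨j, hj, rfl⟩⟩
  have hmap : ∀ i ∈ S.erase j, P.reflectionPerm j i ∈ S.erase j := by
    intro i hi
    rw [Finset.mem_erase, hS, Finset.mem_filter] at hi ⊢
    refine ⟨fun h => ?_, Finset.mem_univ _, hi.2.2.1.reflectionPerm hjb hi.1,
      (isSpannedBy_reflectionPerm hj i).mpr hi.2.2.2⟩
    have h1 := congrArg (P.reflectionPerm j) h
    rw [P.reflectionPerm_self] at h1
    have h2 := hi.2.2.1
    rw [h1, isPos_neg_iff] at h2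
    exact h2 hpos
  -- The reflection in α_j permutes the other positive roots of the subsystem and negates the
  -- pairing with α_j^∨, so the sum equals its own negative.
  have hzero : ∑ i ∈ S.erase j, P.coroot' j (P.root i) = 0 := by
    have h : ∑ i ∈ S.erase j, P.coroot' j (P.root i) =
        ∑ i ∈ S.erase j, -P.coroot' j (P.root i) := by
      refine Finset.sum_nbij' (P.reflectionPerm j) (P.reflectionPerm j) hmap hmap
        (fun i _ => P.reflectionPerm_self j i) (fun i _ => P.reflectionPerm_self j i) ?_
      intro i _
      rw [P.root_reflectionPerm, P.coroot'_reflection, coroot'_reflectionPerm_self, neg_neg]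
    rw [Finset.sum_neg_distrib] at h
    linear_combination h / 2
  rw [← Finset.add_sum_erase _ _ hjS, hzero, add_zero, P.root_coroot'_eq_pairing, P.pairing_same]

/-- The longest element of a standard parabolic subgroup of the Weyl group. -/
lemma exists_longest [P.IsRootSystem] {J : Set ι} (hJ : J ⊆ b.support) :
    ∃ w : P.weylGroup,
      (∀ i, IsSpannedBy (P := P) J i → (b.IsPos (w • i) ↔ ¬ b.IsPos i)) ∧
      (∀ i, ¬ IsSpannedBy (P := P) J i → (b.IsPos (w • i) ↔ b.IsPos i)) ∧
      (∀ x, (∀ j ∈ J, P.coroot' j x = 0) → w • x = x) := by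
  classical
  -- S stands in for the parabolic subgroup: it contains 1 and is stable under right multiplication
  -- by the reflections in J. The longest element is found by minimizing the number of positive
  -- roots that stay positive.
  set S : Set P.weylGroup := {w |
    (∀ i, IsSpannedBy (P := P) J (w • i) ↔ IsSpannedBy (P := P) J i) ∧
    (∀ i, ¬ IsSpannedBy (P := P) J i → (b.IsPos (w • i) ↔ b.IsPos i)) ∧
    (∀ x, (∀ j ∈ J, P.coroot' j x = 0) → w • x = x)} with hS
  have hone : (1 : P.weylGroup) ∈ S := by simp [hS]
  set m : P.weylGroup → ℕ := fun w => Finset.card {i : ι | b.IsPos i ∧ b.IsPos (w • i)} with hm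
  obtain ⟨w, hw, hmin⟩ := Set.exists_min_image S m (Set.toFinite S) ⟨1, hone⟩
  have hself : ∀ j ∈ J, IsSpannedBy (P := P) J j := fun j hj =>
    Submodule.subset_span ⟨j, hj, rfl⟩
  -- If w α_j were positive, composing w with the reflection in α_j would drop α_j from the set
  -- counted by m and permute the rest, contradicting minimality.
  have hsimple : ∀ j ∈ J, ¬ b.IsPos (w • j) := by
    intro j hj hpos
    have hjb : j ∈ b.support := hJ hj
    have hjpos : b.IsPos j := RootPairing.Base.isPos_of_mem_support hjb
    set r := RootPairing.weylGroup.ofIdx P j with hr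
    have hri : ∀ i : ι, (w * r) • i = w • P.reflectionPerm j i := fun i => by
      rw [mul_smul, hr, ofIdx_smul_index]
    have hmem : w * r ∈ S := by
      refine ⟨fun i => ?_, fun i hi => ?_, fun x hx => ?_⟩
      · rw [hri, hw.1, isSpannedBy_reflectionPerm hj]
      · rw [hri, hw.2.1 _ (by rwa [isSpannedBy_reflectionPerm hj])]
        refine isPos_reflectionPerm_iff hjb ?_ ?_
        · rintro rfl
          exact hi (hself _ hj)
        · rintro rfl
          exact hi ((isSpannedBy_neg_iff _).mpr (hself _ hj))
      · rw [mul_smul]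
        have : r • x = x := by
          change P.reflection j x = x
          rw [P.reflection_apply]
          have h0 := hx j hj
          change P.toLinearMap x (P.coroot j) = 0 at h0
          simp [h0]
        rw [this, hw.2.2 x hx]
    refine (hmin _ hmem).not_gt ?_
    simp only [hm]
    have hjm : j ∈ ({i : ι | b.IsPos i ∧ b.IsPos (w • i)} : Finset ι) := by simp [hjpos, hpos]
    refine lt_of_le_of_lt (Finset.card_le_card_of_injOn (P.reflectionPerm j) ?_
      (P.reflectionPerm j).injective.injOn) (Finset.card_erase_lt_of_mem hjm)
    intro i hi
    simp only [Finset.coe_filter, Finset.mem_univ, true_and, Set.mem_ofPred_eq, hri] at hi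
    have hij : i ≠ j := by
      rintro rfl
      rw [smul_reflectionPerm_self, isPos_neg_iff] at hi
      exact hi.2 hpos
    simp only [Finset.coe_erase, Finset.coe_filter, Finset.mem_univ, true_and, Set.mem_sdiff,
      Set.mem_ofPred_eq, Set.mem_singleton_iff]
    refine ⟨⟨hi.1.reflectionPerm hjb hij, hi.2⟩, fun h => ?_⟩
    have h1 := congrArg (P.reflectionPerm j) h
    rw [P.reflectionPerm_self] at h1
    rw [h1, isPos_neg_iff] at hi
    exact hi.1 hjpos
  obtain ⟨η, hη⟩ := exists_height_functional b
  -- A positive root in the span is a nonnegative combination of J, and height is linear, so the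
  -- case of simple roots suffices.
  have hpos : ∀ i, IsSpannedBy (P := P) J i → b.IsPos i → ¬ b.IsPos (w • i) := by
    intro i hi hipos
    obtain ⟨f, -, hf, hsum⟩ := b.exists_root_eq_sum_int i
    have hf0 : 0 ≤ f := by
      rcases hf with hf | hf
      · exact hf.le
      · rw [RootPairing.Base.isPos_iff, RootPairing.Base.height_eq_sum hsum] at hipos
        exact absurd hipos (Finset.sum_nonpos fun j _ => hf.le j).not_gt
    have h1 : b.height (w • i) = ∑ j ∈ b.support, f j * b.height (w • j) := by
      have h2 : (b.height (w • i) : ℂ) =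
          ∑ j ∈ b.support, (f j : ℂ) * (b.height (w • j) : ℂ) := by
        rw [← hη, root_smul, hsum, Finset.smul_sum, map_sum]
        refine Finset.sum_congr rfl fun j _ => ?_
        rw [smul_comm, ← root_smul, map_zsmul, hη, zsmul_eq_mul]
      exact_mod_cast h2
    rw [RootPairing.Base.isPos_iff, h1, not_lt]
    refine Finset.sum_nonpos fun j hj => ?_
    by_cases hjJ : j ∈ J
    · have := hsimple j hjJ
      rw [RootPairing.Base.isPos_iff, not_lt] at this
      exact mul_nonpos_of_nonneg_of_nonpos (hf0 j) this
    · rw [eq_zero_of_isSpannedBy b hJ hi hsum hj hjJ, zero_mul]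
  refine ⟨w, fun i hi => ⟨fun h h' => hpos i hi h' h, fun h => ?_⟩, hw.2⟩
  by_contra hcon
  have h1 := hpos _ ((isSpannedBy_neg_iff i).mpr hi) ((isPos_neg_iff b i).mpr h)
  rw [smul_reflectionPerm_self, isPos_neg_iff, not_not] at h1
  exact hcon h1

end LongestElements

end GroupZeta

namespace GroupZeta

/-! ### Levels, heights, and the integer c_p -/

section IntegralHeights

variable {ι V V' : Type*} [AddCommGroup V] [Module ℂ V] [AddCommGroup V'] [Module ℂ V']
  {P : RootPairing ι ℂ V V'} (b : P.Base)

/-- The coefficient of a coroot at the simple coroot `p`. -/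
noncomputable def coLevel (p : b.support) (i : ι) : ℤ := (exists_coroot_eq_sum b i).choose p

lemma coroot'_fundamentalWeight_of_mem [P.IsRootSystem] (p : b.support) {j : ι}
    (hj : j ∈ b.support) [Decidable (j = p)] :
    P.coroot' j (fundamentalWeight b p) = if j = p then 1 else 0 := by
  have h : P.coroot' j (fundamentalWeight b p) = b.toCoweightBasis.coord p (P.coroot j) := by
    change P.toPerfPair (P.toPerfPair.symm (b.toCoweightBasis.coord p)) (P.coroot j) = _
    rw [LinearEquiv.apply_symm_apply]
  have h1 := b.toCoweightBasis_repr_coroot ⟨j, hj⟩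
  simp only at h1
  rw [h, Module.Basis.coord_apply, h1]
  split_ifs with h2
  · rw [show (⟨j, hj⟩ : b.support) = p from Subtype.ext h2, Finsupp.single_eq_same]
  · rw [Finsupp.single_eq_of_ne]
    exact fun h3 => h2 (congrArg Subtype.val h3).symm

lemma coroot'_fundamentalWeight_of_eq_sum [P.IsRootSystem] (p : b.support) {i : ι} {f : ι → ℤ}
    (h : P.coroot i = ∑ j ∈ b.support, f j • P.coroot j) :
    P.coroot' i (fundamentalWeight b p) = f p := by
  classical
  rw [coroot'_eq_sum h, Finset.sum_eq_single_of_mem (p : ι) p.2,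
    coroot'_fundamentalWeight_of_mem b p p.2]
  · simp
  · intro j hj hjp
    rw [coroot'_fundamentalWeight_of_mem b p hj, if_neg hjp, mul_zero]

lemma coroot'_fundamentalWeight [P.IsRootSystem] (p : b.support) (i : ι) :
    P.coroot' i (fundamentalWeight b p) = coLevel b p i :=
  coroot'_fundamentalWeight_of_eq_sum b p (exists_coroot_eq_sum b i).choose_spec.1

lemma coroot'_inv_smul (w : P.weylGroup) (i : ι) (x : V) :
    P.coroot' i (w⁻¹ • x) = P.coroot' (w • i) x := by
  rw [coroot'_smul, inv_inv]

variable [Fintype ι] [P.IsCrystallographic] [P.IsReduced]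

lemma coLevel_nonneg [P.IsRootSystem] (p : b.support) {i : ι} (hi : b.IsPos i) :
    0 ≤ coLevel b p i := by
  obtain ⟨f, h1, h2⟩ := exists_coroot_eq_sum_nonneg b hi
  have h3 := coroot'_fundamentalWeight_of_eq_sum b p h1
  rw [coroot'_fundamentalWeight] at h3
  have h4 : coLevel b p i = f p := by exact_mod_cast h3
  rw [h4]
  exact h2 p

lemma isPos_iff_flip_height (i : ι) : b.IsPos i ↔ 0 < b.flip.height i := by
  rw [isPos_iff_flip_isPos, RootPairing.Base.isPos_iff]

lemma coroot'_rho_of_mem {j : ι} (hj : j ∈ b.support) : P.coroot' j (rho b) = 1 := by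
  classical
  have h := sum_coroot'_root_of_mem b (J := b.support) subset_rfl hj
  have hspan : ∀ i, IsSpannedBy (P := P) (b.support : Set ι) i := fun i => by
    rw [IsSpannedBy, b.span_root_support]
    exact Submodule.subset_span ⟨i, rfl⟩
  simp only [hspan, and_true] at h
  rw [rho, map_smul, map_sum, smul_eq_mul]
  have h' : ∑ i with b.IsPos i, P.coroot' j (P.root i) = 2 := by convert h
  convert_to (1 / 2 : ℂ) * (∑ i with b.IsPos i, P.coroot' j (P.root i)) = 1
  rw [h']
  norm_num

lemma ht_eq_flip_height (i : ι) : ht b i = b.flip.height i := by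
  obtain ⟨f, h1, -⟩ := exists_coroot_eq_sum b i
  rw [ht, coroot'_eq_sum h1, RootPairing.Base.height_eq_sum (b := b.flip) h1, Int.cast_sum]
  refine Finset.sum_congr rfl fun j hj => ?_
  rw [coroot'_rho_of_mem b hj, mul_one]

variable [P.IsRootSystem]

/-- The longest element of the Weyl group. -/
lemma exists_longest_height :
    ∃ w : P.weylGroup, ∀ i, b.flip.height (w • i) = -b.flip.height i := by
  classical
  obtain ⟨w, h1, h2, -⟩ := exists_longest b (J := b.support) subset_rfl
  refine ⟨w, fun i => ?_⟩
  have hspan : ∀ i, IsSpannedBy (P := P) (b.support : Set ι) i := fun i => by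
    rw [IsSpannedBy, b.span_root_support]
    exact Submodule.subset_span ⟨i, rfl⟩
  have h3 := inv_smul_rho b h1 h2
  have h4 : ∑ i with b.IsPos i ∧ IsSpannedBy (P := P) (b.support : Set ι) i, P.root i =
      (2 : ℂ) • rho b := by
    simp only [hspan, and_true, rho, smul_smul]
    norm_num
  rw [h4] at h3
  have h5 : ((b.flip.height (w • i) : ℤ) : ℂ) = ((-b.flip.height i : ℤ) : ℂ) := by
    rw [Int.cast_neg, ← ht_eq_flip_height, ← ht_eq_flip_height, ht, ht, ← coroot'_inv_smul, h3,
      map_sub, map_smul, smul_eq_mul]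
    ring
  exact_mod_cast h5

/-- The longest element of the Weyl group of a maximal standard Levi subgroup. -/
lemma exists_levi_longest (p : b.support) :
    ∃ (w : P.weylGroup) (c : ℤ), cp b p = c ∧ ∀ i, coLevel b p (w • i) = coLevel b p i ∧
      b.flip.height (w • i) = c * coLevel b p i - b.flip.height i := by
  classical
  set J : Set ι := {j | j ∈ b.support ∧ j ≠ p} with hJdef
  have hJ : J ⊆ b.support := fun j hj => hj.1
  obtain ⟨w, h1, h2, h3⟩ := exists_longest b hJ
  set X : V := ∑ i with b.IsPos i ∧ IsSpannedBy (P := P) J i, P.root i with hX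
  set n : ℤ := ∑ i with b.IsPos i ∧ IsSpannedBy (P := P) J i, P.pairingIn ℤ i p with hn
  have hXp : P.coroot' p X = n := by
    rw [hX, map_sum, hn, Int.cast_sum]
    refine Finset.sum_congr rfl fun i _ => ?_
    rw [P.root_coroot'_eq_pairing, ← P.algebraMap_pairingIn ℤ]
    rfl
  have hXj : ∀ j ∈ J, P.coroot' j X = 2 := fun j hj => by
    rw [hX, map_sum, sum_coroot'_root_of_mem b hJ hj]
  have hlevi : rhoLevi b p = (1 / 2 : ℂ) • X := by
    rw [rhoLevi, hX]
    rfl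
  have hc : cp b p = ((2 - n : ℤ) : ℂ) := by
    rw [cp, hlevi, map_sub, map_smul, hXp, coroot'_fundamentalWeight_of_mem b p p.2, if_pos rfl,
      smul_eq_mul]
    push_cast
    ring
  refine ⟨w, 2 - n, hc, fun i => ⟨?_, ?_⟩⟩
  · have h4 : w • fundamentalWeight b p = fundamentalWeight b p := by
      refine h3 _ fun j hj => ?_
      rw [coroot'_fundamentalWeight_of_mem b p hj.1, if_neg hj.2]
    have h5 := coroot'_smul_smul w i (fundamentalWeight b p)
    rw [h4, coroot'_fundamentalWeight, coroot'_fundamentalWeight] at h5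
    exact_mod_cast h5
  · obtain ⟨f, hf, -⟩ := exists_coroot_eq_sum b i
    have h4 := inv_smul_rho b h1 h2
    -- The vectors w⁻¹ρ = ρ - 2ρ_p and c_p λ_p - ρ pair equally with simple coroots: to -1 away from
    -- p and to 1 - n at p, where c_p = 2 - n.
    have h5 : ∀ j ∈ b.support, P.coroot' j (w⁻¹ • rho b) =
        ((2 - n : ℤ) : ℂ) * P.coroot' j (fundamentalWeight b p) - P.coroot' j (rho b) := by
      intro j hj
      rw [h4, map_sub, coroot'_rho_of_mem b hj, coroot'_fundamentalWeight_of_mem b p hj]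
      split_ifs with hjp
      · rw [hjp]
        change 1 - P.coroot' p X = _
        rw [hXp]
        push_cast
        ring
      · change 1 - P.coroot' j X = _
        rw [hXj j ⟨hj, hjp⟩]
        ring
    have h6 : P.coroot' i (w⁻¹ • rho b) =
        ((2 - n : ℤ) : ℂ) * P.coroot' i (fundamentalWeight b p) - P.coroot' i (rho b) := by
      rw [coroot'_eq_sum hf, coroot'_eq_sum hf, coroot'_eq_sum hf, Finset.mul_sum,
        ← Finset.sum_sub_distrib]
      refine Finset.sum_congr rfl fun j hj => ?_
      rw [h5 j hj]
      ring
    rw [coroot'_inv_smul, coroot'_fundamentalWeight] at h6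
    change ht b _ = _ - ht b i at h6
    rw [ht_eq_flip_height, ht_eq_flip_height] at h6
    exact_mod_cast h6

end IntegralHeights

end GroupZeta

namespace GroupZeta

/-! ### The symmetry of the root system and the exponents of D -/

section Exponents

variable {ι V V' : Type*} [AddCommGroup V] [Module ℂ V] [AddCommGroup V'] [Module ℂ V']
  {P : RootPairing ι ℂ V V'} (b : P.Base) (p : b.support)

lemma one_mem_specialWeyl : (1 : P.weylGroup) ∈ specialWeyl b p := fun i hi _ => by
  rw [one_smul]
  exact Or.inl hi

instance : Nonempty (specialWeyl b p) := ⟨⟨1, one_mem_specialWeyl b p⟩⟩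

lemma flip_height_neg (i : ι) : b.flip.height (P.reflectionPerm i i) = -b.flip.height i :=
  RootPairing.Base.height_reflectionPerm_self b.flip i

variable [P.IsRootSystem]

lemma coLevel_neg (i : ι) : coLevel b p (P.reflectionPerm i i) = -coLevel b p i := by
  have h := coroot'_reflectionPerm_self (P := P) i (fundamentalWeight b p)
  rw [coroot'_fundamentalWeight, coroot'_fundamentalWeight] at h
  exact_mod_cast h

variable [Fintype ι]

lemma bddAbove_drop (m h : ℤ) : BddAbove (Set.range fun w : specialWeyl b p =>
    ((countW b p w m (h - 1) : ℤ) - countW b p w m h)) :=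
  (Set.finite_range _).bddAbove

variable [P.IsCrystallographic] [P.IsReduced]

/-- Membership in Δ_p is read off from level and coroot height, the only two data that the symmetry
has to track. -/
lemma mem_levi_base_iff (i : ι) :
    (i ∈ b.support ∧ i ≠ p) ↔ (coLevel b p i = 0 ∧ b.flip.height i = 1) := by
  classical
  rw [flip_height_eq_one_iff, and_comm]
  refine and_congr_left fun hi => ?_
  have h := coroot'_fundamentalWeight_of_mem b p hi
  rw [coroot'_fundamentalWeight] at h
  split_ifs at h with hip
  · have h' : coLevel b p i = 1 := by exact_mod_cast h
    exact iff_of_false (not_not.mpr hip) (by omega)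
  · have hlevel : coLevel b p i = 0 := by exact_mod_cast h
    exact iff_of_true hip hlevel

/-- The symmetry of the root system that underlies the functional equation. -/
lemma exists_symmetry_perm :
    ∃ c : ℤ, cp b p = c ∧ ∃ (σ : Equiv.Perm ι) (τ : Equiv.Perm P.weylGroup),
      (∀ i, coLevel b p (σ i) = -coLevel b p i) ∧
      (∀ i, b.flip.height (σ i) = b.flip.height i - c * coLevel b p i) ∧
      ∀ w i, b.flip.height (τ w • i) = b.flip.height (w • σ i) := by
  obtain ⟨w₀, hw₀⟩ := exists_longest_height b
  obtain ⟨w₁, c, hc, hw₁⟩ := exists_levi_longest b p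
  have hinv : Function.Involutive fun i : ι => P.reflectionPerm i i :=
    reflectionPerm_self_reflectionPerm_self
  -- With w₁ the longest element of the Levi Weyl group, σ is α ↦ w₁(-α) and τ is w ↦ w₀ w w₁; w₀
  -- negates heights, and this cancels the sign in σ.
  refine ⟨c, hc, hinv.toPerm.trans (MulAction.toPerm w₁),
    (Equiv.mulRight w₁).trans (Equiv.mulLeft w₀), fun i => ?_, fun i => ?_, fun w i => ?_⟩
  · change coLevel b p (w₁ • P.reflectionPerm i i) = _
    rw [(hw₁ _).1, coLevel_neg]
  · change b.flip.height (w₁ • P.reflectionPerm i i) = _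
    rw [(hw₁ _).2, coLevel_neg, flip_height_neg]
    ring
  · change b.flip.height ((w₀ * (w * w₁)) • i) = b.flip.height (w • w₁ • P.reflectionPerm i i)
    rw [mul_smul, mul_smul, hw₀, smul_reflectionPerm_self, smul_reflectionPerm_self,
      flip_height_neg]

open Classical in
lemma countW_eq (w : P.weylGroup) (m h : ℤ) : countW b p w m h =
    Finset.card {i : ι | ¬ 0 < b.flip.height (w • i) ∧ coLevel b p i = m ∧
      b.flip.height i = h} := by
  rw [countW]
  congr 1
  ext i
  simp only [Finset.mem_filter, Finset.mem_univ, true_and, isPos_iff_flip_height,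
    coroot'_fundamentalWeight, ht_eq_flip_height, Int.cast_inj]

open Classical in
lemma count_eq (m h : ℤ) : count b p m h =
    Finset.card {i : ι | coLevel b p i = m ∧ b.flip.height i = h} := by
  rw [count]
  congr 1
  ext i
  simp only [Finset.mem_filter, Finset.mem_univ, true_and, coroot'_fundamentalWeight,
    ht_eq_flip_height, Int.cast_inj]

lemma mem_specialWeyl_iff (w : P.weylGroup) : w ∈ specialWeyl b p ↔
    ∀ i, coLevel b p i = 0 ∧ b.flip.height i = 1 →
      b.flip.height (w • i) = 1 ∨ ¬ 0 < b.flip.height (w • i) := by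
  rw [specialWeyl]
  refine forall_congr' fun i => ?_
  rw [← mem_levi_base_iff, and_imp, flip_height_eq_one_iff, isPos_iff_flip_height]

lemma isPos_of_coLevel_pos {i : ι} (hi : 0 < coLevel b p i) : b.IsPos i := by
  by_contra h
  have := coLevel_nonneg b p ((isPos_neg_iff b i).mpr h)
  rw [coLevel_neg] at this
  omega

lemma countW_le_count (w : P.weylGroup) (m h : ℤ) : countW b p w m h ≤ count b p m h := by
  classical
  rw [countW_eq, count_eq]
  refine Finset.card_le_card fun i hi => ?_
  simp only [Finset.mem_filter, Finset.mem_univ, true_and] at hi ⊢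
  exact hi.2

lemma countW_one {h : ℤ} (hh : 0 < h) (m : ℤ) : countW b p 1 m h = 0 := by
  classical
  rw [countW_eq, Finset.card_eq_zero, Finset.filter_eq_empty_iff]
  rintro i - ⟨h1, -, h2⟩
  rw [one_smul, h2] at h1
  exact h1 hh

lemma count_eq_zero {m h : ℤ} (hm : 0 < m) (hh : h ≤ 0) : count b p m h = 0 := by
  classical
  rw [count_eq, Finset.card_eq_zero, Finset.filter_eq_empty_iff]
  rintro i - ⟨h1, h2⟩
  have := isPos_of_coLevel_pos b p (i := i) (by omega)
  rw [isPos_iff_flip_height] at this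
  omega

/-- The identity w = 1 lies in 𝔚_p and gives drop 0: a negative root has no positive coroot height,
and h - 1 ≥ 1. Hence the truncation at 0 in `maxPosDrop` is harmless. -/
lemma maxDrop_nonneg {h : ℤ} (hh : 2 ≤ h) (m : ℤ) : 0 ≤ maxDrop b p m h := by
  refine le_ciSup_of_le (bddAbove_drop b p m h) ⟨1, one_mem_specialWeyl b p⟩ ?_
  change 0 ≤ (countW b p 1 m (h - 1) : ℤ) - countW b p 1 m h
  rw [countW_one b p (by omega), countW_one b p (by omega)]
  simp

lemma maxPosDrop_eq_maxDrop {h : ℤ} (hh : 2 ≤ h) (m : ℤ) :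
    maxPosDrop b p m h = maxDrop b p m h := by
  refine le_antisymm (ciSup_le fun w => max_le (maxDrop_nonneg b p hh m) ?_) (ciSup_le fun w => ?_)
  · exact le_ciSup (bddAbove_drop b p m h) w
  · exact (le_max_right _ _).trans (le_ciSup (f := fun w : specialWeyl b p =>
      max 0 ((countW b p w m (h - 1) : ℤ) - countW b p w m h)) (Set.finite_range _).bddAbove w)

/-- The exponent of `ζ̂_X(m s + h)` in `D_X^{(G,P)}(s)`. -/
noncomputable def exponent (m h : ℤ) : ℤ := (count b p m (h - 1) : ℤ) - maxDrop b p m h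

lemma maxDrop_eq_zero {m h : ℤ} (h1 : count b p m (h - 1) = 0)
    (h2 : count b p m h = 0 ∨ 0 < h) : maxDrop b p m h = 0 := by
  have h3 : ∀ w, countW b p w m (h - 1) = 0 := fun w =>
    Nat.le_zero.mp ((countW_le_count b p w m _).trans h1.le)
  refine le_antisymm (ciSup_le fun w => ?_)
    (le_ciSup_of_le (bddAbove_drop b p m h) ⟨1, one_mem_specialWeyl b p⟩ ?_)
  · rw [h3]
    simp
  · change 0 ≤ (countW b p 1 m (h - 1) : ℤ) - countW b p 1 m h
    have h4 : countW b p 1 m h = 0 := by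
      rcases h2 with h2 | h2
      · exact Nat.le_zero.mp ((countW_le_count b p 1 m _).trans h2.le)
      · exact countW_one b p h2 m
    rw [h3, h4]
    simp

lemma exponent_eq_zero {m h : ℤ} (h1 : count b p m (h - 1) = 0)
    (h2 : count b p m h = 0 ∨ 0 < h) : exponent b p m h = 0 := by
  rw [exponent, maxDrop_eq_zero b p h1 h2, h1]
  simp

/-- Roots of positive level are positive and so have height ≥ 1. For m > 0 the restriction h ≥ 2 in
D thus omits no nonzero exponent, which lets h be reflected freely. -/
lemma exponent_eq_zero_of_le {m h : ℤ} (hm : 0 < m) (hh : h ≤ 1) : exponent b p m h = 0 := by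
  refine exponent_eq_zero b p (count_eq_zero b p hm (by omega)) ?_
  rcases lt_or_ge 0 h with h0 | h0
  · exact Or.inr h0
  · exact Or.inl (count_eq_zero b p hm h0)

lemma count_symm {c : ℤ} {σ : Equiv.Perm ι} (h1 : ∀ i, coLevel b p (σ i) = -coLevel b p i)
    (h2 : ∀ i, b.flip.height (σ i) = b.flip.height i - c * coLevel b p i) (m h : ℤ) :
    count b p m h = count b p m (c * m - h) := by
  classical
  rw [count_eq, count_eq]
  have hinj : Function.Injective fun i : ι => P.reflectionPerm i i :=
    (show Function.Involutive fun i : ι => P.reflectionPerm i i from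
      reflectionPerm_self_reflectionPerm_self).injective
  have key : ∀ m h : ℤ, Finset.card {i : ι | coLevel b p i = m ∧ b.flip.height i = h} ≤
      Finset.card {i : ι | coLevel b p i = m ∧ b.flip.height i = c * m - h} := by
    intro m h
    refine Finset.card_le_card_of_injOn (fun i => P.reflectionPerm (σ i) (σ i)) ?_
      (hinj.comp σ.injective).injOn
    intro i hi
    simp only [Finset.coe_filter, Finset.mem_univ, true_and, Set.mem_ofPred_eq] at hi ⊢
    rw [coLevel_neg, flip_height_neg, h1, h2, hi.1, hi.2]
    constructor <;> ring
  refine le_antisymm (key m h) ?_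
  have := key m (c * m - h)
  rwa [sub_sub_cancel] at this

/-- The map α ↦ -σα preserves the level m and sends height h to c m - h. It exchanges the condition
τ(w)α < 0 with a positive image under w, hence the complementary count. -/
lemma countW_symm {c : ℤ} {σ : Equiv.Perm ι} {τ : Equiv.Perm P.weylGroup}
    (h1 : ∀ i, coLevel b p (σ i) = -coLevel b p i)
    (h2 : ∀ i, b.flip.height (σ i) = b.flip.height i - c * coLevel b p i)
    (h3 : ∀ w i, b.flip.height (τ w • i) = b.flip.height (w • σ i)) (w : P.weylGroup) (m h : ℤ) :
    (countW b p (τ w) m h : ℤ) = count b p m (c * m - h) - countW b p w m (c * m - h) := by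
  classical
  have hinv : Function.Involutive fun i : ι => P.reflectionPerm i i :=
    reflectionPerm_self_reflectionPerm_self
  have hsplit : countW b p w m (c * m - h) +
      Finset.card {i : ι | 0 < b.flip.height (w • i) ∧ coLevel b p i = m ∧
        b.flip.height i = c * m - h} = count b p m (c * m - h) := by
    rw [countW_eq, count_eq, add_comm, ← Finset.card_filter_add_card_filter_not
      (s := ({i : ι | coLevel b p i = m ∧ b.flip.height i = c * m - h} : Finset ι))
      (fun i => 0 < b.flip.height (w • i)), Finset.filter_filter, Finset.filter_filter]
    congr 2 <;> · ext i; simp [and_comm]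
  have hbij : countW b p (τ w) m h = Finset.card {i : ι | 0 < b.flip.height (w • i) ∧
      coLevel b p i = m ∧ b.flip.height i = c * m - h} := by
    rw [countW_eq]
    refine Finset.card_equiv (σ.trans hinv.toPerm) fun i => ?_
    simp only [Finset.mem_filter, Finset.mem_univ, true_and, Equiv.trans_apply,
      Function.Involutive.coe_toPerm]
    rw [h3, smul_reflectionPerm_self, flip_height_neg, coLevel_neg, flip_height_neg, h1, h2,
      neg_neg]
    have hne : b.flip.height (w • σ i) ≠ 0 := b.flip.height_ne_zero _
    constructor
    · rintro ⟨h4, h5, h6⟩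
      exact ⟨by omega, h5, by rw [h5, h6]; ring⟩
    · rintro ⟨h4, h5, h6⟩
      exact ⟨by omega, h5, by rw [h5] at h6; linarith⟩
  rw [hbij, ← hsplit]
  push_cast
  ring

/-- On level 0 the permutation σ leaves heights unchanged, so it preserves Δ_p, and the condition
for τ w becomes that for w. -/
lemma specialWeyl_symm {c : ℤ} {σ : Equiv.Perm ι} {τ : Equiv.Perm P.weylGroup}
    (h1 : ∀ i, coLevel b p (σ i) = -coLevel b p i)
    (h2 : ∀ i, b.flip.height (σ i) = b.flip.height i - c * coLevel b p i)
    (h3 : ∀ w i, b.flip.height (τ w • i) = b.flip.height (w • σ i)) (w : P.weylGroup) :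
    τ w ∈ specialWeyl b p ↔ w ∈ specialWeyl b p := by
  rw [mem_specialWeyl_iff, mem_specialWeyl_iff]
  refine σ.forall_congr fun i => ?_
  rw [h3, h1, h2]
  refine imp_congr_left ⟨fun h => ?_, fun h => ?_⟩
  · rw [h.1, h.2]
    simp
  · have h4 : coLevel b p i = 0 := neg_eq_zero.mp h.1
    rw [h4, mul_zero, sub_zero] at h
    exact ⟨h4, h.2⟩

/-- The symmetry of the exponents of `D_X^{(G,P)}`. -/
lemma exponent_symm {c : ℤ} (hc : cp b p = c) (m h : ℤ) :
    exponent b p m h = exponent b p m (c * m - h + 1) := by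
  obtain ⟨c', hc', σ, τ, h1, h2, h3⟩ := exists_symmetry_perm b p
  obtain rfl : c' = c := by
    have : (c' : ℂ) = c := by rw [← hc, ← hc']
    exact_mod_cast this
  -- The drop of τ w at h is the drop of w at c m - h + 1 plus a constant independent of w, and τ
  -- permutes 𝔚_p.
  have hsup : maxDrop b p m h = maxDrop b p m (c' * m - h + 1) +
      (count b p m (c' * m - h + 1) - count b p m (c' * m - h)) := by
    rw [maxDrop, maxDrop, ciSup_add (bddAbove_drop b p m _)]
    symm
    refine Equiv.iSup_congr
      (τ.subtypeEquiv fun w => (specialWeyl_symm b p h1 h2 h3 w).symm) fun w => ?_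
    change (countW b p (τ w) m (h - 1) : ℤ) - countW b p (τ w) m h = _
    rw [countW_symm b p h1 h2 h3, countW_symm b p h1 h2 h3,
      show c' * m - (h - 1) = c' * m - h + 1 by ring, add_sub_cancel_right]
    ring
  rw [exponent, exponent, hsup, count_symm b p h1 h2 m (h - 1),
    show c' * m - (h - 1) = c' * m - h + 1 by ring, add_sub_cancel_right]
  ring

end Exponents

end GroupZeta

namespace GroupZeta

/-! ### The factor D, the full factor, and the quotient formula -/

section Denominator

lemma IsCompletedZeta.meromorphic_affine {Z : ℂ → ℂ} {U : Set ℂ} (hZ : IsCompletedZeta Z U)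
    (m h : ℂ) : Meromorphic fun s => Z (m * s + h) := fun s =>
  (hZ.meromorphic (m * s + h)).comp_analyticAt (g := fun s => m * s + h) (by fun_prop)

lemma IsCompletedZeta.eventually_affine {Z : ℂ → ℂ} {U : Set ℂ} (hZ : IsCompletedZeta Z U)
    {m h : ℤ} (hmh : m ≠ 0 ∨ 2 ≤ h) :
    ∀ᶠ s in codiscrete ℂ, (m * s + h : ℂ) ∈ U ∧ Z (m * s + h) ≠ 0 := by
  by_cases hm : m = 0
  · have hh : 2 ≤ h := hmh.resolve_left (not_not.mpr hm)
    refine Eventually.of_forall fun s => ?_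
    rw [hm, Int.cast_zero, zero_mul, zero_add]
    refine ⟨hZ.mem_of_re _ ?_ ?_, hZ.ne_zero h hh⟩
    · rw [Complex.intCast_re]
      exact_mod_cast (by omega : h ≠ 0)
    · rw [Complex.intCast_re]
      exact_mod_cast (by omega : h ≠ 1)
  · exact (tendsto_affine_codiscrete (a := (m : ℂ)) (by exact_mod_cast hm) h).eventually
      hZ.mem_codiscrete

/-- A `finprod` of infinite support is 1 by convention; a bound on the nontrivial factors turns the
products in the definitions into genuine finite ones. -/
lemma finprod_eq_prod_range_Ico {M : Type*} [CommMonoid M] {g : ℕ → ℕ → M} {B : ℕ}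
    (hg : ∀ m h, 2 ≤ h → B ≤ m ∨ B ≤ h → g m h = 1) :
    ∏ᶠ (m : ℕ) (h : ℕ) (_ : 2 ≤ h), g m h =
      ∏ m ∈ Finset.range B, ∏ h ∈ Finset.Ico 2 B, g m h := by
  classical
  have h1 : ∀ m, ∏ᶠ (h : ℕ) (_ : 2 ≤ h), g m h = ∏ h ∈ Finset.Ico 2 B, g m h := by
    intro m
    simp only [finprod_eq_if]
    rw [finprod_eq_prod_of_mulSupport_subset (s := Finset.Ico 2 B)]
    · refine Finset.prod_congr rfl fun h hh => ?_
      rw [if_pos (Finset.mem_Ico.mp hh).1]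
    · intro h hh
      rw [Function.mem_mulSupport] at hh
      by_cases h2 : 2 ≤ h
      · rw [if_pos h2] at hh
        rw [Finset.coe_Ico, Set.mem_Ico]
        refine ⟨h2, ?_⟩
        by_contra h3
        exact hh (hg m h h2 (Or.inr (by omega)))
      · rw [if_neg h2] at hh
        exact absurd rfl hh
  simp only [h1]
  refine finprod_eq_prod_of_mulSupport_subset _ fun m hm => ?_
  rw [Function.mem_mulSupport] at hm
  rw [Finset.coe_range, Set.mem_Iio]
  by_contra h3
  exact hm (Finset.prod_eq_one fun h hh =>
    hg m h (Finset.mem_Ico.mp hh).1 (Or.inl (by omega)))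

variable {ι V V' : Type*} [AddCommGroup V] [Module ℂ V] [AddCommGroup V'] [Module ℂ V']
  {P : RootPairing ι ℂ V V'} (b : P.Base) (p : b.support)

lemma exists_bound [Fintype ι] : ∃ B : ℕ, ∀ i : ι, (coLevel b p i).natAbs + 1 < B ∧
    (b.flip.height i).natAbs + 1 < B := by
  refine ⟨∑ i, ((coLevel b p i).natAbs + (b.flip.height i).natAbs) + 2, fun i => ?_⟩
  have := Finset.single_le_sum
    (f := fun i => (coLevel b p i).natAbs + (b.flip.height i).natAbs)
    (fun _ _ => Nat.zero_le _) (Finset.mem_univ i)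
  omega

variable [Fintype ι] [P.IsRootSystem] [P.IsCrystallographic] [P.IsReduced]

variable {b p} in
lemma count_eq_zero_of_bound {B : ℕ} (hB : ∀ i : ι, (coLevel b p i).natAbs + 1 < B ∧
    (b.flip.height i).natAbs + 1 < B) {m h : ℤ} (hmh : B ≤ m ∨ B ≤ h + 1) :
    count b p m h = 0 := by
  classical
  rw [count_eq, Finset.card_eq_zero, Finset.filter_eq_empty_iff]
  rintro i - ⟨h1, h2⟩
  have := hB i
  omega

variable {b p} in
lemma exponent_eq_zero_of_bound {B : ℕ} (hB : ∀ i : ι, (coLevel b p i).natAbs + 1 < B ∧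
    (b.flip.height i).natAbs + 1 < B) {m h : ℤ} (hh : 2 ≤ h) (hmh : B ≤ m ∨ B ≤ h) :
    exponent b p m h = 0 :=
  exponent_eq_zero b p (count_eq_zero_of_bound hB (by omega)) (Or.inr (by omega))

variable (k F : Type*) [Field k] [Field F] [Algebra k F]

variable {b p} in
lemma Dfactor_eq_prod {B : ℕ} (hB : ∀ i : ι, (coLevel b p i).natAbs + 1 < B ∧
    (b.flip.height i).natAbs + 1 < B) (s : ℂ) :
    Dfactor b p k F s = ∏ m ∈ Finset.range B, ∏ h ∈ Finset.Ico 2 B,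
      completedZeta k F (m * s + h) ^ exponent b p m h := by
  rw [← finprod_eq_prod_range_Ico
    (g := fun m h => completedZeta k F (m * s + h) ^ exponent b p m h)]
  · rfl
  · intro m h h2 hmh
    rw [exponent_eq_zero_of_bound hB (by exact_mod_cast h2) (by exact_mod_cast hmh), zpow_zero]

variable {b p} in
lemma groupZeta_eq_prod {B : ℕ} (hB : ∀ i : ι, (coLevel b p i).natAbs + 1 < B ∧
    (b.flip.height i).natAbs + 1 < B) (l : List b.support) (s : ℂ) :
    groupZeta b p k F l s = (∏ m ∈ Finset.range B, ∏ h ∈ Finset.Ico 2 B,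
      completedZeta k F (m * s + h) ^ maxDrop b p m h) * parabolicPeriod b p k F l s := by
  rw [groupZeta, finprod_eq_prod_range_Ico
    (g := fun m h => completedZeta k F (m * s + h) ^ maxPosDrop b p m h) (B := B)]
  · congr 1
    refine Finset.prod_congr rfl fun m _ => Finset.prod_congr rfl fun h hh => ?_
    rw [maxPosDrop_eq_maxDrop b p (by exact_mod_cast (Finset.mem_Ico.mp hh).1)]
  · intro m h h2 hmh
    rw [maxPosDrop_eq_maxDrop b p (by exact_mod_cast h2), maxDrop_eq_zero, zpow_zero]
    · exact count_eq_zero_of_bound hB (by omega)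
    · exact Or.inr (by omega)

variable {b p} in
-- Positive roots are sorted by level and by height + 1. A root counted here has height h - 1 ≥ 1
-- and is therefore positive.
lemma fullFactor_eq_prod {B : ℕ} (hB : ∀ i : ι, (coLevel b p i).natAbs + 1 < B ∧
    (b.flip.height i).natAbs + 1 < B) (s : ℂ) :
    fullFactor b p k F s = ∏ m ∈ Finset.range B, ∏ h ∈ Finset.Ico 2 B,
      completedZeta k F (m * s + h) ^ (count b p m (h - 1) : ℤ) := by
  classical
  have hval : ∀ i, b.IsPos i → 0 ≤ coLevel b p i ∧ 0 < b.flip.height i := fun i hi =>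
    ⟨coLevel_nonneg b p hi, (isPos_iff_flip_height b i).mp hi⟩
  rw [fullFactor, ← Finset.prod_product'
    (f := fun m h : ℕ => completedZeta k F (m * s + h) ^ (count b p m (h - 1) : ℤ)),
    ← Finset.prod_fiberwise_of_maps_to (t := Finset.range B ×ˢ Finset.Ico 2 B)
      (g := fun i => ((coLevel b p i).toNat, (b.flip.height i + 1).toNat))]
  · refine Finset.prod_congr rfl fun x hx => ?_
    rw [Finset.mem_product, Finset.mem_range, Finset.mem_Ico] at hx
    rw [zpow_natCast, count_eq, ← Finset.prod_const]
    have hset : Finset.filter (fun i => ((coLevel b p i).toNat, (b.flip.height i + 1).toNat) = x)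
        (Finset.univ.filter fun i => b.IsPos i) =
        Finset.univ.filter fun i => coLevel b p i = x.1 ∧ b.flip.height i = (x.2 : ℤ) - 1 := by
      ext i
      simp only [Finset.mem_filter, Finset.mem_univ, true_and, Prod.ext_iff]
      constructor
      · rintro ⟨h1, h2, h3⟩
        have := hval i h1
        omega
      · rintro ⟨h1, h2⟩
        refine ⟨(isPos_iff_flip_height b i).mpr (by omega), by omega, by omega⟩
    rw [hset]
    refine Finset.prod_congr rfl fun i hi => ?_
    rw [Finset.mem_filter] at hi
    rw [coroot'_fundamentalWeight, ht_eq_flip_height, hi.2.1, hi.2.2]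
    congr 1
    push_cast
    ring
  · intro i hi
    rw [Finset.mem_filter] at hi
    have h1 := hval i hi.2
    have h2 := hB i
    rw [Finset.mem_product, Finset.mem_range, Finset.mem_Ico]
    simp only
    omega

variable {k F}
variable {U : Set ℂ} (hZ : IsCompletedZeta (completedZeta k F) U)
include hZ

lemma meromorphic_Dfactor : Meromorphic (Dfactor b p k F) := by
  obtain ⟨B, hB⟩ := exists_bound b p
  rw [funext (Dfactor_eq_prod k F hB)]
  intro s
  refine MeromorphicAt.fun_prod fun m _ => MeromorphicAt.fun_prod fun h _ => ?_
  exact (hZ.meromorphic_affine m h s).zpow _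

lemma eventually_forall_box (B : ℕ) : ∀ᶠ s in codiscrete ℂ, ∀ m ∈ Finset.range B,
    ∀ h ∈ Finset.Ico 2 B, (m * s + h : ℂ) ∈ U ∧ completedZeta k F (m * s + h) ≠ 0 := by
  rw [eventually_all_finset]
  intro m _
  rw [eventually_all_finset]
  intro h hh
  have := hZ.eventually_affine (m := m) (h := h) (Or.inr (by exact_mod_cast (Finset.mem_Ico.mp hh).1))
  simpa only [Int.cast_natCast] using this

/-- At points where no zeta factor vanishes this is the identity M = N - (N - M) in the exponents.
-/
lemma groupZeta_eventuallyEq (l : List b.support) :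
    (fun s => groupZeta b p k F l s) =ᶠ[codiscrete ℂ]
      fun s => Omega b p k F l s / Dfactor b p k F s := by
  obtain ⟨B, hB⟩ := exists_bound b p
  filter_upwards [eventually_forall_box hZ B] with s hs
  rw [Omega, groupZeta_eq_prod k F hB, fullFactor_eq_prod k F hB, Dfactor_eq_prod k F hB,
    mul_div_right_comm, ← Finset.prod_div_distrib]
  congr 1
  refine Finset.prod_congr rfl fun m hm => ?_
  rw [← Finset.prod_div_distrib]
  refine Finset.prod_congr rfl fun h hh => ?_
  rw [← zpow_sub₀ (hs m hm h hh).2, exponent, sub_sub_cancel]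

/-- With c = c_p one has m(-c - s) + h = 1 - (m s + (c m - h + 1)); so ζ̂(1 - s) = ζ̂(s) turns the
reflection of s into h ↦ c m - h + 1, under which the exponents are invariant. Factors with m = 0 do
not involve s. -/
lemma Dfactor_symm : (fun s => Dfactor b p k F (-cp b p - s)) =ᶠ[codiscrete ℂ]
    fun s => Dfactor b p k F s := by
  obtain ⟨B, hB⟩ := exists_bound b p
  obtain ⟨c, hc, -⟩ := exists_symmetry_perm b p
  filter_upwards [eventually_forall_box hZ B] with s hs
  rw [Dfactor_eq_prod k F hB, Dfactor_eq_prod k F hB]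
  refine Finset.prod_congr rfl fun m hm => ?_
  rcases Nat.eq_zero_or_pos m with rfl | hm0
  · simp
  classical
  -- The reflection need not preserve the interval from 2 to B, but it preserves the set of h with
  -- nonzero exponent.
  have hfilter : ∀ f : ℕ → ℂ, ∏ h ∈ Finset.Ico 2 B, f h ^ exponent b p m h =
      ∏ h ∈ (Finset.Ico 2 B).filter (fun h : ℕ => exponent b p m h ≠ 0), f h ^ exponent b p m h := by
    intro f
    symm
    refine Finset.prod_filter_of_ne fun h _ hne h0 => hne ?_
    rw [h0, zpow_zero]
  rw [hfilter, hfilter]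
  have hmem : ∀ h ∈ Finset.Ico 2 B, exponent b p m h ≠ 0 →
      2 ≤ c * m - h + 1 ∧ c * m - h + 1 < B := by
    intro h hh hne
    rw [exponent_symm b p hc] at hne
    have h1 : 2 ≤ c * m - h + 1 := by
      by_contra hcon
      exact hne (exponent_eq_zero_of_le b p (by exact_mod_cast hm0) (by omega))
    refine ⟨h1, ?_⟩
    by_contra hcon
    exact hne (exponent_eq_zero_of_bound hB h1 (Or.inr (by omega)))
  have hmaps : ∀ h ∈ (Finset.Ico 2 B).filter fun h : ℕ => exponent b p m h ≠ 0,
      (c * m - h + 1).toNat ∈ (Finset.Ico 2 B).filter fun h : ℕ => exponent b p m h ≠ 0 := by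
    intro h hh
    rw [Finset.mem_filter] at hh ⊢
    have h1 := hmem h hh.1 hh.2
    refine ⟨by rw [Finset.mem_Ico]; omega, ?_⟩
    rw [Int.toNat_of_nonneg (by omega), ← exponent_symm b p hc]
    exact hh.2
  refine Finset.prod_nbij' (fun h => (c * m - h + 1).toNat) (fun h => (c * m - h + 1).toNat)
    hmaps hmaps ?_ ?_ ?_
  · intro h hh
    rw [Finset.mem_filter] at hh
    have h1 := hmem h hh.1 hh.2
    omega
  · intro h hh
    rw [Finset.mem_filter] at hh
    have h1 := hmem h hh.1 hh.2
    omega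
  · intro h hh
    have hh' := hmaps h hh
    rw [Finset.mem_filter] at hh hh'
    have h1 := hmem h hh.1 hh.2
    have h2 := (hs m hm _ hh'.1).1
    have h3 : (((c * m - h + 1).toNat : ℕ) : ℂ) = c * m - h + 1 := by
      rw [← Int.cast_natCast, Int.toNat_of_nonneg (by omega)]
      push_cast
      rfl
    rw [Int.toNat_of_nonneg (by omega), ← exponent_symm b p hc]
    congr 1
    rw [← hZ.apply_one_sub _ h2, h3, hc]
    congr 1
    ring

end Denominator

end GroupZeta

namespace GroupZeta

/-! ### The period in coordinates -/

section Coordinates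

variable {ι V V' : Type*} [AddCommGroup V] [Module ℂ V] [AddCommGroup V'] [Module ℂ V']
  {P : RootPairing ι ℂ V V'} (b : P.Base) (p : b.support)

lemma prod_map_list_eq [Fintype ι] [DecidableEq ι] {l : List b.support} (hl : l.Nodup)
    (hlp : ∀ j, j ∈ l ↔ j ≠ p) (g : ι → ℂ) :
    (l.map fun j : b.support => g j).prod = ∏ i with i ∈ b.support ∧ i ≠ p, g i := by
  classical
  rw [← List.prod_toFinset _ hl]
  refine Finset.prod_bij' (fun j _ => (j : ι)) (fun i hi => ⟨i, (Finset.mem_filter.mp hi).2.1⟩)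
    ?_ ?_ ?_ ?_ ?_
  · intro j hj
    rw [List.mem_toFinset, hlp] at hj
    rw [Finset.mem_filter]
    exact ⟨Finset.mem_univ _, j.2, fun h => hj (Subtype.ext h)⟩
  · intro i hi
    rw [List.mem_toFinset, hlp]
    exact fun h => (Finset.mem_filter.mp hi).2.2 (congrArg Subtype.val h)
  · exact fun _ _ => rfl
  · exact fun _ _ => rfl
  · exact fun _ _ => rfl

variable [P.IsRootSystem]

lemma coroot'_weightOfCoords_of_mem (x : b.support → ℂ) (j : b.support) :
    P.coroot' j (weightOfCoords b x) = 1 + x j := by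
  classical
  rw [weightOfCoords, map_sum, Finset.sum_eq_single j]
  · rw [map_smul, coroot'_fundamentalWeight_of_mem b j j.2, if_pos rfl, smul_eq_mul, mul_one]
  · intro i _ hij
    rw [map_smul, coroot'_fundamentalWeight_of_mem b i j.2,
      if_neg fun h => hij (Subtype.ext h).symm, smul_zero]
  · simp

lemma analyticAt_coroot'_weightOfCoords (i : ι) (x : b.support → ℂ) :
    AnalyticAt ℂ (fun x => P.coroot' i (weightOfCoords b x)) x := by
  have h : (fun x => P.coroot' i (weightOfCoords b x)) = fun x : b.support → ℂ =>
      ∑ j, (1 + x j) * P.coroot' i (fundamentalWeight b j) := by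
    funext x
    rw [weightOfCoords, map_sum]
    simp only [map_smul, smul_eq_mul]
  rw [h]
  refine Finset.analyticAt_fun_sum _ fun j _ => ?_
  refine AnalyticAt.mul (analyticAt_const.add ?_) analyticAt_const
  exact (ContinuousLinearMap.proj (R := ℂ) (φ := fun _ : b.support => ℂ) j).analyticAt x

variable [Fintype ι] [P.IsCrystallographic] [P.IsReduced]

open Classical in
-- At the base point of the residues, λ = ρ + s λ_p.
lemma coroot'_weightOfCoords_single (s : ℂ) (i : ι) :
    P.coroot' i (weightOfCoords b (Pi.single p s)) = coLevel b p i * s + b.flip.height i := by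
  obtain ⟨f, h1, -⟩ := exists_coroot_eq_sum b i
  rw [← coroot'_fundamentalWeight, ← ht_eq_flip_height, ht, coroot'_eq_sum h1, coroot'_eq_sum h1,
    coroot'_eq_sum h1, Finset.sum_mul, ← Finset.sum_add_distrib]
  refine Finset.sum_congr rfl fun j hj => ?_
  have h2 := coroot'_weightOfCoords_of_mem b (Pi.single p s) ⟨j, hj⟩
  simp only at h2
  rw [h2, coroot'_fundamentalWeight_of_mem b p hj, coroot'_rho_of_mem b hj, Pi.single_apply]
  by_cases h : j = p
  · rw [if_pos h, if_pos (Subtype.ext h)]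
    ring
  · rw [if_neg h, if_neg fun h' => h (congrArg Subtype.val h')]
    ring

noncomputable instance : Fintype P.weylGroup := Fintype.ofFinite _

open Classical in
/-- The period as a sum of products over all roots. -/
lemma period_eq_sum (k F : Type*) [Field k] [Field F] [Algebra k F] (x : V) :
    period b k F x = ∑ w : P.weylGroup, ∏ i,
      ((if b.flip.height (w • i) = 1 then
          (1 - (Nat.card k : ℂ) ^ (-(P.coroot' i x - 1)))⁻¹ else 1) *
        if 0 < b.flip.height i ∧ ¬ 0 < b.flip.height (w • i) then
          completedZeta k F (P.coroot' i x) / completedZeta k F (P.coroot' i x + 1) else 1) := by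
  rw [period, finsum_eq_sum_of_fintype]
  refine Finset.sum_congr rfl fun w _ => ?_
  rw [Finset.prod_mul_distrib, ← Finset.prod_filter, ← Finset.prod_filter, ← Finset.prod_inv_distrib]
  congr 1
  · refine Finset.prod_nbij' (fun i => w⁻¹ • i) (fun i => w • i) ?_ ?_ ?_ ?_ ?_
    · intro i hi
      rw [Finset.mem_filter, smul_inv_smul, flip_height_eq_one_iff]
      exact ⟨Finset.mem_univ _, hi⟩
    · intro i hi
      rw [Finset.mem_filter, flip_height_eq_one_iff] at hi
      exact hi.2
    · exact fun i _ => smul_inv_smul w i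
    · exact fun i _ => inv_smul_smul w i
    · intro i hi
      rw [map_sub, coroot'_smul, coroot'_rho_of_mem b hi]
  · refine Finset.prod_congr (Finset.filter_congr fun i _ => ?_) fun _ _ => rfl
    rw [isPos_iff_flip_height, isPos_iff_flip_height]

end Coordinates

end GroupZeta

namespace GroupZeta

/-! ### The iterated residue of the period -/

section PeriodFormula

lemma cpow_natCast_ne_one {q : ℕ} (hq : 1 < q) {s : ℂ} (hs : s.re ≠ 0) : (q : ℂ) ^ s ≠ 1 := by
  have := cpow_natCast_pow_ne_one hq one_pos hs
  rwa [pow_one] at this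

lemma eventually_cpow_affine_ne_one {q : ℕ} (hq : 1 < q) {m h : ℤ} (hmh : m ≠ 0 ∨ h ≠ 0) :
    ∀ᶠ s in codiscrete ℂ, 1 - (q : ℂ) ^ (-(m * s + h : ℂ)) ≠ 0 := by
  have hq0 : (q : ℂ) ≠ 0 := by exact_mod_cast (by omega : q ≠ 0)
  have hx : ∃ x : ℂ, (m * x + h : ℂ).re ≠ 0 := by
    by_cases hm : m = 0
    · refine ⟨0, ?_⟩
      have : h ≠ 0 := hmh.resolve_left (not_not.mpr hm)
      simpa using this
    · refine ⟨(1 - h) / m, ?_⟩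
      rw [mul_div_cancel₀ _ (by exact_mod_cast hm), sub_add_cancel]
      simp
  obtain ⟨x, hx⟩ := hx
  have hdiff : Differentiable ℂ fun s : ℂ => 1 - (q : ℂ) ^ (-(m * s + h : ℂ)) := fun s =>
    (DifferentiableAt.const_cpow (by fun_prop) (Or.inl hq0)).const_sub 1
  refine AnalyticOnNhd.preimage_zero_mem_codiscrete (x := x) (fun s _ => hdiff.analyticAt s) ?_
  exact sub_ne_zero.mpr (cpow_natCast_ne_one hq (by rwa [Complex.neg_re, neg_ne_zero])).symm

/-- The factor of the period at a root that stays analytic at the points where the residues are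
taken. Here `m`, `h` are the level and the height of the root, `n` is the height of its image under
the Weyl group element. -/
noncomputable def regularFactor (Z : ℂ → ℂ) (q : ℕ) (m h n : ℤ) (y : ℂ) : ℂ :=
  if m = 0 ∧ h = 1 then (if 0 < n then 1 else (Z (y + 1))⁻¹)
  else (if n = 1 then (1 - (q : ℂ) ^ (-(y - 1)))⁻¹ else 1) *
    if 0 < h ∧ ¬ 0 < n then Z y / Z (y + 1) else 1

/-- The factor of the period at a simple root along which a residue is taken. -/
noncomputable def polarFactor (Z : ℂ → ℂ) (q : ℕ) (n : ℤ) (y : ℂ) : ℂ :=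
  if n = 1 then (1 - (q : ℂ) ^ (-(y - 1)))⁻¹ else if 0 < n then 1 else Z y

/-- For a root of Δ_p at most one singular factor occurs: the geometric one needs wα simple, the
zeta one needs wα < 0. All poles along the coordinate hyperplanes are thus at most simple. -/
lemma regularFactor_mul_polarFactor (Z : ℂ → ℂ) (q : ℕ) (m h n : ℤ) (y : ℂ) :
    (if n = 1 then (1 - (q : ℂ) ^ (-(y - 1)))⁻¹ else 1) *
        (if 0 < h ∧ ¬ 0 < n then Z y / Z (y + 1) else 1) =
      regularFactor Z q m h n y * if m = 0 ∧ h = 1 then polarFactor Z q n y else 1 := by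
  unfold regularFactor polarFactor
  by_cases h1 : m = 0 ∧ h = 1
  · rw [if_pos h1, if_pos h1]
    have hh : 0 < h := by omega
    by_cases h2 : n = 1
    · have hn : 0 < n := by omega
      simp [h2]
    · by_cases h3 : 0 < n
      · simp [h2, h3]
      · simp [h2, h3, hh, div_eq_inv_mul]
  · rw [if_neg h1, if_neg h1, mul_one]

variable {ι V V' : Type*} [Fintype ι] [AddCommGroup V] [Module ℂ V] [AddCommGroup V'] [Module ℂ V']
  {P : RootPairing ι ℂ V V'} (b : P.Base) (p : b.support)
  (k F : Type*) [Field k] [Field F] [Algebra k F]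

/-- The points at which the residue that defines `ω_X^{(G,P)}` can be evaluated. -/
structure IsRegularPoint (U : Set ℂ) (s : ℂ) : Prop where
  cpow_ne : ∀ i, ¬ (coLevel b p i = 0 ∧ b.flip.height i = 1) →
    1 - (Nat.card k : ℂ) ^ (-(coLevel b p i * s + b.flip.height i - 1 : ℂ)) ≠ 0
  mem : ∀ i, 0 < b.flip.height i → ¬ (coLevel b p i = 0 ∧ b.flip.height i = 1) →
    (coLevel b p i * s + b.flip.height i : ℂ) ∈ U
  add_one_mem : ∀ i, 0 < b.flip.height i → (coLevel b p i * s + b.flip.height i + 1 : ℂ) ∈ U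
  ne_zero : ∀ i, 0 < b.flip.height i →
    completedZeta k F (coLevel b p i * s + b.flip.height i + 1) ≠ 0

variable {U : Set ℂ} (hZ : IsCompletedZeta (completedZeta k F) U) [Finite k]
include hZ

/-- The roots of Δ_p are the only positive ones whose factor is singular for every s. For the other
positive roots the argument is either a nonconstant affine function of s or an integer ≥ 2. -/
lemma eventually_isRegularPoint : ∀ᶠ s in codiscrete ℂ, IsRegularPoint b p k F U s := by
  have hq : 1 < Nat.card k := Finite.one_lt_card
  have h1 : ∀ᶠ s in codiscrete ℂ, ∀ i, ¬ (coLevel b p i = 0 ∧ b.flip.height i = 1) →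
      1 - (Nat.card k : ℂ) ^ (-(coLevel b p i * s + b.flip.height i - 1 : ℂ)) ≠ 0 := by
    rw [eventually_all]
    intro i
    by_cases hi : coLevel b p i = 0 ∧ b.flip.height i = 1
    · exact Eventually.of_forall fun s h => absurd hi h
    · filter_upwards [eventually_cpow_affine_ne_one hq (m := coLevel b p i)
        (h := b.flip.height i - 1) (by omega)] with s hs _
      rw [add_sub_assoc]
      simpa using hs
  have h2 : ∀ᶠ s in codiscrete ℂ, ∀ i, 0 < b.flip.height i →
      ¬ (coLevel b p i = 0 ∧ b.flip.height i = 1) →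
      (coLevel b p i * s + b.flip.height i : ℂ) ∈ U := by
    rw [eventually_all]
    intro i
    by_cases hi : 0 < b.flip.height i ∧ ¬ (coLevel b p i = 0 ∧ b.flip.height i = 1)
    · filter_upwards [hZ.eventually_affine (m := coLevel b p i)
        (h := b.flip.height i) (by omega)] with s hs _ _
      exact hs.1
    · exact Eventually.of_forall fun s h h' => absurd ⟨h, h'⟩ hi
  have h3 : ∀ᶠ s in codiscrete ℂ, ∀ i, 0 < b.flip.height i →
      (coLevel b p i * s + b.flip.height i + 1 : ℂ) ∈ U ∧
      completedZeta k F (coLevel b p i * s + b.flip.height i + 1) ≠ 0 := by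
    rw [eventually_all]
    intro i
    by_cases hi : 0 < b.flip.height i
    · filter_upwards [hZ.eventually_affine (m := coLevel b p i)
        (h := b.flip.height i + 1) (by omega)] with s hs _
      rw [add_assoc]
      simpa using hs
    · exact Eventually.of_forall fun s h => absurd h hi
  filter_upwards [h1, h2, h3] with s h1 h2 h3
  exact ⟨h1, h2, fun i hi => (h3 i hi).1, fun i hi => (h3 i hi).2⟩

variable [P.IsRootSystem] [P.IsCrystallographic] [P.IsReduced]

open Classical in
lemma analyticAt_regularFactor {s : ℂ} (hs : IsRegularPoint b p k F U s) (i : ι) (n : ℤ) :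
    AnalyticAt ℂ (fun x => regularFactor (completedZeta k F) (Nat.card k) (coLevel b p i)
      (b.flip.height i) n (P.coroot' i (weightOfCoords b x))) (Pi.single p s) := by
  have hq0 : (Nat.card k : ℂ) ≠ 0 := by exact_mod_cast Nat.card_pos.ne'
  have hlin := analyticAt_coroot'_weightOfCoords (P := P) b i (Pi.single p s)
  have hval := coroot'_weightOfCoords_single b p s i
  have hcomp : ∀ {φ : ℂ → ℂ}, AnalyticAt ℂ φ (coLevel b p i * s + b.flip.height i) →
      AnalyticAt ℂ (fun x => φ (P.coroot' i (weightOfCoords b x))) (Pi.single p s) := by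
    intro φ hφ
    rw [← hval] at hφ
    exact AnalyticAt.comp (f := fun x => P.coroot' i (weightOfCoords b x)) hφ hlin
  have hshift : 0 < b.flip.height i → AnalyticAt ℂ (fun y => completedZeta k F (y + 1))
      (coLevel b p i * s + b.flip.height i) := fun hi =>
    (hZ.analyticAt _ (hs.add_one_mem i hi)).comp (f := fun y => y + 1) (by fun_prop)
  refine hcomp (φ := fun y => regularFactor (completedZeta k F) (Nat.card k) (coLevel b p i)
      (b.flip.height i) n y) ?_
  unfold regularFactor
  split_ifs with h1 h2 h3 h4 h5
  · exact analyticAt_const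
  · exact (hshift (by omega)).inv (hs.ne_zero i (by omega))
  all_goals
    refine AnalyticAt.mul ?_ ?_
    all_goals first
      | exact analyticAt_const
      | exact (hZ.analyticAt _ (hs.mem i (by omega) h1)).div (hshift (by omega))
          (hs.ne_zero i (by omega))
      | refine AnalyticAt.inv ?_ (hs.cpow_ne i h1)
        refine Differentiable.analyticAt (fun y => ?_) _
        exact (DifferentiableAt.const_cpow (by fun_prop) (Or.inl hq0)).const_sub 1

open Classical in
/-- The iterated residue of the period. -/
lemma exists_parabolicPeriod_eq_sum : ∃ a R : ℂ, ∀ (l : List b.support) (_ : l.Nodup)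
    (_ : ∀ j, j ∈ l ↔ j ≠ p) (s : ℂ), IsRegularPoint b p k F U s →
    parabolicPeriod b p k F l s = ∑ w : P.weylGroup,
      ∏ i, (regularFactor (completedZeta k F) (Nat.card k) (coLevel b p i) (b.flip.height i)
          (b.flip.height (w • i)) (coLevel b p i * s + b.flip.height i) *
        if coLevel b p i = 0 ∧ b.flip.height i = 1 then
          (if b.flip.height (w • i) = 1 then a else if 0 < b.flip.height (w • i) then 0 else R)
        else 1) := by
  have hq : 1 < Nat.card k := Finite.one_lt_card
  have hq0 : (Nat.card k : ℂ) ≠ 0 := by exact_mod_cast Nat.card_pos.ne'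
  have hlog : Complex.log (Nat.card k : ℂ) ≠ 0 := by
    rw [← Complex.natCast_log]
    have : 0 < Real.log (Nat.card k) := Real.log_pos (by exact_mod_cast hq)
    exact_mod_cast this.ne'
  have hderiv : HasDerivAt (fun z : ℂ => 1 - (Nat.card k : ℂ) ^ (-z))
      (Complex.log (Nat.card k)) 0 := by
    have h2 := ((hasDerivAt_id (0 : ℂ)).neg.const_cpow (c := (Nat.card k : ℂ))
      (Or.inl hq0)).const_sub 1
    convert! h2 using 1
    simp
  obtain ⟨v, hv, -, hveq⟩ := exists_simple_pole (f := fun z : ℂ => 1 - (Nat.card k : ℂ) ^ (-z))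
    (z₀ := 0) (Differentiable.analyticAt (fun z =>
      (DifferentiableAt.const_cpow (by fun_prop) (Or.inl hq0)).const_sub 1) 0) (by simp)
    (by rw [hderiv.deriv]; exact hlog)
  obtain ⟨u, hu, hueq⟩ := hZ.simple_pole
  -- The residues at 0 of (1 - q^{-z})⁻¹ and of ζ̂(1 + z). They are fixed before the list l, so the
  -- result does not depend on the order of the residues.
  refine ⟨v 0, u 0, fun l hl hlp s hs => ?_⟩
  -- Numerators over z. A factor without pole is written 1 = z / z, and its numerator vanishes at 0,
  -- so such a w contributes nothing.
  set φ : P.weylGroup → ι → ℂ → ℂ := fun w i z =>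
    if b.flip.height (w • i) = 1 then v z else if 0 < b.flip.height (w • i) then z else u z with hφ
  set H : P.weylGroup → (b.support → ℂ) → ℂ := fun w x =>
    ∏ i, regularFactor (completedZeta k F) (Nat.card k) (coLevel b p i) (b.flip.height i)
      (b.flip.height (w • i)) (P.coroot' i (weightOfCoords b x)) with hH
  have hHan : ∀ w, AnalyticAt ℂ (H w) (Pi.single p s) := fun w =>
    Finset.analyticAt_fun_prod _ fun i _ => analyticAt_regularFactor b p k F hZ hs i _
  have e1 : ∀ᶠ x in 𝓝 (Pi.single p s : b.support → ℂ), ∀ w, AnalyticAt ℂ (H w) x :=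
    eventually_all.mpr fun w => (hHan w).eventually_analyticAt
  have e2 : ∀ᶠ z in 𝓝 (0 : ℂ), AnalyticAt ℂ v z ∧ AnalyticAt ℂ u z ∧
      (z ≠ 0 → completedZeta k F (1 + z) = u z / z) := by
    rw [eventually_nhdsWithin_iff] at hueq
    filter_upwards [hv.eventually_analyticAt, hu.eventually_analyticAt, hueq] with z h1 h2 h3
    exact ⟨h1, h2, h3⟩
  obtain ⟨ε₁, hε₁, h1⟩ := Metric.eventually_nhds_iff_ball.mp e1
  obtain ⟨ε₂, hε₂, h2⟩ := Metric.eventually_nhds_iff_ball.mp e2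
  have hbase : ∀ j : b.support, j ≠ p → coLevel b p j = 0 ∧ b.flip.height (j : ι) = 1 :=
    fun j hj => (mem_levi_base_iff b p j).mp ⟨j.2, fun h => hj (Subtype.ext h)⟩
  have hprod : ∀ g : ι → ℂ, (l.map fun j : b.support => g j).prod =
      ∏ i, if coLevel b p i = 0 ∧ b.flip.height i = 1 then g i else 1 := by
    intro g
    rw [prod_map_list_eq b p hl hlp, ← Finset.prod_filter]
    refine Finset.prod_congr (Finset.filter_congr fun i _ => mem_levi_base_iff b p i) fun _ _ => rfl
  have hres := iteratedResidue_sum_of_simple_poles l hl (s₀ := Pi.single p s)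
    (fun j hj => by simp [(hlp j).mp hj]) (ε := min ε₁ ε₂) (lt_min hε₁ hε₂)
    (u := fun w (j : b.support) => φ w j) (H := H)
    (Ψ := fun x => period b k F (weightOfCoords b x)) ?_ ?_ ?_
  · rw [parabolicPeriod]
    refine Eq.trans ?_ (hres.trans (Finset.sum_congr rfl fun w _ => ?_))
    · congr!
    · rw [hprod fun i => φ w i 0, hH, Finset.prod_mul_distrib]
      simp only [coroot'_weightOfCoords_single]
      rfl
  · intro w j z hz
    have hz' := h2 z (Metric.ball_subset_ball (min_le_right _ _) hz)
    refine DifferentiableAt.differentiableWithinAt ?_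
    simp only [hφ]
    split_ifs
    · exact hz'.1.differentiableAt
    · exact differentiableAt_id
    · exact hz'.2.1.differentiableAt
  · intro w x hx
    have hx' := h1 x (Metric.ball_subset_ball (min_le_left _ _) hx) w
    exact hx'.differentiableAt.differentiableWithinAt
  · intro x hx hne
    have hxj : ∀ j : b.support, j ≠ p → x j ∈ Metric.ball (0 : ℂ) ε₂ := by
      intro j hj
      have h3 : dist (x j) ((Pi.single p s : b.support → ℂ) j) < ε₂ :=
        (dist_le_pi_dist x _ j).trans_lt (lt_of_lt_of_le hx (min_le_right _ _))
      rwa [Pi.single_eq_of_ne hj] at h3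
    change period b k F (weightOfCoords b x) = _
    rw [period_eq_sum]
    refine Finset.sum_congr rfl fun w _ => ?_
    rw [Finset.prod_congr rfl fun i _ => regularFactor_mul_polarFactor (completedZeta k F)
      (Nat.card k) (coLevel b p i) (b.flip.height i) (b.flip.height (w • i))
      (P.coroot' i (weightOfCoords b x)), Finset.prod_mul_distrib,
      ← hprod fun i => polarFactor (completedZeta k F) (Nat.card k)
      (b.flip.height (w • i)) (P.coroot' i (weightOfCoords b x))]
    congr 2
    refine List.map_congr_left fun j hj => ?_
    have hjp : j ≠ p := (hlp j).mp hj
    have hj0 : x j ≠ 0 := hne j hj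
    rw [coroot'_weightOfCoords_of_mem]
    simp only [polarFactor, hφ, add_sub_cancel_left]
    have h3 := h2 _ (hxj j hjp)
    split_ifs
    · have := hveq (x j) hj0
      rwa [sub_zero] at this
    · rw [div_self hj0]
    · exact h3.2.2 hj0

end PeriodFormula

end GroupZeta

namespace GroupZeta

/-! ### The explicit form of Ω and its functional equation -/

section FunctionalEquation

/-- The factor of `Ω_X^{(G,P)}` at a root. -/
noncomputable def omegaFactor (Z : ℂ → ℂ) (q : ℕ) (a R : ℂ) (m h n : ℤ) (y : ℂ) : ℂ :=
  if m = 0 ∧ h = 1 then (if n = 1 then a else if 0 < n then 0 else R)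
  else if n = 1 then (1 - (q : ℂ) ^ (-(y - 1)))⁻¹ else if 0 < n then 1 else Z y

variable {ι V V' : Type*} [Fintype ι] [AddCommGroup V] [Module ℂ V] [AddCommGroup V'] [Module ℂ V']
  {P : RootPairing ι ℂ V V'} (b : P.Base) (p : b.support) [P.IsRootSystem]

/-- The explicit form of `Ω_X^{(G,P)}`. -/
noncomputable def omegaSum (Z : ℂ → ℂ) (q : ℕ) (a R s : ℂ) : ℂ :=
  ∑ w : P.weylGroup, ∏ i, omegaFactor Z q a R (coLevel b p i) (b.flip.height i)
    (b.flip.height (w • i)) (coLevel b p i * s + b.flip.height i)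

lemma meromorphic_omegaSum {Z : ℂ → ℂ} {U : Set ℂ} (hZ : IsCompletedZeta Z U) {q : ℕ}
    (hq : q ≠ 0) (a R : ℂ) : Meromorphic (omegaSum b p Z q a R) := by
  have hq0 : (q : ℂ) ≠ 0 := by exact_mod_cast hq
  intro s
  refine MeromorphicAt.fun_sum fun w _ => MeromorphicAt.fun_prod fun i _ => ?_
  unfold omegaFactor
  split_ifs
  · exact MeromorphicAt.const _ _
  · exact MeromorphicAt.const _ _
  · exact MeromorphicAt.const _ _
  · refine MeromorphicAt.inv (AnalyticAt.meromorphicAt ?_)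
    refine Differentiable.analyticAt (fun y => ?_) _
    exact (DifferentiableAt.const_cpow (by fun_prop) (Or.inl hq0)).const_sub 1
  · exact MeromorphicAt.const _ _
  · exact hZ.meromorphic_affine _ _ s

variable [P.IsCrystallographic] [P.IsReduced]

/-- Each factor depends only on level, height, height of the image and level · s + height. Under s ↦
-c_p - s these data for (τ w, α) become those for (w, σα), except for the sign of the level and the
shift of the height, which do not affect membership in Δ_p. -/
lemma omegaSum_symm (Z : ℂ → ℂ) (q : ℕ) (a R s : ℂ) :
    omegaSum b p Z q a R (-cp b p - s) = omegaSum b p Z q a R s := by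
  obtain ⟨c, hc, σ, τ, h1, h2, h3⟩ := exists_symmetry_perm b p
  rw [omegaSum, omegaSum, ← Equiv.sum_comp τ]
  refine Finset.sum_congr rfl fun w _ => ?_
  rw [← Equiv.prod_comp σ fun i => omegaFactor Z q a R (coLevel b p i) (b.flip.height i)
    (b.flip.height (w • i)) (coLevel b p i * s + b.flip.height i)]
  refine Finset.prod_congr rfl fun i _ => ?_
  have h4 : (coLevel b p i * (-cp b p - s) + b.flip.height i : ℂ) =
      coLevel b p (σ i) * s + b.flip.height (σ i) := by
    rw [h1, h2, hc]
    push_cast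
    ring
  have h5 : (coLevel b p i = 0 ∧ b.flip.height i = 1) ↔
      (coLevel b p (σ i) = 0 ∧ b.flip.height (σ i) = 1) := by
    rw [h1, h2, neg_eq_zero]
    refine and_congr_right fun h => ?_
    rw [h, mul_zero, sub_zero]
  rw [h3, h4]
  unfold omegaFactor
  simp only [h5]

variable {k F : Type*} [Field k] [Field F] [Algebra k F] [Finite k]
  {U : Set ℂ} (hZ : IsCompletedZeta (completedZeta k F) U)
include hZ

/-- The full factor cancels every ζ̂(y + 1) in the denominators. What remains of it is moved to
negative roots by ζ̂(1 - s) = ζ̂(s), which makes positive and negative roots enter alike. -/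
lemma exists_Omega_eventuallyEq : ∃ a R : ℂ, ∀ (l : List b.support) (_ : l.Nodup)
    (_ : ∀ j, j ∈ l ↔ j ≠ p),
    Omega b p k F l =ᶠ[codiscrete ℂ] omegaSum b p (completedZeta k F) (Nat.card k) a R := by
  classical
  obtain ⟨a, R, hper⟩ := exists_parabolicPeriod_eq_sum b p k F hZ
  refine ⟨a, R, fun l hl hlp => ?_⟩
  filter_upwards [eventually_isRegularPoint b p k F hZ] with s hs
  rw [Omega, hper l hl hlp s hs, omegaSum, Finset.mul_sum]
  refine Finset.sum_congr rfl fun w _ => ?_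
  set Z := completedZeta k F with hZdef
  set f : ι → ℂ := fun i => coLevel b p i * s + b.flip.height i with hf
  have hfull : fullFactor b p k F s = ∏ i, if 0 < b.flip.height i then Z (f i + 1) else 1 := by
    rw [fullFactor, ← Finset.prod_filter]
    refine Finset.prod_congr (Finset.filter_congr fun i _ => isPos_iff_flip_height b i) fun i _ => ?_
    rw [coroot'_fundamentalWeight, ht_eq_flip_height]
  -- Substituting -α for α: the factor ζ̂(-y) of a negative root sent to a negative one equals ζ̂(y
  -- + 1) for its opposite.
  have hneg : (∏ i, if ¬ 0 < b.flip.height i ∧ ¬ 0 < b.flip.height (w • i) then Z (f i) else 1) =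
      ∏ i, if 0 < b.flip.height i ∧ 0 < b.flip.height (w • i) then Z (f i + 1) else 1 := by
    have hinv : Function.Involutive fun i : ι => P.reflectionPerm i i :=
      reflectionPerm_self_reflectionPerm_self
    rw [← Equiv.prod_comp hinv.toPerm]
    refine Finset.prod_congr rfl fun i _ => ?_
    change (if ¬ 0 < b.flip.height (P.reflectionPerm i i) ∧
      ¬ 0 < b.flip.height (w • P.reflectionPerm i i) then Z (f (P.reflectionPerm i i)) else 1) = _
    have h1 : b.flip.height i ≠ 0 := b.flip.height_ne_zero _
    have h2 : b.flip.height (w • i) ≠ 0 := b.flip.height_ne_zero _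
    have h4 := flip_height_neg b i
    have h5 : b.flip.height (w • P.reflectionPerm i i) = -b.flip.height (w • i) := by
      rw [smul_reflectionPerm_self, flip_height_neg]
    by_cases h3 : 0 < b.flip.height i ∧ 0 < b.flip.height (w • i)
    · rw [if_pos h3, if_pos (by omega), ← hZ.apply_one_sub _ (hs.add_one_mem i h3.1)]
      congr 1
      simp only [hf]
      rw [coLevel_neg, flip_height_neg]
      push_cast
      ring
    · rw [if_neg h3, if_neg (by omega)]
  have hsplit : ∀ i, omegaFactor Z (Nat.card k) a R (coLevel b p i) (b.flip.height i)
      (b.flip.height (w • i)) (f i) =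
      (if coLevel b p i = 0 ∧ b.flip.height i = 1 then
        (if b.flip.height (w • i) = 1 then a else if 0 < b.flip.height (w • i) then 0 else R)
        else if b.flip.height (w • i) = 1 then (1 - (Nat.card k : ℂ) ^ (-(f i - 1)))⁻¹ else
        if 0 < b.flip.height (w • i) then 1 else if 0 < b.flip.height i then Z (f i) else 1) *
      if ¬ 0 < b.flip.height i ∧ ¬ 0 < b.flip.height (w • i) then Z (f i) else 1 := by
    intro i
    unfold omegaFactor
    by_cases h1 : coLevel b p i = 0 ∧ b.flip.height i = 1
    · have h2 : 0 < b.flip.height i := by omega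
      simp [h1]
    · by_cases h2 : b.flip.height (w • i) = 1
      · simp [h1, h2]
      · by_cases h3 : 0 < b.flip.height (w • i)
        · simp [h1, h2, h3]
        · by_cases h4 : 0 < b.flip.height i
          · simp [h1, h2, h3, h4]
          · simp [h1, h2, h3, h4]
  refine Eq.trans ?_ ((Finset.prod_congr rfl fun i _ => hsplit i).trans
    (Finset.prod_mul_distrib.trans (congrArg₂ HMul.hMul rfl hneg))).symm
  rw [← Finset.prod_mul_distrib, hfull, ← Finset.prod_mul_distrib]
  refine Finset.prod_congr rfl fun i _ => ?_
  change _ * (regularFactor Z _ _ _ _ (f i) * _) = _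
  unfold regularFactor
  have hne := hs.ne_zero i
  change 0 < b.flip.height i → Z (f i + 1) ≠ 0 at hne
  by_cases h1 : coLevel b p i = 0 ∧ b.flip.height i = 1
  · have h2 : 0 < b.flip.height i := by omega
    by_cases h3 : 0 < b.flip.height (w • i)
    · simp only [if_pos h1, if_pos h2, if_pos h3, if_pos (And.intro h2 h3)]
      ring
    · have h4 : b.flip.height (w • i) ≠ 1 := by omega
      have := hne h2
      simp only [if_pos h1, if_pos h2, if_neg h3, if_neg h4, if_neg fun h : _ ∧ _ => h3 h.2]
      field_simp
  · by_cases h2 : 0 < b.flip.height i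
    · have := hne h2
      by_cases h3 : 0 < b.flip.height (w • i)
      · by_cases h4 : b.flip.height (w • i) = 1
        · simp [h1, h2, h4]
          ring
        · simp [h1, h2, h3, h4]
      · have h4 : b.flip.height (w • i) ≠ 1 := by omega
        simp [h1, h2, h3, h4]
        field_simp
    · by_cases h3 : 0 < b.flip.height (w • i)
      · by_cases h4 : b.flip.height (w • i) = 1
        · simp [h1, h2, h4]
        · simp [h1, h2, h3, h4]
      · have h4 : b.flip.height (w • i) ≠ 1 := by omega
        simp [h1, h2, h3, h4]

end FunctionalEquation

end GroupZeta

/-! ### Conclusion -/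

theorem proposition7
    {k F : Type*} [Field k] [Finite k] [Field F] [Algebra k F]
    (hF : GroupZeta.IsCurveFunctionField k F)
    {ι V V' : Type*} [Fintype ι] [AddCommGroup V] [Module ℂ V] [AddCommGroup V'] [Module ℂ V']
    (P : RootPairing ι ℂ V V') [P.IsRootSystem] [P.IsCrystallographic] [P.IsReduced]
    (b : P.Base) (p : b.support)
    (l : List b.support) (hl : l.Nodup) (hlp : ∀ j, j ∈ l ↔ j ≠ p) :
    (Meromorphic (GroupZeta.Dfactor b p k F) ∧ Meromorphic (GroupZeta.Omega b p k F l)) ∧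
    (fun s => GroupZeta.groupZeta b p k F l s) =ᶠ[Filter.codiscrete ℂ]
      (fun s => GroupZeta.Omega b p k F l s / GroupZeta.Dfactor b p k F s) ∧
    (fun s => GroupZeta.Dfactor b p k F (-GroupZeta.cp b p - s)) =ᶠ[Filter.codiscrete ℂ]
      (fun s => GroupZeta.Dfactor b p k F s) ∧
    (fun s => GroupZeta.Omega b p k F l (-GroupZeta.cp b p - s)) =ᶠ[Filter.codiscrete ℂ]
      (fun s => GroupZeta.Omega b p k F l s) := by
  obtain ⟨U, hZ⟩ := hF.isCompletedZeta
  obtain ⟨a, R, hΩ⟩ := GroupZeta.exists_Omega_eventuallyEq b p hZ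
  have hΩl := hΩ l hl hlp
  refine ⟨⟨GroupZeta.meromorphic_Dfactor b p hZ, ?_⟩,
    GroupZeta.groupZeta_eventuallyEq b p hZ l, GroupZeta.Dfactor_symm b p hZ, ?_⟩
  · exact (GroupZeta.meromorphic_omegaSum b p hZ Nat.card_pos.ne' a R).congr_codiscrete hΩl.symm
  -- The explicit form of Ω must hold both at s and at -c_p - s; the reflection preserves codiscrete
  -- sets.
  · have hrefl : Tendsto (fun s : ℂ => -GroupZeta.cp b p - s) (codiscrete ℂ) (codiscrete ℂ) := by
      refine (GroupZeta.tendsto_affine_codiscrete (a := -1) (by norm_num)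
        (-GroupZeta.cp b p)).congr fun s => ?_
      ring
    filter_upwards [hΩl, hrefl.eventually hΩl] with s h1 h2
    rw [h1, h2, GroupZeta.omegaSum_symm]
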